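/- Let $m\ge 2$, $I=\mathbb Z/m\mathbb Z$, and let $Q$ be the framed cyclic quiver with vertex set $I\sqcup\{\infty\}$ and arrows $x_i:i\to i+1$ $(i\in I)$, $v:0\to\infty$. Let $\bar Q$ be its double, with opposite arrows $y_i=x_i^*:i+1\to i$, $w=v^*:\infty\to 0$, signs $\varepsilon(x_i)=\varepsilon(v)=1$, $\varepsilon(y_i)=\varepsilon(w)=-1$, and the order $y_{i-1}<x_i$ (and $y_{m-1}<x_0<v$ at $0$) on the arrows starting at each vertex. Paths are composed from left to right. Let $A$ be the path algebra $\mathbb C\bar Q$ with all $1+aa^*$ $(a\in\bar Q)$ inverted, equipped with the double bracket $\{\!\{-,-\}\!\}$ defined by Van den Bergh's bivector $$P=\tfrac12\sum_{a\in\bar Q}\varepsilon(a)(1+a^*a)\frac{\partial}{\partial a}\frac{\partial}{\partial a^*}-\tfrac12\sum_{a<b,\ t(a)=t(b)}F_aF_b,\qquad F_a=\frac{\partial}{\partial a^*}a^*-a\frac{\partial}{\partial a},$$ where $t(a)$ is the tail of $a$, and let $\Phi=\sum_s\Phi_s$, $\Phi_s=\prod_{t(a)=s}(e_s+aa^*)^{\varepsilon(a)}$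 (ordered product), be the multiplicative moment map. Let $\alpha\in\mathbb N^I$, $q\in(\mathbb C^\times)^I$, $\tilde\alpha=(1,\alpha)$, $\tilde q=q^{-\alpha}e_\infty+\sum_i q_ie_i$ with $q^{-\alpha}=\prod_i q_i^{-\alpha_i}$, $\Lambda^{\tilde q}=A/(\Phi-\tilde q)$, and let $\mathcal M_{\alpha,q}=\operatorname{Rep}(\Lambda^{\tilde q},\tilde\alpha)/\!/\operatorname{GL}_{\tilde\alpha}$, so that $\mathcal O(\mathcal M_{\alpha,q})=\mathcal O(\operatorname{Rep}(\Lambda^{\tilde q},\tilde\alpha))^{\operatorname{GL}_{\tilde\alpha}}$. Let $\{-,-\}$ be the biderivation of $\mathcal O(\operatorname{Rep}(A,\tilde\alpha))$ with $\{a_{ij},b_{uv}\}=\{\!\{a,b\}\!\}'_{uj}\{\!\{a,b\}\!\}''_{iv}$ for all $a,b\in A$. There is a unique bracket on $\mathcal O(\mathcal M_{\alpha,q})$ (the Poisson bracket obtained by quasi-Hamiltonian reduction) such that $\{F,G\}$ is the restriction of $\{f,g\}$ to $\operatorname{Rep}(\Lambda^{\tilde q},\tilde\alpha)$ whenever $f,g\in\mathcal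 O(\operatorname{Rep}(A,\tilde\alpha))$ restrict to the invariant functions $F,G$; and it extends uniquely to a biderivation on the coordinate ring $\mathcal O(\mathcal M_{\alpha,q})[\det X^{-1}]$ of the open subset $\mathcal M^0_{\alpha,q}\subset\mathcal M_{\alpha,q}$ on which $X$ is invertible. Here $X=X_0+\dots+X_{m-1}$ and $Y=Y_0+\dots+Y_{m-1}$ are the endomorphisms of $\mathcal V=\bigoplus_{i\in I}\mathbb C^{\alpha_i}$ given by the matrices $X_i,Y_i$ representing $x_i,y_i$. The endomorphism $1+XY$ is invertible on $\operatorname{Rep}(\Lambda^{\tilde q},\tilde\alpha)$, and $Y+X^{-1}$ is invertible wherever $X$ is. With respect to these brackets, each of the following four families consists of pairwise Poisson commuting functions: $$\{\operatorname{tr}X^{jm}\mid j\in\mathbb N\},\qquad \{\operatorname{tr}Y^{jm}\mid j\in\mathbb N\},\qquad \{\operatorname{tr}(1+XY)^j\mid j\in\mathbb Z\}$$ on $\mathcal M_{\alpha,q}$, and $\{\operatorname{tr}(Y+X^{-1})^{jm}\mid j\in\mathbb Z\}$ on $\mathcal M^0_{\alpha,q}$. -/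

import Mathlib

open scoped TensorProduct

namespace CyclicQuiver

/-! ## The double of the framed cyclic quiver -/

/-- Vertices of the framed cyclic quiver: `some i` is the vertex `i ∈ ℤ/mℤ`,
`none` is the framing vertex `∞`. -/
abbrev Vertex (m : ℕ) : Type := Option (ZMod m)

/-- Arrows of the doubled quiver: `(some i, false)` is `x_i : i → i + 1`, `(none, false)` is
`v : 0 → ∞`, and `(·, true)` are the opposite arrows `y_i : i + 1 → i` and `w : ∞ → 0`. -/
abbrev Arrow (m : ℕ) : Type := Option (ZMod m) × Bool

variable {m : ℕ}

/-- The involution `a ↦ a*`. -/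
def Arrow.star (a : Arrow m) : Arrow m := (a.1, !a.2)

/-- The tail (starting vertex) of an arrow. -/
def Arrow.tail : Arrow m → Vertex m
  | (some i, false) => some i
  | (none, false) => some 0
  | (some i, true) => some (i + 1)
  | (none, true) => none

/-- The head (final vertex) of an arrow. -/
def Arrow.head (a : Arrow m) : Vertex m := a.star.tail

/-- The sign `ε`: `1` on `x_i`, `v` and `-1` on `y_i`, `w`. -/
def Arrow.sign (a : Arrow m) : ℂ := if a.2 then -1 else 1

/-- Auxiliary numbers which encode the order of the arrows that start at a given vertex. -/
def Arrow.rank : Arrow m → ℕ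
  | (some _, true) => 0
  | (some _, false) => 1
  | (none, false) => 2
  | (none, true) => 3

/-- The order on the arrows starting at a common vertex: `y_{i-1} < x_i` at `i ≠ 0`,
and `y_{m-1} < x_0 < v` at `0` (at `∞` only `w` starts). -/
def Arrow.Before (a b : Arrow m) : Prop := a.tail = b.tail ∧ a.rank < b.rank

instance : DecidableRel (Arrow.Before (m := m)) := fun a b => by
  unfold Arrow.Before; infer_instance

/-! ## The localised path algebra -/

/-- Generators: the idempotents `e_i`, the arrows `a`, and the inverses of `1 + a a*`. -/
inductive Gen (m : ℕ) : Type
  | e (i : Vertex m)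
  | arr (a : Arrow m)
  | inv (a : Arrow m)

section
variable [NeZero m]

/-- Relations: the path algebra of the doubled quiver (paths composed from left to right),
with all `1 + a a*` inverted. -/
inductive Rel (m : ℕ) [NeZero m] : FreeAlgebra ℂ (Gen m) → FreeAlgebra ℂ (Gen m) → Prop
  | idem (i : Vertex m) : Rel m (.ι ℂ (.e i) * .ι ℂ (.e i)) (.ι ℂ (.e i))
  | orth (i j : Vertex m) (h : i ≠ j) : Rel m (.ι ℂ (.e i) * .ι ℂ (.e j)) 0
  | sum : Rel m (∑ i, .ι ℂ (.e i)) 1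
  | tail (a : Arrow m) : Rel m (.ι ℂ (.e a.tail) * .ι ℂ (.arr a)) (.ι ℂ (.arr a))
  | head (a : Arrow m) : Rel m (.ι ℂ (.arr a) * .ι ℂ (.e a.head)) (.ι ℂ (.arr a))
  | mul_inv (a : Arrow m) :
      Rel m ((1 + .ι ℂ (.arr a) * .ι ℂ (.arr a.star)) * .ι ℂ (.inv a)) 1
  | inv_mul (a : Arrow m) :
      Rel m (.ι ℂ (.inv a) * (1 + .ι ℂ (.arr a) * .ι ℂ (.arr a.star))) 1

/-- The algebra `A`: the path algebra of the doubled quiver with all `1 + a a*` inverted. -/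
def PathAlg (m : ℕ) [NeZero m] : Type := RingQuot (Rel m)

noncomputable instance : Ring (PathAlg m) := inferInstanceAs (Ring (RingQuot (Rel m)))

noncomputable instance : Algebra ℂ (PathAlg m) := inferInstanceAs (Algebra ℂ (RingQuot (Rel m)))

namespace PathAlg

/-- The quotient map from the free algebra to `A`. -/
noncomputable def mk : FreeAlgebra ℂ (Gen m) →ₐ[ℂ] PathAlg m := RingQuot.mkAlgHom ℂ (Rel m)

theorem mk_surjective : Function.Surjective (mk (m := m)) :=
  RingQuot.mkAlgHom_surjective ℂ (Rel m)

theorem mk_rel {p r : FreeAlgebra ℂ (Gen m)} (h : Rel m p r) : mk p = mk r :=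
  RingQuot.mkAlgHom_rel ℂ h

/-- Homomorphisms from `A` are given by the images of the generators. -/
noncomputable def lift {K : Type*} [Ring K] [Algebra ℂ K] (f : Gen m → K)
    (hf : ∀ ⦃p r⦄, Rel m p r → FreeAlgebra.lift ℂ f p = FreeAlgebra.lift ℂ f r) :
    PathAlg m →ₐ[ℂ] K :=
  RingQuot.liftAlgHom ℂ ⟨FreeAlgebra.lift ℂ f, hf⟩

theorem lift_mk {K : Type*} [Ring K] [Algebra ℂ K] (f : Gen m → K)
    (hf : ∀ ⦃p r⦄, Rel m p r → FreeAlgebra.lift ℂ f p = FreeAlgebra.lift ℂ f r)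
    (p : FreeAlgebra ℂ (Gen m)) : lift f hf (mk p) = FreeAlgebra.lift ℂ f p :=
  RingQuot.liftAlgHom_mkAlgHom_apply ℂ _ hf p

/-- The image in `A` of a generator. -/
noncomputable def gen (g : Gen m) : PathAlg m := mk (.ι ℂ g)

/-- The idempotent `e_i`. -/
noncomputable def e (i : Vertex m) : PathAlg m := gen (.e i)

/-- An arrow as an element of `A`. -/
noncomputable def arr (a : Arrow m) : PathAlg m := gen (.arr a)

/-- The element `(1 + a a*)⁻¹`. -/
noncomputable def inv (a : Arrow m) : PathAlg m := gen (.inv a)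

theorem e_mul_self (i : Vertex m) : e i * e i = e i := by
  simpa [e, gen] using mk_rel (Rel.idem (m := m) i)

theorem e_mul_ne {i j : Vertex m} (h : i ≠ j) : e i * e j = 0 := by
  simpa [e, gen] using mk_rel (Rel.orth (m := m) i j h)

theorem sum_e : ∑ i : Vertex m, e i = 1 := by
  simpa only [e, gen, map_sum, map_one] using mk_rel (Rel.sum (m := m))

theorem e_tail_mul (a : Arrow m) : e a.tail * arr a = arr a := by
  simpa [e, arr, gen] using mk_rel (Rel.tail (m := m) a)

theorem mul_e_head (a : Arrow m) : arr a * e a.head = arr a := by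
  simpa [e, arr, gen] using mk_rel (Rel.head (m := m) a)

theorem one_add_mul_inv (a : Arrow m) : (1 + arr a * arr a.star) * inv a = 1 := by
  simpa [inv, arr, gen] using mk_rel (Rel.mul_inv (m := m) a)

theorem inv_mul_one_add (a : Arrow m) : inv a * (1 + arr a * arr a.star) = 1 := by
  simpa [inv, arr, gen] using mk_rel (Rel.inv_mul (m := m) a)

end PathAlg

open PathAlg

/-! ## Double derivations and the double bracket

`A ⊗ A` is a ring in the usual way; its outer bimodule structure is
`b ξ c = (b ⊗ 1) * ξ * (1 ⊗ c)`. -/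

/-- The matrix `[[u ⊗ 1, d], [0, 1 ⊗ u]]`. A linear map `δ : A → A ⊗ A` is a derivation for the
outer bimodule structure if and only if `u ↦ [[u ⊗ 1, δ u], [0, 1 ⊗ u]]` is multiplicative. -/
noncomputable def tri (u : PathAlg m) (d : PathAlg m ⊗[ℂ] PathAlg m) :
    Matrix (Fin 2) (Fin 2) (PathAlg m ⊗[ℂ] PathAlg m) :=
  !![u ⊗ₜ 1, d; 0, 1 ⊗ₜ u]

theorem tri_mul (u u' : PathAlg m) (d d' : PathAlg m ⊗[ℂ] PathAlg m) :
    tri u d * tri u' d' = tri (u * u') ((u ⊗ₜ[ℂ] 1) * d' + d * ((1 : PathAlg m) ⊗ₜ[ℂ] u')) := by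
  simp [tri]

theorem tri_add (u u' : PathAlg m) (d d' : PathAlg m ⊗[ℂ] PathAlg m) :
    tri u d + tri u' d' = tri (u + u') (d + d') := by
  simp [tri, TensorProduct.add_tmul, TensorProduct.tmul_add]

theorem tri_zero : tri (0 : PathAlg m) 0 = 0 := by
  ext i j; fin_cases i <;> fin_cases j <;> simp [tri]

theorem tri_one : tri (1 : PathAlg m) 0 = 1 := by
  ext i j; fin_cases i <;> fin_cases j <;> simp [tri, Algebra.TensorProduct.one_def]

/-- The value on `b` of the double derivation `∂/∂a`: `e_{t(a)} ⊗ e_{h(a)}` if `b = a`,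
and `0` otherwise. -/
noncomputable def partialArr (a b : Arrow m) : PathAlg m ⊗[ℂ] PathAlg m :=
  if b = a then e a.tail ⊗ₜ e a.head else 0

/-- The value of `∂/∂a` on `1 + b b*`. -/
noncomputable def partialOneAdd (a b : Arrow m) : PathAlg m ⊗[ℂ] PathAlg m :=
  (arr b ⊗ₜ 1) * partialArr a b.star + partialArr a b * (1 ⊗ₜ arr b.star)

/-- The matrices `[[u ⊗ 1, ∂u/∂a], [0, 1 ⊗ u]]` for the generators `u` of `A`. -/
noncomputable def partialGen (a : Arrow m) :
    Gen m → Matrix (Fin 2) (Fin 2) (PathAlg m ⊗[ℂ] PathAlg m)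
  | .e i => tri (e i) 0
  | .arr b => tri (arr b) (partialArr a b)
  | .inv b => tri (inv b) (-((inv b ⊗ₜ 1) * partialOneAdd a b * (1 ⊗ₜ inv b)))

theorem partialGen_rel (a : Arrow m) ⦃p r : FreeAlgebra ℂ (Gen m)⦄ (h : Rel m p r) :
    FreeAlgebra.lift ℂ (partialGen a) p = FreeAlgebra.lift ℂ (partialGen a) r := by
  have hsum : ∀ s : Finset (Vertex m), ∑ i ∈ s, tri (e i) 0 = tri (∑ i ∈ s, e i) 0 := by
    intro s
    induction s using Finset.cons_induction with
    | empty => simp [tri_zero]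
    | cons i s hi ih => rw [Finset.sum_cons, Finset.sum_cons, ih, tri_add, add_zero]
  cases h with
  | idem i => simp [partialGen, tri_mul, e_mul_self]
  | orth i j h => simp [partialGen, tri_mul, e_mul_ne h, tri_zero]
  | sum => simp only [map_sum, FreeAlgebra.lift_ι_apply, partialGen, hsum, sum_e, tri_one, map_one]
  | tail b =>
    simp only [map_mul, FreeAlgebra.lift_ι_apply, partialGen, tri_mul, e_tail_mul]
    congr 1
    by_cases hb : b = a
    · subst hb; simp [partialArr, e_mul_self]
    · simp [partialArr, hb]
  | head b =>
    simp only [map_mul, FreeAlgebra.lift_ι_apply, partialGen, tri_mul, mul_e_head]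
    congr 1
    by_cases hb : b = a
    · subst hb; simp [partialArr, e_mul_self]
    · simp [partialArr, hb]
  | mul_inv b =>
    have h1 : tri (1 : PathAlg m) 0 + tri (arr b) (partialArr a b) *
        tri (arr b.star) (partialArr a b.star) =
        tri (1 + arr b * arr b.star) (partialOneAdd a b) := by
      simp [tri_mul, tri_add, partialOneAdd]
    simp only [map_mul, map_add, map_one, FreeAlgebra.lift_ι_apply, partialGen]
    rw [← tri_one, h1, tri_mul, one_add_mul_inv]
    congr 1
    rw [mul_neg, mul_assoc (inv b ⊗ₜ[ℂ] 1), ← mul_assoc, Algebra.TensorProduct.tmul_mul_tmul,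
      one_add_mul_inv, mul_one, ← Algebra.TensorProduct.one_def, one_mul, neg_add_cancel]
  | inv_mul b =>
    have h1 : tri (1 : PathAlg m) 0 + tri (arr b) (partialArr a b) *
        tri (arr b.star) (partialArr a b.star) =
        tri (1 + arr b * arr b.star) (partialOneAdd a b) := by
      simp [tri_mul, tri_add, partialOneAdd]
    simp only [map_mul, map_add, map_one, FreeAlgebra.lift_ι_apply, partialGen]
    rw [← tri_one, h1, tri_mul, inv_mul_one_add]
    congr 1
    rw [neg_mul, mul_assoc _ (1 ⊗ₜ[ℂ] inv b), Algebra.TensorProduct.tmul_mul_tmul,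
      inv_mul_one_add, mul_one, ← Algebra.TensorProduct.one_def, mul_one, add_neg_cancel]

/-- The algebra homomorphism `u ↦ [[u ⊗ 1, ∂u/∂a], [0, 1 ⊗ u]]`. -/
noncomputable def partialHom (a : Arrow m) :
    PathAlg m →ₐ[ℂ] Matrix (Fin 2) (Fin 2) (PathAlg m ⊗[ℂ] PathAlg m) :=
  PathAlg.lift (partialGen a) (partialGen_rel a)

/-- The double derivation `∂/∂a : A → A ⊗ A`. -/
noncomputable def dPartial (a : Arrow m) : PathAlg m →ₗ[ℂ] PathAlg m ⊗[ℂ] PathAlg m :=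
  Matrix.entryLinearMap ℂ _ 0 1 ∘ₗ (partialHom a).toLinearMap

theorem partialHom_gen (a : Arrow m) (g : Gen m) : partialHom a (gen g) = partialGen a g := by
  simp [partialHom, gen, lift_mk]

theorem dPartial_e (a : Arrow m) (i : Vertex m) : dPartial a (e i) = 0 := by
  simp [dPartial, e, partialHom_gen, partialGen, tri]

theorem dPartial_arr (a b : Arrow m) : dPartial a (arr b) = partialArr a b := by
  simp [dPartial, arr, partialHom_gen, partialGen, tri]

theorem partialHom_eq (a : Arrow m) (u : PathAlg m) :
    partialHom a u = tri u (dPartial a u) := by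
  have key : ∀ p : FreeAlgebra ℂ (Gen m),
      ∃ d, partialHom a (mk p) = tri (mk p) d := by
    intro p
    induction p using FreeAlgebra.induction with
    | grade0 r =>
      refine ⟨0, ?_⟩
      rw [AlgHom.commutes, AlgHom.commutes]
      ext i j
      fin_cases i <;> fin_cases j <;>
        simp [tri, Matrix.algebraMap_matrix_apply, Algebra.TensorProduct.algebraMap_apply]
      rw [Algebra.algebraMap_eq_smul_one, TensorProduct.smul_tmul]
    | grade1 g =>
      have := partialHom_gen a g
      rw [gen] at this
      rw [this]
      cases g <;> exact ⟨_, rfl⟩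
    | mul p r hp hr =>
      obtain ⟨d, hd⟩ := hp
      obtain ⟨d', hd'⟩ := hr
      exact ⟨_, by rw [map_mul, map_mul, hd, hd', tri_mul]⟩
    | add p r hp hr =>
      obtain ⟨d, hd⟩ := hp
      obtain ⟨d', hd'⟩ := hr
      exact ⟨_, by rw [map_add, map_add, hd, hd', tri_add]⟩
  obtain ⟨p, rfl⟩ := mk_surjective u
  obtain ⟨d, hd⟩ := key p
  rw [hd]
  congr 1
  simp [dPartial, hd, tri]

/-- `∂/∂a` is a derivation for the outer bimodule structure. -/
theorem dPartial_mul (a : Arrow m) (u u' : PathAlg m) :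
    dPartial a (u * u') = (u ⊗ₜ[ℂ] 1) * dPartial a u' + dPartial a u * (1 ⊗ₜ[ℂ] u') := by
  have h := map_mul (partialHom a) u u'
  rw [partialHom_eq, partialHom_eq, partialHom_eq, tri_mul] at h
  simpa [tri] using congrFun (congrFun h 0) 1

/-- The inner bimodule structure on double derivations: `(b δ c)(u) = δ(u)' c ⊗ b δ(u)''`. -/
noncomputable def inner (b : PathAlg m) (δ : PathAlg m →ₗ[ℂ] PathAlg m ⊗[ℂ] PathAlg m)
    (c : PathAlg m) : PathAlg m →ₗ[ℂ] PathAlg m ⊗[ℂ] PathAlg m :=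
  TensorProduct.map (LinearMap.mulRight ℂ c) (LinearMap.mulLeft ℂ b) ∘ₗ δ

/-- The bilinear map `(p' ⊗ p'', r' ⊗ r'') ↦ r' p'' ⊗ p' r''`. -/
noncomputable def glue : PathAlg m ⊗[ℂ] PathAlg m →ₗ[ℂ] PathAlg m ⊗[ℂ] PathAlg m →ₗ[ℂ]
    PathAlg m ⊗[ℂ] PathAlg m :=
  TensorProduct.map₂ (LinearMap.mul ℂ (PathAlg m)).flip (LinearMap.mul ℂ (PathAlg m)) ∘ₗ
    (TensorProduct.comm ℂ (PathAlg m) (PathAlg m)).toLinearMap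

theorem glue_tmul (p p' r r' : PathAlg m) :
    glue (p ⊗ₜ[ℂ] p') (r ⊗ₜ[ℂ] r') = (r * p') ⊗ₜ[ℂ] (p * r') := by
  simp [glue]

/-- The double bracket defined by a product `δ₁ δ₂` of two double derivations:
`{{a,b}} = δ₂(b)' δ₁(a)'' ⊗ δ₁(a)' δ₂(b)'' - δ₁(b)' δ₂(a)'' ⊗ δ₂(a)' δ₁(b)''`. -/
noncomputable def bracketOf (δ₁ δ₂ : PathAlg m →ₗ[ℂ] PathAlg m ⊗[ℂ] PathAlg m) :
    PathAlg m →ₗ[ℂ] PathAlg m →ₗ[ℂ] PathAlg m ⊗[ℂ] PathAlg m :=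
  glue.compl₁₂ δ₁ δ₂ - glue.compl₁₂ δ₂ δ₁

/-- `F_a = (∂/∂a*) a* - a (∂/∂a)`. -/
noncomputable def fusionF (a : Arrow m) : PathAlg m →ₗ[ℂ] PathAlg m ⊗[ℂ] PathAlg m :=
  inner 1 (dPartial a.star) (arr a.star) - inner (arr a) (dPartial a) 1

/-- The double quasi-Poisson bracket on `A` defined by the bivector
`P = 1/2 ∑_a ε(a) (1 + a* a) ∂/∂a ∂/∂a* - 1/2 ∑_{a < b, t(a) = t(b)} F_a F_b`. -/
noncomputable def dgal (m : ℕ) [NeZero m] :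
    PathAlg m →ₗ[ℂ] PathAlg m →ₗ[ℂ] PathAlg m ⊗[ℂ] PathAlg m :=
  (1 / 2 : ℂ) • ∑ a : Arrow m, a.sign •
      bracketOf (inner (1 + arr a.star * arr a) (dPartial a) 1) (dPartial a.star)
    - (1 / 2 : ℂ) • ∑ a : Arrow m, ∑ b : Arrow m,
      if a.Before b then bracketOf (fusionF a) (fusionF b) else 0

/-- The derivation property for the outer bimodule structure. -/
def IsOuterDer (δ : PathAlg m →ₗ[ℂ] PathAlg m ⊗[ℂ] PathAlg m) : Prop :=
  ∀ u u', δ (u * u') = (u ⊗ₜ[ℂ] 1) * δ u' + δ u * (1 ⊗ₜ[ℂ] u')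

theorem IsOuterDer.sub {δ₁ δ₂ : PathAlg m →ₗ[ℂ] PathAlg m ⊗[ℂ] PathAlg m}
    (h₁ : IsOuterDer δ₁) (h₂ : IsOuterDer δ₂) : IsOuterDer (δ₁ - δ₂) := fun u u' => by
  simp only [LinearMap.sub_apply, h₁ u u', h₂ u u', mul_sub, sub_mul]; abel

theorem IsOuterDer.inner {δ : PathAlg m →ₗ[ℂ] PathAlg m ⊗[ℂ] PathAlg m}
    (h : IsOuterDer δ) (b c : PathAlg m) : IsOuterDer (inner b δ c) := fun u u' => by
  have h1 : ∀ ξ : PathAlg m ⊗[ℂ] PathAlg m,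
      TensorProduct.map (LinearMap.mulRight ℂ c) (LinearMap.mulLeft ℂ b) ((u ⊗ₜ[ℂ] 1) * ξ) =
        (u ⊗ₜ[ℂ] 1) *
          TensorProduct.map (LinearMap.mulRight ℂ c) (LinearMap.mulLeft ℂ b) ξ := fun ξ => by
    induction ξ with
    | zero => simp
    | tmul p q => simp [mul_assoc]
    | add p q hp hq => rw [mul_add, map_add, hp, hq, map_add, mul_add]
  have h2 : ∀ ξ : PathAlg m ⊗[ℂ] PathAlg m,
      TensorProduct.map (LinearMap.mulRight ℂ c) (LinearMap.mulLeft ℂ b) (ξ * (1 ⊗ₜ[ℂ] u')) =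
        TensorProduct.map (LinearMap.mulRight ℂ c) (LinearMap.mulLeft ℂ b) ξ *
          (1 ⊗ₜ[ℂ] u') := fun ξ => by
    induction ξ with
    | zero => simp
    | tmul p q => simp [mul_assoc]
    | add p q hp hq => rw [add_mul, map_add, hp, hq, map_add, add_mul]
  simp only [CyclicQuiver.inner, LinearMap.comp_apply, h u u', map_add, h1, h2]

theorem isOuterDer_dPartial (a : Arrow m) : IsOuterDer (dPartial a) := dPartial_mul a

theorem isOuterDer_fusionF (a : Arrow m) : IsOuterDer (fusionF a) :=
  ((isOuterDer_dPartial _).inner _ _).sub ((isOuterDer_dPartial _).inner _ _)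

theorem glue_left_mul (b : PathAlg m) (p r : PathAlg m ⊗[ℂ] PathAlg m) :
    glue p ((b ⊗ₜ[ℂ] 1) * r) = (b ⊗ₜ[ℂ] 1) * glue p r := by
  induction p with
  | zero => simp
  | add p q hp hq => simp only [map_add, LinearMap.add_apply, hp, hq, mul_add]
  | tmul p p' =>
    induction r with
    | zero => simp
    | add r q hr hq => simp only [map_add, hr, hq, mul_add]
    | tmul r r' => simp [glue_tmul, mul_assoc]

theorem glue_right_mul (c : PathAlg m) (p r : PathAlg m ⊗[ℂ] PathAlg m) :
    glue p (r * (1 ⊗ₜ[ℂ] c)) = glue p r * (1 ⊗ₜ[ℂ] c) := by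
  induction p with
  | zero => simp
  | add p q hp hq => simp only [map_add, LinearMap.add_apply, hp, hq, add_mul]
  | tmul p p' =>
    induction r with
    | zero => simp
    | add r q hr hq => simp only [map_add, hr, hq, add_mul]
    | tmul r r' => simp [glue_tmul, mul_assoc]

theorem glue_mul_left (b : PathAlg m) (p r : PathAlg m ⊗[ℂ] PathAlg m) :
    glue ((b ⊗ₜ[ℂ] 1) * p) r = (1 ⊗ₜ[ℂ] b) * glue p r := by
  induction p with
  | zero => simp
  | add p q hp hq => simp only [map_add, LinearMap.add_apply, hp, hq, mul_add]
  | tmul p p' =>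
    induction r with
    | zero => simp
    | add r q hr hq => simp only [map_add, hr, hq, mul_add]
    | tmul r r' => simp [glue_tmul, mul_assoc]

theorem glue_mul_right (c : PathAlg m) (p r : PathAlg m ⊗[ℂ] PathAlg m) :
    glue (p * (1 ⊗ₜ[ℂ] c)) r = glue p r * (c ⊗ₜ[ℂ] 1) := by
  induction p with
  | zero => simp
  | add p q hp hq => simp only [map_add, LinearMap.add_apply, hp, hq, add_mul]
  | tmul p p' =>
    induction r with
    | zero => simp
    | add r q hr hq => simp only [map_add, hr, hq, add_mul]
    | tmul r r' => simp [glue_tmul, mul_assoc]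

theorem bracketOf_mul_right {δ₁ δ₂ : PathAlg m →ₗ[ℂ] PathAlg m ⊗[ℂ] PathAlg m}
    (h₁ : IsOuterDer δ₁) (h₂ : IsOuterDer δ₂) (a b c : PathAlg m) :
    bracketOf δ₁ δ₂ a (b * c) =
      (b ⊗ₜ[ℂ] 1) * bracketOf δ₁ δ₂ a c + bracketOf δ₁ δ₂ a b * (1 ⊗ₜ[ℂ] c) := by
  simp only [bracketOf, LinearMap.sub_apply, LinearMap.compl₁₂_apply, h₁ b c, h₂ b c, map_add,
    glue_left_mul, glue_right_mul, mul_sub, sub_mul]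
  abel

theorem bracketOf_mul_left {δ₁ δ₂ : PathAlg m →ₗ[ℂ] PathAlg m ⊗[ℂ] PathAlg m}
    (h₁ : IsOuterDer δ₁) (h₂ : IsOuterDer δ₂) (a b c : PathAlg m) :
    bracketOf δ₁ δ₂ (a * b) c =
      (1 ⊗ₜ[ℂ] a) * bracketOf δ₁ δ₂ b c + bracketOf δ₁ δ₂ a c * (b ⊗ₜ[ℂ] 1) := by
  simp only [bracketOf, LinearMap.sub_apply, LinearMap.compl₁₂_apply, h₁ a b, h₂ a b, map_add,
    LinearMap.add_apply, glue_mul_left, glue_mul_right, mul_sub, sub_mul]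
  abel

theorem dgal_apply (a b : PathAlg m) :
    dgal m a b = (1 / 2 : ℂ) • ∑ c : Arrow m, c.sign •
      bracketOf (inner (1 + arr c.star * arr c) (dPartial c) 1) (dPartial c.star) a b
    - (1 / 2 : ℂ) • ∑ c : Arrow m, ∑ d : Arrow m,
      if c.Before d then bracketOf (fusionF c) (fusionF d) a b else 0 := by
  simp only [dgal, LinearMap.sub_apply, LinearMap.smul_apply, LinearMap.sum_apply]
  congr 2
  refine Finset.sum_congr rfl fun c _ => Finset.sum_congr rfl fun d _ => ?_
  split_ifs <;> rfl

/-- The double bracket is a derivation in its second argument, for the outer bimodule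
structure. -/
theorem dgal_mul_right (a b c : PathAlg m) :
    dgal m a (b * c) = (b ⊗ₜ[ℂ] 1) * dgal m a c + dgal m a b * (1 ⊗ₜ[ℂ] c) := by
  have h1 : ∀ d : Arrow m, _ := fun d => bracketOf_mul_right
    ((isOuterDer_dPartial d).inner (1 + arr d.star * arr d) 1) (isOuterDer_dPartial d.star) a b c
  have h2 : ∀ d d' : Arrow m, _ := fun d d' => bracketOf_mul_right
    (isOuterDer_fusionF d) (isOuterDer_fusionF d') a b c
  simp only [dgal_apply, h1, h2, mul_sub, sub_mul, mul_smul_comm, smul_mul_assoc, Finset.mul_sum,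
    Finset.sum_mul, mul_ite, ite_mul, mul_zero, zero_mul, smul_add, Finset.sum_add_distrib]
  have h3 : ∀ d d' : Arrow m, ∀ x y : PathAlg m ⊗[ℂ] PathAlg m,
      (if d.Before d' then x + y else 0) =
        (if d.Before d' then x else 0) + (if d.Before d' then y else 0) := by
    intros; split_ifs <;> simp
  simp only [h3, Finset.sum_add_distrib, smul_add]
  abel

/-- The double bracket is a derivation in its first argument, for the inner bimodule
structure. -/
theorem dgal_mul_left (a b c : PathAlg m) :
    dgal m (a * b) c = (1 ⊗ₜ[ℂ] a) * dgal m b c + dgal m a c * (b ⊗ₜ[ℂ] 1) := by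
  have h1 : ∀ d : Arrow m, _ := fun d => bracketOf_mul_left
    ((isOuterDer_dPartial d).inner (1 + arr d.star * arr d) 1) (isOuterDer_dPartial d.star) a b c
  have h2 : ∀ d d' : Arrow m, _ := fun d d' => bracketOf_mul_left
    (isOuterDer_fusionF d) (isOuterDer_fusionF d') a b c
  simp only [dgal_apply, h1, h2, mul_sub, sub_mul, mul_smul_comm, smul_mul_assoc, Finset.mul_sum,
    Finset.sum_mul, mul_ite, ite_mul, mul_zero, zero_mul, smul_add, Finset.sum_add_distrib]
  have h3 : ∀ d d' : Arrow m, ∀ x y : PathAlg m ⊗[ℂ] PathAlg m,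
      (if d.Before d' then x + y else 0) =
        (if d.Before d' then x else 0) + (if d.Before d' then y else 0) := by
    intros; split_ifs <;> simp
  simp only [h3, Finset.sum_add_distrib, smul_add]
  abel

theorem inner_e (b c : PathAlg m) (a : Arrow m) (i : Vertex m) :
    inner b (dPartial a) c (e i) = 0 := by
  simp [inner, dPartial_e]

/-- The double bracket is `B`-linear. -/
theorem dgal_e_right (a : PathAlg m) (i : Vertex m) : dgal m a (e i) = 0 := by
  simp [dgal_apply, bracketOf, fusionF, inner_e, dPartial_e]

theorem dgal_e_left (a : PathAlg m) (i : Vertex m) : dgal m (e i) a = 0 := by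
  simp [dgal_apply, bracketOf, fusionF, inner_e, dPartial_e]

end

/-! ## Representation spaces of algebras with a system of idempotents -/

section Rep

/-- The index set `⊔_i {1, …, α_i}` of rows and columns of block matrices. -/
abbrev RepIdx {V : Type} (α : V → ℕ) : Type := Σ i : V, Fin (α i)

variable {V : Type} [Fintype V] [DecidableEq V] {C : Type} [Ring C] [Algebra ℂ C]

/-- The block matrix which represents the idempotent at the vertex `s`. -/
def blockIdem (α : V → ℕ) (K : Type*) [CommRing K] (s : V) : Matrix (RepIdx α) (RepIdx α) K :=
  Matrix.diagonal fun i => if i.1 = s then 1 else 0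

open MvPolynomial in
/-- The relations between the coordinate functions `a_{ij}` (`a ∈ C`): linearity in `a`,
`(ab)_{ij} = ∑_k a_{ik} b_{kj}`, and the idempotents `e_s` are the block idempotents. -/
inductive RepRel (e : V → C) (α : V → ℕ) :
    MvPolynomial (C × RepIdx α × RepIdx α) ℂ → Prop
  | add (a b : C) (i j : RepIdx α) : RepRel e α (X (a + b, i, j) - (X (a, i, j) + X (b, i, j)))
  | smul (c : ℂ) (a : C) (i j : RepIdx α) :
      RepRel e α (X (c • a, i, j) - MvPolynomial.C c * X (a, i, j))
  | one (i j : RepIdx α) : RepRel e α (X (1, i, j) - if i = j then 1 else 0)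
  | mul (a b : C) (i j : RepIdx α) :
      RepRel e α (X (a * b, i, j) - ∑ k, X (a, i, k) * X (b, k, j))
  | idem (s : V) (i j : RepIdx α) : RepRel e α (X (e s, i, j) - blockIdem α _ s i j)

/-- The coordinate ring `O(Rep_B(C, α))` of the affine scheme of representations of `C` in which
the idempotents `e s` act as the block idempotents of block sizes `α s`. -/
def RepRing (e : V → C) (α : V → ℕ) : Type :=
  MvPolynomial (C × RepIdx α × RepIdx α) ℂ ⧸ Ideal.span {p | RepRel e α p}

namespace RepRing

variable (e : V → C) (α : V → ℕ)

noncomputable instance : CommRing (RepRing e α) :=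
  inferInstanceAs (CommRing (MvPolynomial _ ℂ ⧸ Ideal.span {p | RepRel e α p}))

noncomputable instance : Algebra ℂ (RepRing e α) :=
  inferInstanceAs (Algebra ℂ (MvPolynomial _ ℂ ⧸ Ideal.span {p | RepRel e α p}))

/-- The quotient map from the polynomial ring in the `a_{ij}`. -/
noncomputable def mk : MvPolynomial (C × RepIdx α × RepIdx α) ℂ →ₐ[ℂ] RepRing e α :=
  Ideal.Quotient.mkₐ ℂ _

variable {e α}

theorem mk_surjective : Function.Surjective (mk e α) := Ideal.Quotient.mk_surjective

theorem mk_rel {p : MvPolynomial (C × RepIdx α × RepIdx α) ℂ} (h : RepRel e α p) :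
    mk e α p = 0 :=
  Ideal.Quotient.eq_zero_iff_mem.2 (Ideal.subset_span h)

/-- The coordinate function `a_{ij}`. -/
noncomputable def coord (e : V → C) (α : V → ℕ) (a : C) (i j : RepIdx α) : RepRing e α :=
  mk e α (.X (a, i, j))

/-- The matrix-valued function `𝒳(a) = (a_{ij})`, as a function of `a`: this is the universal
representation of `C`. -/
noncomputable def univ (e : V → C) (α : V → ℕ) :
    C →ₐ[ℂ] Matrix (RepIdx α) (RepIdx α) (RepRing e α) :=
  AlgHom.ofLinearMap
    { toFun := fun a => Matrix.of (coord e α a)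
      map_add' := fun a b => by
        ext i j
        have := mk_rel (RepRel.add (e := e) a b i j)
        rw [map_sub, map_add, sub_eq_zero] at this
        exact this
      map_smul' := fun c a => by
        ext i j
        have := mk_rel (RepRel.smul (e := e) c a i j)
        rw [map_sub, sub_eq_zero, ← MvPolynomial.smul_eq_C_mul, map_smul] at this
        exact this }
    (by
      ext i j
      have := mk_rel (RepRel.one (e := e) i j)
      rw [map_sub, sub_eq_zero] at this
      refine Eq.trans this ?_
      by_cases h : i = j <;> simp [Matrix.one_apply, h])
    (fun a b => by
      ext i j
      have := mk_rel (RepRel.mul (e := e) a b i j)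
      rw [map_sub, sub_eq_zero, map_sum] at this
      refine Eq.trans this ?_
      simp [Matrix.mul_apply, coord])

theorem univ_apply (a : C) (i j : RepIdx α) : univ e α a i j = coord e α a i j := rfl

theorem univ_idem (s : V) : univ e α (e s) = blockIdem α _ s := by
  ext i j
  have := mk_rel (RepRel.idem (e := e) (α := α) s i j)
  rw [map_sub, sub_eq_zero] at this
  refine Eq.trans this ?_
  by_cases h : i = j
  · subst h; by_cases hs : i.1 = s <;> simp [blockIdem, hs]
  · simp [blockIdem, h]

theorem aeval_rel {K : Type} [CommRing K] [Algebra ℂ K]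
    (σ : C →ₐ[ℂ] Matrix (RepIdx α) (RepIdx α) K) (hσ : ∀ s, σ (e s) = blockIdem α K s)
    {p : MvPolynomial (C × RepIdx α × RepIdx α) ℂ} (h : RepRel e α p) :
    MvPolynomial.aeval (R := ℂ) (fun x : C × RepIdx α × RepIdx α => σ x.1 x.2.1 x.2.2) p = 0 := by
  cases h with
  | add a b i j => simp
  | smul c a i j =>
    rw [map_sub, map_mul, MvPolynomial.aeval_X, MvPolynomial.aeval_X, MvPolynomial.aeval_C,
      map_smul, Matrix.smul_apply, Algebra.smul_def, sub_self]
  | one i j => by_cases h : i = j <;> simp [h]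
  | mul a b i j => simp [Matrix.mul_apply]
  | idem s i j =>
    by_cases h : i = j
    · subst h; by_cases hs : i.1 = s <;> simp [blockIdem, hs, hσ]
    · simp [blockIdem, h, hσ]

/-- The universal property of `O(Rep_B(C, α))`: representations with values in a commutative
`ℂ`-algebra `K`. -/
noncomputable def lift {K : Type} [CommRing K] [Algebra ℂ K]
    (σ : C →ₐ[ℂ] Matrix (RepIdx α) (RepIdx α) K) (hσ : ∀ s, σ (e s) = blockIdem α K s) :
    RepRing e α →ₐ[ℂ] K :=
  Ideal.Quotient.liftₐ (Ideal.span {p | RepRel e α p})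
    (MvPolynomial.aeval fun x => σ x.1 x.2.1 x.2.2) fun _ hp =>
      (Ideal.span_le (I := RingHom.ker
        (MvPolynomial.aeval (R := ℂ) fun x : C × RepIdx α × RepIdx α => σ x.1 x.2.1 x.2.2))).2
        (fun _ h => aeval_rel σ hσ h) hp

theorem lift_coord {K : Type} [CommRing K] [Algebra ℂ K]
    (σ : C →ₐ[ℂ] Matrix (RepIdx α) (RepIdx α) K) (hσ : ∀ s, σ (e s) = blockIdem α K s)
    (a : C) (i j : RepIdx α) : lift σ hσ (coord e α a i j) = σ a i j := by
  exact MvPolynomial.aeval_X (R := ℂ) (fun x : C × RepIdx α × RepIdx α => σ x.1 x.2.1 x.2.2)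
    (a, i, j)

/-- The map of coordinate rings induced by a homomorphism of algebras over `B`. -/
noncomputable def map {D : Type} [Ring D] [Algebra ℂ D] {e' : V → D} (f : C →ₐ[ℂ] D)
    (hf : ∀ s, f (e s) = e' s) : RepRing e α →ₐ[ℂ] RepRing e' α :=
  lift ((univ e' α).comp f) fun s => by
    rw [AlgHom.comp_apply, hf, univ_idem]

/-- An element `g` of `GL_α = ∏_i GL_{α_i}` as a block diagonal matrix. -/
noncomputable def blockGL (K : Type*) [CommRing K] [Algebra ℂ K]
    (g : ∀ i : V, GL (Fin (α i)) ℂ) : Matrix (RepIdx α) (RepIdx α) K :=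
  Matrix.blockDiagonal' fun i => (g i).1.map (algebraMap ℂ K)

theorem blockGL_mul_inv (K : Type*) [CommRing K] [Algebra ℂ K]
    (g : ∀ i : V, GL (Fin (α i)) ℂ) : blockGL K g * blockGL K g⁻¹ = 1 := by
  have : ∀ i, (g i).1.map (algebraMap ℂ K) * ((g⁻¹) i).1.map (algebraMap ℂ K) = 1 := fun i => by
    rw [← Matrix.map_mul, Pi.inv_apply, ← Units.val_mul, mul_inv_cancel]
    simp
  rw [blockGL, blockGL, ← Matrix.blockDiagonal'_mul]
  simp_rw [this]
  exact Matrix.blockDiagonal'_one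

theorem blockGL_inv_mul (K : Type*) [CommRing K] [Algebra ℂ K]
    (g : ∀ i : V, GL (Fin (α i)) ℂ) : blockGL K g⁻¹ * blockGL K g = 1 := by
  simpa using blockGL_mul_inv K g⁻¹

theorem blockGL_comm_blockIdem (K : Type*) [CommRing K] [Algebra ℂ K]
    (g : ∀ i : V, GL (Fin (α i)) ℂ) (s : V) :
    blockGL K g * blockIdem α K s = blockIdem α K s * blockGL K g := by
  ext ⟨i, k⟩ ⟨j, l⟩
  rw [blockIdem, Matrix.mul_diagonal, Matrix.diagonal_mul]
  by_cases h : i = j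
  · subst h; simp [mul_comm]
  · simp [blockGL, Matrix.blockDiagonal'_apply, h]

/-- The action of `g ∈ GL_α` on `O(Rep_B(C, α))`, induced by the conjugation
`𝒳(a) ↦ g 𝒳(a) g⁻¹`. -/
noncomputable def act (g : ∀ i : V, GL (Fin (α i)) ℂ) : RepRing e α →ₐ[ℂ] RepRing e α :=
  lift
    (AlgHom.ofLinearMap
      (LinearMap.mulLeftRight ℂ (blockGL (RepRing e α) g, blockGL (RepRing e α) g⁻¹) ∘ₗ
        (univ e α).toLinearMap)
      (by simp [blockGL_mul_inv])
      (fun a b => by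
        simp only [LinearMap.comp_apply, LinearMap.mulLeftRight_apply, AlgHom.toLinearMap_apply,
          map_mul]
        have h := blockGL_inv_mul (RepRing e α) g
        calc _ = blockGL (RepRing e α) g * univ e α a * 1 * univ e α b *
              blockGL (RepRing e α) g⁻¹ := by simp only [mul_one, mul_assoc]
          _ = _ := by rw [← h]; simp only [mul_assoc]))
    (fun s => by
      change blockGL (RepRing e α) g * univ e α (e s) * blockGL (RepRing e α) g⁻¹ = _
      rw [univ_idem, blockGL_comm_blockIdem, mul_assoc, blockGL_mul_inv, mul_one])

theorem act_coord (g : ∀ i : V, GL (Fin (α i)) ℂ) (a : C) (i j : RepIdx α) :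
    act g (coord e α a i j) =
      (blockGL (RepRing e α) g * univ e α a * blockGL (RepRing e α) g⁻¹) i j :=
  lift_coord _ _ _ _ _

/-- The algebra of invariants `O(Rep_B(C, α))^{GL_α}`, i.e. the coordinate ring of the quotient
`Rep_B(C, α) // GL_α`. -/
noncomputable def invariants (e : V → C) (α : V → ℕ) : Subalgebra ℂ (RepRing e α) where
  carrier := {f | ∀ g : ∀ i : V, GL (Fin (α i)) ℂ, act g f = f}
  mul_mem' := fun hf hg g => by rw [map_mul, hf g, hg g]
  add_mem' := fun hf hg g => by rw [map_add, hf g, hg g]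
  algebraMap_mem' := fun c g => AlgHom.commutes _ c

theorem algHom_ext {K : Type*} [Semiring K] [Algebra ℂ K] {φ ψ : RepRing e α →ₐ[ℂ] K}
    (h : ∀ a i j, φ (coord e α a i j) = ψ (coord e α a i j)) : φ = ψ := by
  have : φ.comp (mk e α) = ψ.comp (mk e α) := MvPolynomial.algHom_ext fun x => h x.1 x.2.1 x.2.2
  ext f
  obtain ⟨p, rfl⟩ := mk_surjective f
  exact DFunLike.congr_fun this p

theorem derivation_ext {M : Type*} [AddCommGroup M] [Module ℂ M] [Module (RepRing e α) M]
    {φ ψ : Derivation ℂ (RepRing e α) M}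
    (h : ∀ a i j, φ (coord e α a i j) = ψ (coord e α a i j)) : φ = ψ := by
  have hadj : Algebra.adjoin ℂ
      (Set.range fun x : C × RepIdx α × RepIdx α => coord e α x.1 x.2.1 x.2.2) = ⊤ := by
    have := congrArg (Subalgebra.map (mk e α)) (MvPolynomial.adjoin_range_X (R := ℂ)
      (σ := C × RepIdx α × RepIdx α))
    rw [AlgHom.map_adjoin, ← Set.range_comp, Algebra.map_top,
      (AlgHom.range_eq_top _).2 mk_surjective] at this
    exact this
  refine Derivation.ext_of_adjoin_eq_top _ hadj ?_
  rintro _ ⟨x, rfl⟩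
  exact h x.1 x.2.1 x.2.2

theorem derivation_sum_apply {ι R N : Type*} [CommRing R] [Algebra ℂ R] [AddCommGroup N]
    [Module ℂ N] [Module R N] (s : Finset ι) (f : ι → Derivation ℂ R N) (x : R) :
    (∑ i ∈ s, f i) x = ∑ i ∈ s, f i x := by
  induction s using Finset.cons_induction with
  | empty => simp
  | cons i s hi ih => rw [Finset.sum_cons, Finset.sum_cons, Derivation.add_apply, ih]

section Derivation

variable {M : Type} [AddCommGroup M] [Module ℂ M] [Module (RepRing e α) M]
  [Module (RepRing e α)ᵐᵒᵖ M] [IsCentralScalar (RepRing e α) M] [IsScalarTower ℂ (RepRing e α) M]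
  [IsScalarTower ℂ (RepRing e α)ᵐᵒᵖ M]

/-- The homomorphism `a_{ij} ↦ a_{ij} + ε T(a)_{ij}` for a matrix-valued derivation `T`. -/
noncomputable def sqZeroHom (T : C →ₗ[ℂ] Matrix (RepIdx α) (RepIdx α) M)
    (hmul : ∀ a b i j, T (a * b) i j =
      ∑ k, (coord e α a i k • T b k j + coord e α b k j • T a i k))
    (hidem : ∀ s, T (e s) = 0) (hone : T 1 = 0) :
    RepRing e α →ₐ[ℂ] TrivSqZeroExt (RepRing e α) M :=
  lift (AlgHom.ofLinearMap
    { toFun := fun a => Matrix.of fun i j =>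
        (TrivSqZeroExt.inl (coord e α a i j) + TrivSqZeroExt.inr (T a i j) :
          TrivSqZeroExt (RepRing e α) M)
      map_add' := fun a b => by
        ext i j
        · simp [← univ_apply]
        · simp
      map_smul' := fun c a => by
        ext i j
        · simp [← univ_apply]
        · simp }
    (by
      ext i j
      · by_cases h : i = j
        · subst h; simp [← univ_apply]
        · simp [← univ_apply, h]
      · by_cases h : i = j
        · subst h; simp [hone]
        · simp [hone, h])
    (fun a b => by
      ext i j
      · simp [Matrix.mul_apply, ← univ_apply, TrivSqZeroExt.fst_sum]
      · simp [Matrix.mul_apply, hmul, TrivSqZeroExt.snd_sum]))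
    (fun s => by
      ext i j
      · by_cases h : i = j
        · subst h; by_cases hs : i.1 = s <;> simp [← univ_apply, univ_idem, blockIdem, hs]
        · simp [← univ_apply, univ_idem, blockIdem, h]
      · by_cases h : i = j
        · subst h; by_cases hs : i.1 = s <;> simp [hidem, blockIdem, hs]
        · simp [hidem, blockIdem, h])

variable (T : C →ₗ[ℂ] Matrix (RepIdx α) (RepIdx α) M)
    (hmul : ∀ a b i j, T (a * b) i j =
      ∑ k, (coord e α a i k • T b k j + coord e α b k j • T a i k))
    (hidem : ∀ s, T (e s) = 0) (hone : T 1 = 0)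

theorem sqZeroHom_coord (a : C) (i j : RepIdx α) :
    sqZeroHom T hmul hidem hone (coord e α a i j) =
      TrivSqZeroExt.inl (coord e α a i j) + TrivSqZeroExt.inr (T a i j) :=
  lift_coord _ _ _ _ _

theorem fst_sqZeroHom (f : RepRing e α) : (sqZeroHom T hmul hidem hone f).fst = f := by
  have : (TrivSqZeroExt.fstHom ℂ (RepRing e α) M).comp (sqZeroHom T hmul hidem hone) =
      AlgHom.id ℂ _ := algHom_ext fun a i j => by simp [sqZeroHom_coord]
  exact DFunLike.congr_fun this f

/-- The derivation of `O(Rep_B(C, α))` with `a_{ij} ↦ T(a)_{ij}`. -/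
noncomputable def derOf : Derivation ℂ (RepRing e α) M :=
  Derivation.mk' ((TrivSqZeroExt.sndHom (RepRing e α) M).restrictScalars ℂ ∘ₗ
      (sqZeroHom T hmul hidem hone).toLinearMap) fun f g => by
    simp [fst_sqZeroHom]

theorem derOf_coord (a : C) (i j : RepIdx α) :
    derOf T hmul hidem hone (coord e α a i j) = T a i j := by
  simp [derOf, sqZeroHom_coord]

end Derivation

end RepRing

end Rep

/-! ## The quasi-Poisson bracket on `Rep(A, α̃)` -/

section Bracket

variable [NeZero m]

/-- The dimension vector `α̃ = (1, α)`. -/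
def framed (α : ZMod m → ℕ) : Vertex m → ℕ
  | none => 1
  | some i => α i

/-- The coordinate ring of `Rep_B(A, α̃)`. -/
abbrev RepA (α : ZMod m → ℕ) : Type := RepRing (PathAlg.e (m := m)) (framed α)

open RepRing PathAlg

/-- The functional `c' ⊗ c'' ↦ c'_{uj} c''_{iv}`. -/
noncomputable def ev (α : ZMod m → ℕ) (u j i v : RepIdx (framed α)) :
    PathAlg m ⊗[ℂ] PathAlg m →ₗ[ℂ] RepA α :=
  TensorProduct.lift ((LinearMap.mul ℂ (RepA α)).compl₁₂
    (Matrix.entryLinearMap ℂ _ u j ∘ₗ (univ PathAlg.e (framed α)).toLinearMap)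
    (Matrix.entryLinearMap ℂ _ i v ∘ₗ (univ PathAlg.e (framed α)).toLinearMap))

variable {α : ZMod m → ℕ}

theorem ev_tmul (u j i v : RepIdx (framed α)) (c d : PathAlg m) :
    ev α u j i v (c ⊗ₜ d) = coord PathAlg.e (framed α) c u j * coord PathAlg.e (framed α) d i v := by
  rfl

theorem coord_mul {V C : Type} [Fintype V] [DecidableEq V] [Ring C] [Algebra ℂ C] {e : V → C}
    {α : V → ℕ} (a b : C) (i j : RepIdx α) :
    coord e α (a * b) i j = ∑ k, coord e α a i k * coord e α b k j := by
  simp only [← univ_apply, map_mul, Matrix.mul_apply]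

theorem ev_outer_left (u j i v : RepIdx (framed α)) (b : PathAlg m)
    (ξ : PathAlg m ⊗[ℂ] PathAlg m) : ev α u j i v ((b ⊗ₜ[ℂ] 1) * ξ) =
      ∑ k, coord PathAlg.e (framed α) b u k * ev α k j i v ξ := by
  induction ξ with
  | zero => simp
  | tmul p q => simp [ev_tmul, coord_mul, Finset.sum_mul, mul_assoc]
  | add p q hp hq => simp only [mul_add, map_add, hp, hq, Finset.sum_add_distrib]

theorem ev_outer_right (u j i v : RepIdx (framed α)) (c : PathAlg m)
    (ξ : PathAlg m ⊗[ℂ] PathAlg m) : ev α u j i v (ξ * (1 ⊗ₜ[ℂ] c)) =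
      ∑ k, coord PathAlg.e (framed α) c k v * ev α u j i k ξ := by
  induction ξ with
  | zero => simp
  | tmul p q =>
    simp only [Algebra.TensorProduct.tmul_mul_tmul, mul_one, ev_tmul, coord_mul, Finset.mul_sum]
    exact Finset.sum_congr rfl fun k _ => by ring
  | add p q hp hq => simp only [add_mul, mul_add, map_add, hp, hq, Finset.sum_add_distrib]

theorem ev_inner_left (u j i v : RepIdx (framed α)) (b : PathAlg m)
    (ξ : PathAlg m ⊗[ℂ] PathAlg m) : ev α u j i v ((1 ⊗ₜ[ℂ] b) * ξ) =
      ∑ k, coord PathAlg.e (framed α) b i k * ev α u j k v ξ := by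
  induction ξ with
  | zero => simp
  | tmul p q =>
    simp only [Algebra.TensorProduct.tmul_mul_tmul, one_mul, ev_tmul, coord_mul, Finset.mul_sum]
    exact Finset.sum_congr rfl fun k _ => by ring
  | add p q hp hq => simp only [mul_add, map_add, hp, hq, Finset.sum_add_distrib]

theorem ev_inner_right (u j i v : RepIdx (framed α)) (c : PathAlg m)
    (ξ : PathAlg m ⊗[ℂ] PathAlg m) : ev α u j i v (ξ * (c ⊗ₜ[ℂ] 1)) =
      ∑ k, coord PathAlg.e (framed α) c k j * ev α u k i v ξ := by
  induction ξ with
  | zero => simp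
  | tmul p q =>
    simp only [Algebra.TensorProduct.tmul_mul_tmul, mul_one, ev_tmul, coord_mul, Finset.sum_mul]
    exact Finset.sum_congr rfl fun k _ => by ring
  | add p q hp hq => simp only [add_mul, mul_add, map_add, hp, hq, Finset.sum_add_distrib]

theorem dgal_one_right (a : PathAlg m) : dgal m a 1 = 0 := by
  rw [← sum_e, map_sum]; simp [dgal_e_right]

theorem dgal_one_left (a : PathAlg m) : dgal m 1 a = 0 := by
  rw [← sum_e, map_sum, LinearMap.sum_apply]; simp [dgal_e_left]

/-- The derivation `{a_{ij}, -}`, with `{a_{ij}, b_{uv}} = {{a,b}}'_{uj} {{a,b}}''_{iv}`. -/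
noncomputable def coordBracket (α : ZMod m → ℕ) (a : PathAlg m) (i j : RepIdx (framed α)) :
    Derivation ℂ (RepA α) (RepA α) :=
  derOf
    { toFun := fun b => Matrix.of fun u v => ev α u j i v (dgal m a b)
      map_add' := fun b c => by ext u v; simp
      map_smul' := fun c b => by ext u v; simp }
    (fun b c u v => by
      simp [dgal_mul_right, ev_outer_left, ev_outer_right, Finset.sum_add_distrib])
    (fun s => by ext u v; simp [dgal_e_right])
    (by ext u v; simp [dgal_one_right])

theorem coordBracket_coord (a b : PathAlg m) (i j u v : RepIdx (framed α)) :
    coordBracket α a i j (coord PathAlg.e (framed α) b u v) = ev α u j i v (dgal m a b) :=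
  derOf_coord _ _ _ _ _ _ _

/-- The bracket `{-, -}` on `O(Rep_B(A, α̃))`: the biderivation with
`{a_{ij}, b_{uv}} = {{a,b}}'_{uj} {{a,b}}''_{iv}` for all `a, b ∈ A`. -/
noncomputable def repBracket (α : ZMod m → ℕ) :
    Derivation ℂ (RepA α) (Derivation ℂ (RepA α) (RepA α)) :=
  derOf
    { toFun := fun a => Matrix.of fun i j => coordBracket α a i j
      map_add' := fun a b => by
        refine Matrix.ext fun i j => derivation_ext fun c u v => ?_
        simp [coordBracket_coord]
      map_smul' := fun c b => by
        refine Matrix.ext fun i j => derivation_ext fun c u v => ?_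
        simp [coordBracket_coord] }
    (fun a b i j => derivation_ext fun c u v => by
      simp [coordBracket_coord, dgal_mul_left, ev_inner_left, ev_inner_right,
        Finset.sum_add_distrib, derivation_sum_apply])
    (fun s => by
      refine Matrix.ext fun i j => derivation_ext fun c u v => ?_
      simp [coordBracket_coord, dgal_e_left])
    (by
      refine Matrix.ext fun i j => derivation_ext fun c u v => ?_
      simp [coordBracket_coord, dgal_one_left])

theorem repBracket_coord (a b : PathAlg m) (i j u v : RepIdx (framed α)) :
    repBracket α (coord PathAlg.e (framed α) a i j) (coord PathAlg.e (framed α) b u v) =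
      ev α u j i v (dgal m a b) := by
  rw [repBracket, derOf_coord]
  exact coordBracket_coord _ _ _ _ _ _

end Bracket

/-! ## The multiplicative preprojective algebra and the multiplicative quiver variety -/

section Variety

variable [NeZero m]

open RepRing PathAlg

/-- The factor `(1 + a a*)^{ε(a)}` of the multiplicative moment map. -/
noncomputable def factor (a : Arrow m) : PathAlg m :=
  if a.2 then inv a else 1 + arr a * arr a.star

/-- The component `Φ_i = ∏_{t(a) = i} (e_i + a a*)^{ε(a)}` of the multiplicative moment map:
`Φ_∞ = (e_∞ + w v)⁻¹`, `Φ_0 = (e_0 + y_{m-1} x_{m-1})⁻¹ (e_0 + x_0 y_0) (e_0 + v w)` and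
`Φ_i = (e_i + y_{i-1} x_{i-1})⁻¹ (e_i + x_i y_i)` for `i ≠ 0, ∞`. -/
noncomputable def moment : Vertex m → PathAlg m
  | none => e none * factor (none, true)
  | some i => e (some i) * factor (some (i - 1), true) * factor (some i, false) *
      if i = 0 then factor (none, false) else 1

variable (α : ZMod m → ℕ) (q : ZMod m → ℂˣ)

/-- The parameter `q̃`, with `q̃_i = q_i` and `q̃_∞ = q^{-α} = ∏_i q_i^{-α_i}`. -/
noncomputable def framedParam : Vertex m → ℂˣ
  | none => (∏ i, q i ^ α i)⁻¹
  | some i => q i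

/-- The relations `Φ_i = q̃_i e_i`. -/
inductive RelPreproj : PathAlg m → PathAlg m → Prop
  | moment (i : Vertex m) : RelPreproj (moment i) ((framedParam α q i : ℂ) • e i)

/-- The multiplicative preprojective algebra `Λ^{q̃}`. -/
def Preproj : Type := RingQuot (RelPreproj α q)

noncomputable instance : Ring (Preproj α q) := inferInstanceAs (Ring (RingQuot (RelPreproj α q)))

noncomputable instance : Algebra ℂ (Preproj α q) :=
  inferInstanceAs (Algebra ℂ (RingQuot (RelPreproj α q)))

/-- The quotient map `A → Λ^{q̃}`. -/
noncomputable def toPreproj : PathAlg m →ₐ[ℂ] Preproj α q :=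
  RingQuot.mkAlgHom ℂ (RelPreproj α q)

/-- The coordinate ring of `Rep(Λ^{q̃}, α̃)`. -/
abbrev RepPreproj : Type :=
  RepRing (fun i : Vertex m => toPreproj α q (e i)) (framed α)

/-- The coordinate ring `O(M_{α,q}) = O(Rep(Λ^{q̃}, α̃))^{GL_α̃}` of the multiplicative quiver
variety `M_{α,q} = Rep(Λ^{q̃}, α̃) // GL_α̃`. (The scalars in `GL_α̃` act trivially, so that
these are also the invariants of `GL_α̃ / ℂˣ`.) -/
noncomputable abbrev QuiverVariety : Subalgebra ℂ (RepPreproj α q) :=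
  invariants (fun i : Vertex m => toPreproj α q (e i)) (framed α)

/-- The restriction of functions from `Rep(A, α̃)` to its closed subscheme
`Rep(Λ^{q̃}, α̃) = {Φ = q̃}`. -/
noncomputable def restrict : RepA α →ₐ[ℂ] RepPreproj α q :=
  RepRing.map (toPreproj α q) fun _ => rfl

/-- `br` is the Poisson bracket on `O(M_{α,q})` obtained from the quasi-Poisson bracket on `Rep(A, α̃)` by
quasi-Hamiltonian reduction: if the restrictions `F`, `G` of `f`, `g` to `{Φ = q̃}` are invariant,
then `{F, G}` is the restriction of `{f, g}`. -/
def IsReducedBracket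
    (br : QuiverVariety α q →ₗ[ℂ] QuiverVariety α q →ₗ[ℂ] QuiverVariety α q) : Prop :=
  ∀ (f g : RepA α) (F G : QuiverVariety α q), restrict α q f = F → restrict α q g = G →
    (br F G : RepPreproj α q) = restrict α q (repBracket α f g)

/-! ### The matrices `X`, `Y` and the open subset where `X` is invertible -/

/-- The indices of a basis of `𝒱 = ⊕_{i ∈ ℤ/m} 𝒱_i` (the vertex `∞` is left out). -/
abbrev CycIdx : Type := Σ i : ZMod m, Fin (α i)

variable {α} in
/-- The inclusion of the basis of `𝒱` into the basis of `𝒱_∞ ⊕ 𝒱`. -/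
def CycIdx.incl (k : CycIdx α) : RepIdx (framed α) := ⟨some k.1, k.2⟩

/-- The endomorphism of `𝒱` which represents an element of `A`, as a matrix of functions on
`Rep(Λ^{q̃}, α̃)`. -/
noncomputable def cycBlock (c : PathAlg m) : Matrix (CycIdx α) (CycIdx α) (RepPreproj α q) :=
  (univ (fun i : Vertex m => toPreproj α q (e i)) (framed α) (toPreproj α q c)).submatrix
    CycIdx.incl CycIdx.incl

/-- `X = X_0 + ⋯ + X_{m-1}`. -/
noncomputable def matX : Matrix (CycIdx α) (CycIdx α) (RepPreproj α q) :=
  ∑ i : ZMod m, cycBlock α q (arr (some i, false))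

/-- `Y = Y_0 + ⋯ + Y_{m-1}`. -/
noncomputable def matY : Matrix (CycIdx α) (CycIdx α) (RepPreproj α q) :=
  ∑ i : ZMod m, cycBlock α q (arr (some i, true))

variable {α q}

theorem blockGL_mul_submatrix (g : ∀ i : Vertex m, GL (Fin (framed α i)) ℂ)
    (U : Matrix (RepIdx (framed α)) (RepIdx (framed α)) (RepPreproj α q)) :
    (blockGL (RepPreproj α q) g * U).submatrix CycIdx.incl (CycIdx.incl (α := α)) =
      (blockGL (RepPreproj α q) g).submatrix CycIdx.incl CycIdx.incl *
        U.submatrix CycIdx.incl CycIdx.incl := by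
  ext ⟨i, k⟩ ⟨j, l⟩
  simp only [Matrix.submatrix_apply, Matrix.mul_apply, Fintype.sum_sigma, Fintype.sum_option]
  have h : ∀ x, blockGL (RepPreproj α q) g (CycIdx.incl ⟨i, k⟩) ⟨none, x⟩ = 0 := fun x => by
    simp [blockGL, CycIdx.incl, Matrix.blockDiagonal'_apply]
  simp only [h, zero_mul, Finset.sum_const_zero, zero_add]
  rfl

theorem mul_blockGL_submatrix (g : ∀ i : Vertex m, GL (Fin (framed α i)) ℂ)
    (U : Matrix (RepIdx (framed α)) (RepIdx (framed α)) (RepPreproj α q)) :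
    (U * blockGL (RepPreproj α q) g).submatrix CycIdx.incl (CycIdx.incl (α := α)) =
      U.submatrix CycIdx.incl CycIdx.incl *
        (blockGL (RepPreproj α q) g).submatrix CycIdx.incl CycIdx.incl := by
  ext ⟨i, k⟩ ⟨j, l⟩
  simp only [Matrix.submatrix_apply, Matrix.mul_apply, Fintype.sum_sigma, Fintype.sum_option]
  have h : ∀ x, blockGL (RepPreproj α q) g ⟨none, x⟩ (CycIdx.incl ⟨j, l⟩) = 0 := fun x => by
    simp [blockGL, CycIdx.incl, Matrix.blockDiagonal'_apply]
  simp only [h, mul_zero, Finset.sum_const_zero, zero_add]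
  rfl

theorem act_cycBlock (g : ∀ i : Vertex m, GL (Fin (framed α i)) ℂ) (c : PathAlg m) :
    (cycBlock α q c).map (act g) =
      (blockGL (RepPreproj α q) g).submatrix CycIdx.incl CycIdx.incl * cycBlock α q c *
        (blockGL (RepPreproj α q) g⁻¹).submatrix CycIdx.incl CycIdx.incl := by
  rw [cycBlock, ← blockGL_mul_submatrix, ← mul_blockGL_submatrix]
  ext i j
  exact act_coord _ _ _ _

theorem act_matX (g : ∀ i : Vertex m, GL (Fin (framed α i)) ℂ) :
    (matX α q).map (act g) =
      (blockGL (RepPreproj α q) g).submatrix CycIdx.incl CycIdx.incl * matX α q *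
        (blockGL (RepPreproj α q) g⁻¹).submatrix CycIdx.incl CycIdx.incl := by
  have : (matX α q).map (act g) = (act g).mapMatrix (matX α q) := rfl
  rw [this, matX, map_sum, Finset.mul_sum, Finset.sum_mul]
  exact Finset.sum_congr rfl fun i _ => act_cycBlock g _

theorem det_matX_mem : (matX α q).det ∈ QuiverVariety α q := fun g => by
  rw [AlgHom.map_det]
  have h : (act g).mapMatrix (matX α q) = _ := act_matX g
  rw [h, Matrix.det_mul, Matrix.det_mul, mul_right_comm, ← Matrix.det_mul,
    ← blockGL_mul_submatrix, blockGL_mul_inv]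
  have h1 : (1 : Matrix (RepIdx (framed α)) (RepIdx (framed α)) (RepPreproj α q)).submatrix
      CycIdx.incl (CycIdx.incl (α := α)) = 1 := by
    refine Matrix.submatrix_one _ ?_
    rintro ⟨i, k⟩ ⟨j, l⟩ h
    obtain ⟨h1, h2⟩ := Sigma.ext_iff.1 h
    obtain rfl : i = j := Option.some.inj h1
    rw [show k = l from eq_of_heq h2]
  rw [h1, Matrix.det_one, one_mul]

variable (α q)

/-- The function `det X` on `M_{α,q}`. -/
noncomputable def detX : QuiverVariety α q := ⟨(matX α q).det, det_matX_mem⟩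

/-- The coordinate ring of the open subset `M⁰_{α,q} ⊆ M_{α,q}` on which `X` is invertible. -/
abbrev QuiverVariety₀ : Type := Localization.Away (detX α q)

/-- The coordinate ring of the open subset of `Rep(Λ^{q̃}, α̃)` on which `X` is invertible. -/
abbrev RepPreproj₀ : Type := Localization.Away (detX α q : RepPreproj α q)

/-- The pull-back of functions from `M⁰_{α,q}` to the open subset of `Rep(Λ^{q̃}, α̃)` on which
`X` is invertible. -/
noncomputable def pullback₀ : QuiverVariety₀ α q →+* RepPreproj₀ α q :=
  Localization.awayMap (QuiverVariety α q).val.toRingHom (detX α q)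

/-- `br₀` is the biderivation on `O(M⁰_{α,q})` which extends the bracket `br` on `O(M_{α,q})`. -/
structure IsExtendedBracket
    (br : QuiverVariety α q →ₗ[ℂ] QuiverVariety α q →ₗ[ℂ] QuiverVariety α q)
    (br₀ : QuiverVariety₀ α q →ₗ[ℂ] QuiverVariety₀ α q →ₗ[ℂ] QuiverVariety₀ α q) : Prop where
  extends_br : ∀ F G : QuiverVariety α q,
    br₀ (algebraMap _ _ F) (algebraMap _ _ G) = algebraMap _ _ (br F G)
  mul_right : ∀ F G H, br₀ F (G * H) = G * br₀ F H + br₀ F G * H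
  mul_left : ∀ F G H, br₀ (F * G) H = F * br₀ G H + br₀ F H * G

/-- The matrix `Z = Y + X⁻¹`, on the open subset where `X` is invertible. -/
noncomputable def matZ : Matrix (CycIdx α) (CycIdx α) (RepPreproj₀ α q) :=
  (matY α q).map (algebraMap _ _) + ((matX α q).map (algebraMap _ _))⁻¹

end Variety

/-- The functions `h j` on `Rep` are pulled back, along `ι : O(M) → O(Rep)`, from functions on `M`
which pairwise commute for the bracket `br`. -/
def Commuting {O S J : Type} [AddCommGroup O] [Module ℂ O] (ι : O → S)
    (br : O →ₗ[ℂ] O →ₗ[ℂ] O) (h : J → S) : Prop :=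
  ∃ F : J → O, (∀ j, ι (F j) = h j) ∧ ∀ j k, br (F j) (F k) = 0

end CyclicQuiver

namespace CyclicQuiver

variable {m : ℕ}

/-! Each family consists of traces of powers of one matrix: X, Y, 1 + XY or Z = Y + X⁻¹. The four
matrices share a feature. If U is one of them and e_i are the projections onto the summands of 𝒱,
the brackets of the entries of U, read as a tensor, are c ∑_i (e_i ⊗ U e_i U - U e_i U ⊗ e_i), with
c = 1/2 for X and c = -1/2 for the other three. This shape alone forces commutation
(`HasBracket.commute`). A function f of tr U^k type has differential D f = c' tr(M D U) with M
commuting with U (`HasTraceGradient`). If N plays the same role for g, then {f, g} is a multiple of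
the sum of the differences tr(N e_i M U e_i U) - tr(N U e_i U M e_i), and each difference vanishes
by cyclicity of the trace because M and N commute with U. The Jacobi identity plays no role.

The shape is read off from the bivector for x and y (`dgal_sumX_sumX`, `dgal_sumY_sumY`). For 1 + xy
it follows from the formula for the bracket with a factor 1 + x_i y_i of the moment map
(`dgal_oneAdd_self`). For Z it is assembled from the brackets among X, Y and X⁻¹: the terms of other
shapes cancel in antisymmetric pairs and the rest is the polarisation of the quadratic expression
above (`HasBracket.add_inv`).

The bracket descends to the quotient by quasi-Hamiltonian reduction. The product of the factors (1 +
a a*)^{ε(a)} at a vertex is a multiplicative moment map (`dgal_moment`), so on {Φ = q̃} the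
Hamiltonian vector fields of the entries of Φ are multiples of the infinitesimal gauge action
(`restrict_repBracket_moment`). Invariant functions are killed by this action even if the scheme is
not reduced (`gaugeDeriv_of_invariant`), and the ideal of {Φ = q̃} is generated by the entries of Φ
- q̃ (`mem_momentIdeal`). Hence {f, g} restricted to {Φ = q̃} depends only on the restrictions of f
and g when these are invariant (`restrict_repBracket_congr`); with the equivariance of the bracket
this gives existence, while uniqueness is the surjectivity of restriction. In particular,
commutation may be tested on Rep(A, α̃), where the entries of X and Y live.

For Z everything is localised at det X, where biderivations extend uniquely. The functions tr Z^n
have invariant numerators over powers of det X, so the bracket on M⁰ is again computed upstairs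
(`IsExtendedBracket.pullback₀_eq`), and pull-back of functions is injective. -/

theorem star_star (a : Arrow m) : a.star.star = a := by simp [Arrow.star]

theorem star_ne (a : Arrow m) : a.star ≠ a := by
  simp [Arrow.star, Prod.ext_iff]

theorem head_star (a : Arrow m) : a.star.head = a.tail := by
  simp [Arrow.head, star_star]

theorem tail_star (a : Arrow m) : a.star.tail = a.head := rfl

section DoubleBracket

variable [NeZero m]

open PathAlg

/-! ## The double bracket on generators -/

/-- `c ↦ c ⊗ 1`. -/
noncomputable abbrev inl : PathAlg m →ₐ[ℂ] PathAlg m ⊗[ℂ] PathAlg m :=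
  Algebra.TensorProduct.includeLeft

/-- `c ↦ 1 ⊗ c`. -/
noncomputable abbrev inr : PathAlg m →ₐ[ℂ] PathAlg m ⊗[ℂ] PathAlg m :=
  Algebra.TensorProduct.includeRight

theorem inner_apply (b c : PathAlg m) (δ : PathAlg m →ₗ[ℂ] PathAlg m ⊗[ℂ] PathAlg m)
    (z : PathAlg m) : inner b δ c z = inr b * δ z * inl c := by
  rw [inner, LinearMap.comp_apply]
  induction δ z with
  | zero => simp
  | tmul p q => simp
  | add p q hp hq => rw [map_add, hp, hq, mul_add, add_mul]

/-- A pure tensor as first argument acts through the inner bimodule structure. This turns the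
brackets with 1 + a a*, whose derivatives are sums of pure tensors, into inner multiplications. -/
theorem glue_tmul_left (p p' : PathAlg m) (ξ : PathAlg m ⊗[ℂ] PathAlg m) :
    glue (p ⊗ₜ[ℂ] p') ξ = inr p * ξ * inl p' := by
  induction ξ with
  | zero => simp
  | tmul r q => simp [glue_tmul]
  | add r q hr hq => rw [map_add, hr, hq, mul_add, add_mul]

theorem IsOuterDer.map_one {δ : PathAlg m →ₗ[ℂ] PathAlg m ⊗[ℂ] PathAlg m}
    (h : IsOuterDer δ) : δ 1 = 0 := by
  have := h 1 1
  rw [← Algebra.TensorProduct.one_def, mul_one, one_mul, mul_one] at this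
  simpa using this

theorem IsOuterDer.map_inv {δ : PathAlg m →ₗ[ℂ] PathAlg m ⊗[ℂ] PathAlg m}
    (h : IsOuterDer δ) {u v : PathAlg m} (huv : u * v = 1) (hvu : v * u = 1) :
    δ v = -(inl v * δ u * inr v) := by
  have h1 := h u v
  rw [huv, h.map_one] at h1
  have h2 : inl v * (inl u * δ v) = inl v * (-(δ u * inr v)) := by
    rw [show inl u * δ v = -(δ u * inr v) from eq_neg_of_add_eq_zero_left h1.symm]
  rw [← mul_assoc, ← map_mul, hvu, _root_.map_one, one_mul] at h2
  rw [h2, mul_neg, mul_assoc]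

/-- The Leibniz rule determines a derivation on inverses (`IsOuterDer.map_inv`), so inverting the
elements 1 + a a* adds no generators to check. -/
theorem IsOuterDer.ext {δ δ' : PathAlg m →ₗ[ℂ] PathAlg m ⊗[ℂ] PathAlg m}
    (h : IsOuterDer δ) (h' : IsOuterDer δ') (he : ∀ i, δ (e i) = δ' (e i))
    (ha : ∀ a, δ (arr a) = δ' (arr a)) : δ = δ' := by
  have hu : ∀ a : Arrow m, δ (1 + arr a * arr a.star) = δ' (1 + arr a * arr a.star) := fun a => by
    rw [map_add, map_add, h, h', h.map_one, h'.map_one, ha, ha]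
  refine LinearMap.ext fun z => ?_
  obtain ⟨p, rfl⟩ := PathAlg.mk_surjective z
  induction p using FreeAlgebra.induction with
  | grade0 r =>
    rw [AlgHom.commutes, Algebra.algebraMap_eq_smul_one, map_smul, map_smul, h.map_one,
      h'.map_one]
  | grade1 g =>
    cases g with
    | e i => exact he i
    | arr a => exact ha a
    | inv a =>
      change δ (inv a) = δ' (inv a)
      rw [h.map_inv (one_add_mul_inv a) (inv_mul_one_add a),
        h'.map_inv (one_add_mul_inv a) (inv_mul_one_add a), hu]
  | mul p r hp hr => rw [map_mul, h, h', hp, hr]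
  | add p r hp hr => rw [map_add, map_add, map_add, hp, hr]

theorem IsOuterDer.add {δ₁ δ₂ : PathAlg m →ₗ[ℂ] PathAlg m ⊗[ℂ] PathAlg m}
    (h₁ : IsOuterDer δ₁) (h₂ : IsOuterDer δ₂) : IsOuterDer (δ₁ + δ₂) := fun u u' => by
  simp only [LinearMap.add_apply, h₁ u u', h₂ u u', mul_add, add_mul]; abel

/-- The derivation `z ↦ z e_s ⊗ e_s - e_s ⊗ e_s z`. -/
noncomputable def gaugeDer (s : Vertex m) : PathAlg m →ₗ[ℂ] PathAlg m ⊗[ℂ] PathAlg m :=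
  LinearMap.mulRight ℂ (e s ⊗ₜ[ℂ] e s) ∘ₗ (inl (m := m)).toLinearMap -
    LinearMap.mulLeft ℂ (e s ⊗ₜ[ℂ] e s) ∘ₗ (inr (m := m)).toLinearMap

theorem gaugeDer_apply (s : Vertex m) (z : PathAlg m) :
    gaugeDer s z = (z * e s) ⊗ₜ[ℂ] e s - e s ⊗ₜ[ℂ] (e s * z) := by
  simp [gaugeDer]

theorem isOuterDer_gaugeDer (s : Vertex m) : IsOuterDer (gaugeDer s) := fun u u' => by
  simp [gaugeDer_apply, mul_sub, sub_mul, mul_assoc]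

theorem mul_e_tail_star (a : Arrow m) : arr a.star * e a.tail = arr a.star := by
  rw [← head_star, mul_e_head]

theorem e_head_mul_star (a : Arrow m) : e a.head * arr a.star = arr a.star := by
  rw [← tail_star, e_tail_mul]

theorem fusionF_apply (a : Arrow m) (z : PathAlg m) :
    fusionF a z = dPartial a.star z * inl (arr a.star) - inr (arr a) * dPartial a z := by
  rw [fusionF, LinearMap.sub_apply, inner_apply, inner_apply, _root_.map_one, _root_.map_one,
    one_mul, mul_one]

theorem fusionF_e (a : Arrow m) (i : Vertex m) : fusionF a (e i) = 0 := by
  simp [fusionF_apply, dPartial_e]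

theorem fusionF_arr (a b : Arrow m) : fusionF a (arr b) =
    (if b = a.star then arr a.star ⊗ₜ[ℂ] e a.tail else 0) -
      if b = a then e a.tail ⊗ₜ[ℂ] arr a else 0 := by
  rw [fusionF_apply, dPartial_arr, dPartial_arr, partialArr, partialArr, head_star, tail_star]
  split_ifs <;> simp [e_head_mul_star, mul_e_head]

theorem fusionF_self (a : Arrow m) : fusionF a (arr a) = -(e a.tail ⊗ₜ[ℂ] arr a) := by
  simp [fusionF_arr, (star_ne a).symm]

theorem fusionF_star (a : Arrow m) : fusionF a (arr a.star) = arr a.star ⊗ₜ[ℂ] e a.tail := by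
  simp [fusionF_arr, star_ne a]

theorem fusionF_ne {a b : Arrow m} (h : b ≠ a) (h' : b ≠ a.star) : fusionF a (arr b) = 0 := by
  simp [fusionF_arr, h, h']

/-- Inner multiplication by an idempotent is again an outer derivation, and it does nothing to
e_{t(a)} ⊗ e_{h(a)}. This is used to drop idempotents after gluing. -/
theorem dPartial_absorb_left (a : Arrow m) (z : PathAlg m) :
    inr (e a.head) * dPartial a z = dPartial a z := by
  have : inner (e a.head) (dPartial a) 1 = dPartial a :=
    ((isOuterDer_dPartial a).inner _ _).ext (isOuterDer_dPartial a)
      (fun i => by simp [inner_apply, dPartial_e])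
      (fun b => by
        rw [inner_apply, dPartial_arr, partialArr]
        split_ifs <;> simp [e_mul_self])
  simpa [inner_apply, ← Algebra.TensorProduct.one_def] using LinearMap.congr_fun this z

theorem dPartial_absorb_right (a : Arrow m) (z : PathAlg m) :
    dPartial a z * inl (e a.tail) = dPartial a z := by
  have : inner 1 (dPartial a) (e a.tail) = dPartial a :=
    ((isOuterDer_dPartial a).inner _ _).ext (isOuterDer_dPartial a)
      (fun i => by simp [inner_apply, dPartial_e])
      (fun b => by
        rw [inner_apply, dPartial_arr, partialArr]
        split_ifs <;> simp [e_mul_self])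
  simpa [inner_apply, ← Algebra.TensorProduct.one_def] using LinearMap.congr_fun this z

theorem fusionF_absorb_left (a : Arrow m) (z : PathAlg m) :
    inr (e a.tail) * fusionF a z = fusionF a z := by
  rw [fusionF_apply, mul_sub, ← mul_assoc, ← mul_assoc, ← map_mul, e_tail_mul]
  nth_rewrite 1 [← head_star]
  rw [dPartial_absorb_left]

theorem fusionF_absorb_right (a : Arrow m) (z : PathAlg m) :
    fusionF a z * inl (e a.tail) = fusionF a z := by
  rw [fusionF_apply, sub_mul, mul_assoc, mul_assoc, ← map_mul, dPartial_absorb_right,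
    mul_e_tail_star]

/-! ### Antisymmetry -/

theorem glue_comm (p r : PathAlg m ⊗[ℂ] PathAlg m) :
    TensorProduct.comm ℂ _ _ (glue p r) = glue r p := by
  induction p with
  | zero => simp
  | add p q hp hq => simp only [map_add, LinearMap.add_apply, hp, hq]
  | tmul p p' =>
    induction r with
    | zero => simp
    | add r q hr hq => simp only [map_add, LinearMap.add_apply, hr, hq]
    | tmul r r' => simp [glue_tmul]

/-- The flip of the tensor factors exchanges the arguments of `glue`, hence the two terms whose
difference is the bracket. -/
theorem bracketOf_comm (δ₁ δ₂ : PathAlg m →ₗ[ℂ] PathAlg m ⊗[ℂ] PathAlg m) (a b : PathAlg m) :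
    TensorProduct.comm ℂ _ _ (bracketOf δ₁ δ₂ a b) = -bracketOf δ₁ δ₂ b a := by
  simp only [bracketOf, LinearMap.sub_apply, LinearMap.compl₁₂_apply, map_sub, glue_comm, neg_sub]

theorem dgal_comm (a b : PathAlg m) :
    TensorProduct.comm ℂ _ _ (dgal m a b) = -dgal m b a := by
  simp only [dgal_apply, map_sub, map_smul, map_sum, apply_ite, bracketOf_comm, map_zero]
  have h3 : ∀ d d' : Arrow m, ∀ x : PathAlg m ⊗[ℂ] PathAlg m,
      (if d.Before d' then -x else 0) = -(if d.Before d' then x else 0) := by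
    intros; split_ifs <;> simp
  simp only [h3, Finset.sum_neg_distrib, smul_neg]
  abel

/-! ### The bracket as a sum over vertices and arrows -/

theorem sum_arrow {M : Type*} [AddCommMonoid M] (f : Arrow m → M) :
    ∑ a, f a = ∑ i : ZMod m, (f (some i, false) + f (some i, true)) +
      (f (none, false) + f (none, true)) := by
  rw [Fintype.sum_prod_type, Fintype.sum_option, add_comm]
  simp [add_comm]

/-- The ordered pairs are y_{i-1} < x_i at every vertex i, and y_{m-1} < v and x_0 < v at 0; the
arrow y_{m-1} has index -1 in ℤ/m. -/
theorem sum_before {M : Type*} [AddCommGroup M] (f : Arrow m → Arrow m → M) :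
    ∑ a : Arrow m, ∑ b : Arrow m, (if a.Before b then f a b else 0) =
      ∑ i : ZMod m, f (some (i - 1), true) (some i, false) +
        f (some (-1), true) (none, false) + f (some 0, false) (none, false) := by
  have key : ∀ i : ZMod m, ∑ j : ZMod m, (if i + 1 = j then
      f (some i, true) (some j, false) else 0) = f (some i, true) (some (i + 1), false) := by
    intro i; simp
  have h0 : ∀ i : ZMod m, (i + 1 = 0) ↔ (i = -1) := fun i => by
    rw [eq_neg_iff_add_eq_zero]
  have h1 : ∑ i : ZMod m, f (some (i - 1), true) (some i, false) =
      ∑ i : ZMod m, f (some i, true) (some (i + 1), false) := by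
    rw [← Equiv.sum_comp (Equiv.addRight (1 : ZMod m))]
    simp
  simp only [sum_arrow, Arrow.Before, Arrow.tail, Arrow.rank]
  simp [Finset.sum_add_distrib, key, h0, h1]
  abel

/-- The contribution of `a` and `a*` to the first sum in the bivector. -/
noncomputable def pairBracket (a : Arrow m) (u z : PathAlg m) : PathAlg m ⊗[ℂ] PathAlg m :=
  bracketOf (inner (1 + arr a.star * arr a) (dPartial a) 1) (dPartial a.star) u z -
    bracketOf (inner (1 + arr a * arr a.star) (dPartial a.star) 1) (dPartial a) u z

/-- The signs ε(a) = 1 and ε(a*) = -1 group the first sum into one `pairBracket` for each of x_i and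
v. -/
theorem dgal_eq (u z : PathAlg m) : dgal m u z =
    (1 / 2 : ℂ) • (∑ i : ZMod m, pairBracket (some i, false) u z + pairBracket (none, false) u z)
    - (1 / 2 : ℂ) • (∑ i : ZMod m,
      bracketOf (fusionF (some (i - 1), true)) (fusionF (some i, false)) u z +
        bracketOf (fusionF (some (-1), true)) (fusionF (none, false)) u z +
        bracketOf (fusionF (some 0, false)) (fusionF (none, false)) u z) := by
  rw [dgal_apply, sum_before (fun c d => bracketOf (fusionF c) (fusionF d) u z), sum_arrow]
  simp [pairBracket, Arrow.sign, Arrow.star, sub_eq_add_neg]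

end DoubleBracket

end CyclicQuiver

namespace CyclicQuiver

variable {m : ℕ} [NeZero m]

section MomentMap

open PathAlg

/-! ## The moment map property -/

theorem fusionF_mul (a : Arrow m) (u v : PathAlg m) :
    fusionF a (u * v) = inl u * fusionF a v + fusionF a u * inr v :=
  isOuterDer_fusionF a u v

theorem fusionF_one (a : Arrow m) : fusionF a 1 = 0 := (isOuterDer_fusionF a).map_one

theorem fusionF_oneAdd_self (a : Arrow m) : fusionF a (1 + arr a * arr a.star) =
    (arr a * arr a.star) ⊗ₜ[ℂ] e a.tail - e a.tail ⊗ₜ[ℂ] (arr a * arr a.star) := by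
  rw [map_add, fusionF_one, fusionF_mul, fusionF_self, fusionF_star]
  simp [sub_eq_add_neg]

/-- The only case with content is b = a*: the terms a ⊗ a* produced by differentiating a and a*
cancel. So among all F_b only F_a sees 1 + a a*. -/
theorem fusionF_oneAdd_ne {a b : Arrow m} (h : b ≠ a) :
    fusionF b (1 + arr a * arr a.star) = 0 := by
  rw [map_add, fusionF_one, fusionF_mul]
  by_cases h' : b = a.star
  · subst h'
    have := fusionF_star a.star
    rw [star_star] at this
    rw [fusionF_self, this]
    simp [tail_star, mul_e_head, e_head_mul_star]
  · rw [fusionF_ne (Ne.symm h), fusionF_ne (Ne.symm h')]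
    · simp
    · rintro h2; exact h (by rw [← star_star b, ← h2, star_star])
    · rintro h2; exact h' (by rw [h2, star_star])

/-- `v ξ + ξ v` for the inner bimodule structure. -/
noncomputable def innerSym (v : PathAlg m) (ξ : PathAlg m ⊗[ℂ] PathAlg m) :
    PathAlg m ⊗[ℂ] PathAlg m := inr v * ξ + ξ * inl v

/-- `v ξ - ξ v` for the inner bimodule structure. -/
noncomputable def innerComm (v : PathAlg m) (ξ : PathAlg m ⊗[ℂ] PathAlg m) :
    PathAlg m ⊗[ℂ] PathAlg m := inr v * ξ - ξ * inl v

theorem bracketOf_eq (δ₁ δ₂ : PathAlg m →ₗ[ℂ] PathAlg m ⊗[ℂ] PathAlg m) (u z : PathAlg m) :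
    bracketOf δ₁ δ₂ u z = glue (δ₁ u) (δ₂ z) - glue (δ₂ u) (δ₁ z) := rfl

/-- F_a(1 + a a*) is the difference of a a* ⊗ e and e ⊗ a a*, and gluing it gives an inner
commutator with a a*. The idempotents are absorbed because b starts where a does, and the summand 1
commutes with everything. -/
theorem glue_fusionF_oneAdd {a b : Arrow m} (h : a.tail = b.tail) (z : PathAlg m) :
    glue (fusionF a (1 + arr a * arr a.star)) (fusionF b z) =
      innerComm (1 + arr a * arr a.star) (fusionF b z) := by
  rw [fusionF_oneAdd_self, map_sub, LinearMap.sub_apply, glue_tmul_left, glue_tmul_left, mul_assoc,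
    h, fusionF_absorb_right, fusionF_absorb_left, innerComm]
  simp only [map_add, map_one, mul_add, add_mul, mul_one, one_mul]
  abel

theorem bracketOf_fusionF_oneAdd {a c d : Arrow m} (h : c.Before d) (z : PathAlg m) :
    bracketOf (fusionF c) (fusionF d) (1 + arr a * arr a.star) z =
      (if c = a then innerComm (1 + arr a * arr a.star) (fusionF d z) else 0) -
        if d = a then innerComm (1 + arr a * arr a.star) (fusionF c z) else 0 := by
  have hcd : c ≠ d := by
    rintro rfl; exact lt_irrefl _ h.2
  rw [bracketOf_eq]
  congr 1
  · split_ifs with hc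
    · subst hc; exact glue_fusionF_oneAdd h.1 z
    · rw [fusionF_oneAdd_ne hc, map_zero, LinearMap.zero_apply]
  · split_ifs with hc
    · subst hc; exact glue_fusionF_oneAdd h.1.symm z
    · rw [fusionF_oneAdd_ne hc, map_zero, LinearMap.zero_apply]

theorem dPartial_mul' (a : Arrow m) (u v : PathAlg m) :
    dPartial a (u * v) = inl u * dPartial a v + dPartial a u * inr v := dPartial_mul a u v

theorem dPartial_oneAdd_self (a : Arrow m) :
    dPartial a (1 + arr a * arr a.star) = e a.tail ⊗ₜ[ℂ] arr a.star := by
  rw [map_add, (isOuterDer_dPartial a).map_one, dPartial_mul', dPartial_arr, dPartial_arr,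
    partialArr, partialArr, if_neg (star_ne a), if_pos rfl]
  simp [e_head_mul_star]

theorem dPartial_star_oneAdd (a : Arrow m) :
    dPartial a.star (1 + arr a * arr a.star) = arr a ⊗ₜ[ℂ] e a.tail := by
  rw [map_add, (isOuterDer_dPartial _).map_one, dPartial_mul', dPartial_arr, dPartial_arr,
    partialArr, partialArr, if_neg (star_ne a).symm, if_pos rfl, head_star, tail_star]
  simp [mul_e_head]

theorem dPartial_oneAdd_ne {a b : Arrow m} (h : b ≠ a) (h' : b ≠ a.star) :
    dPartial b (1 + arr a * arr a.star) = 0 := by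
  rw [map_add, (isOuterDer_dPartial _).map_one, dPartial_mul', dPartial_arr, dPartial_arr,
    partialArr, partialArr, if_neg h.symm, if_neg h'.symm]
  simp

/-- The coefficients 1 + a* a and 1 + a a* of the bivector are exactly what the intertwining
relation a (1 + a* a) = (1 + a a*) a needs in order to collect all terms into the anticommutator
with F_a. -/
theorem pairBracket_oneAdd_self (a : Arrow m) (z : PathAlg m) :
    pairBracket a (1 + arr a * arr a.star) z =
      innerSym (1 + arr a * arr a.star) (fusionF a z) := by
  have h1 : inr (e a.tail) * dPartial a.star z = dPartial a.star z := by
    rw [← head_star, dPartial_absorb_left]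
  have h2 := dPartial_absorb_right a z
  have h3 : e a.tail * (1 + arr a * arr a.star) = (1 + arr a * arr a.star) * e a.tail := by
    rw [mul_add, add_mul, ← mul_assoc, e_tail_mul, mul_assoc, mul_e_tail_star, one_mul, mul_one]
  have h4 : (1 + arr a.star * arr a) * arr a.star = arr a.star * (1 + arr a * arr a.star) := by
    noncomm_ring
  have h5 : arr a * (1 + arr a.star * arr a) = (1 + arr a * arr a.star) * arr a := by
    noncomm_ring
  have t1 : ∀ b c d : PathAlg m, (inr b : PathAlg m ⊗[ℂ] PathAlg m) * c ⊗ₜ[ℂ] d * inl 1 =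
      c ⊗ₜ[ℂ] (b * d) := fun b c d => by simp [← Algebra.TensorProduct.one_def]
  simp only [pairBracket, bracketOf_eq, inner_apply, dPartial_oneAdd_self, dPartial_star_oneAdd, t1,
    fusionF_apply, innerSym, glue_tmul_left, h4, ← h3]
  simp only [map_one, mul_one]
  have k1 : inr (arr a) * (inr (1 + arr a.star * arr a) * dPartial a z) * inl (e a.tail) =
      inr (1 + arr a * arr a.star) * (inr (arr a) * dPartial a z) := by
    rw [← mul_assoc, ← map_mul, h5, mul_assoc, h2, map_mul, mul_assoc]
  have k2 : inr (arr a) * dPartial a z * inl (e a.tail * (1 + arr a * arr a.star)) =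
      inr (arr a) * dPartial a z * inl (1 + arr a * arr a.star) := by
    rw [map_mul, ← mul_assoc, mul_assoc (inr (arr a)), h2]
  have k3 : inr (e a.tail) * (inr (1 + arr a * arr a.star) * dPartial a.star z) *
      inl (arr a.star) =
      inr (1 + arr a * arr a.star) * (dPartial a.star z * inl (arr a.star)) := by
    rw [← mul_assoc, ← map_mul, h3, map_mul, mul_assoc (inr (1 + arr a * arr a.star)), h1, mul_assoc]
  have k4 : inr (e a.tail) * dPartial a.star z * inl (arr a.star * (1 + arr a * arr a.star)) =
      dPartial a.star z * inl (arr a.star) * inl (1 + arr a * arr a.star) := by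
    rw [h1, map_mul, mul_assoc]
  rw [k1, k2, k3, k4, mul_sub, sub_mul]
  abel

theorem pairBracket_star (a : Arrow m) (u z : PathAlg m) :
    pairBracket a.star u z = -pairBracket a u z := by
  simp [pairBracket, star_star]

theorem pairBracket_oneAdd_ne {a b : Arrow m} (h : b ≠ a) (h' : b ≠ a.star) (z : PathAlg m) :
    pairBracket b (1 + arr a * arr a.star) z = 0 := by
  have h1 := dPartial_oneAdd_ne h h'
  have h2 : dPartial b.star (1 + arr a * arr a.star) = 0 := dPartial_oneAdd_ne
    (fun hb => h' (by rw [← hb, star_star])) (fun hb => h (by rw [← star_star b, hb, star_star]))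
  simp only [pairBracket, bracketOf_eq, inner_apply, h1, h2, mul_zero, zero_mul, map_zero,
    LinearMap.zero_apply, sub_self]

/-- Only the pair that contains a contributes. When a is a starred arrow the sum contains the pair
of its opposite, which accounts for the sign. -/
theorem sum_pairBracket_oneAdd (a : Arrow m) (z : PathAlg m) :
    ∑ i : ZMod m, pairBracket (some i, false) (1 + arr a * arr a.star) z +
      pairBracket (none, false) (1 + arr a * arr a.star) z =
        a.sign • innerSym (1 + arr a * arr a.star) (fusionF a z) := by
  rw [add_comm, ← Fintype.sum_option (fun o => pairBracket (o, false) (1 + arr a * arr a.star) z)]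
  obtain ⟨o, s⟩ := a
  rw [Finset.sum_eq_single o]
  · cases s with
    | false => rw [pairBracket_oneAdd_self]; simp [Arrow.sign]
    | true =>
      rw [← pairBracket_oneAdd_self]
      rw [show ((o, false) : Arrow m) = Arrow.star (o, true) from rfl, pairBracket_star]
      simp [Arrow.sign]
  · intro b _ hb
    exact pairBracket_oneAdd_ne (fun h => hb (Prod.ext_iff.1 h).1) (fun h => hb (Prod.ext_iff.1 h).1) z
  · simp

theorem dgal_eq' (u z : PathAlg m) : dgal m u z =
    (1 / 2 : ℂ) • (∑ i : ZMod m, pairBracket (some i, false) u z + pairBracket (none, false) u z)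
    - (1 / 2 : ℂ) • ∑ c : Arrow m, ∑ d : Arrow m,
      (if c.Before d then bracketOf (fusionF c) (fusionF d) u z else 0) := by
  rw [dgal_eq, sum_before (fun c d => bracketOf (fusionF c) (fusionF d) u z)]

/-- The first sum of the bivector gives the anticommutator with F_a; the pairs F_a F_b and F_b F_a
give commutators with F_b, with opposite signs according to the order. -/
theorem dgal_oneAdd (a : Arrow m) (z : PathAlg m) :
    dgal m (1 + arr a * arr a.star) z = (1 / 2 : ℂ) •
      (a.sign • innerSym (1 + arr a * arr a.star) (fusionF a z) -
        ∑ b : Arrow m, (if a.Before b then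
          innerComm (1 + arr a * arr a.star) (fusionF b z) else 0) +
        ∑ b : Arrow m, (if b.Before a then
          innerComm (1 + arr a * arr a.star) (fusionF b z) else 0)) := by
  have h1 : ∀ c d : Arrow m, (if c.Before d then
      bracketOf (fusionF c) (fusionF d) (1 + arr a * arr a.star) z else 0) =
      (if c = a then if a.Before d then
        innerComm (1 + arr a * arr a.star) (fusionF d z) else 0 else 0) -
      (if d = a then if c.Before a then
        innerComm (1 + arr a * arr a.star) (fusionF c z) else 0 else 0) := fun c d => by
    by_cases h : c.Before d
    · rw [if_pos h, bracketOf_fusionF_oneAdd h]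
      congr 1 <;> split_ifs <;> simp_all
    · rw [if_neg h]
      split_ifs <;> simp_all
  rw [dgal_eq', sum_pairBracket_oneAdd]
  simp only [h1, Finset.sum_sub_distrib]
  rw [Finset.sum_comm]
  simp
  module

/-- No sign ε(a) is left: passing from u to u⁻¹ negates the anticommutator with F_a and keeps the
sign of the commutators. For ε(a) = -1 this cancels the sign in `dgal_oneAdd`, which is why the
factors of Φ carry the exponents ε(a). -/
theorem dgal_factor (a : Arrow m) (z : PathAlg m) :
    dgal m (factor a) z = (1 / 2 : ℂ) •
      (innerSym (factor a) (fusionF a z) -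
        ∑ b : Arrow m, (if a.Before b then innerComm (factor a) (fusionF b z) else 0) +
        ∑ b : Arrow m, (if b.Before a then innerComm (factor a) (fusionF b z) else 0)) := by
  by_cases ha : a.2
  · have h0 := dgal_mul_left (1 + arr a * arr a.star) (inv a) z
    have hv : (inr (inv a) : PathAlg m ⊗[ℂ] PathAlg m) * inr (1 + arr a * arr a.star) = 1 := by
      rw [← map_mul, inv_mul_one_add, map_one]
    have hv' : (inl (1 + arr a * arr a.star) : PathAlg m ⊗[ℂ] PathAlg m) * inl (inv a) = 1 := by
      rw [← map_mul, one_add_mul_inv, map_one]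
    have h1 : dgal m (inv a) z =
        -(inr (inv a) * dgal m (1 + arr a * arr a.star) z * inl (inv a)) := by
      rw [one_add_mul_inv, dgal_one_left] at h0
      have h2 : inr (1 + arr a * arr a.star) * dgal m (inv a) z =
        -(dgal m (1 + arr a * arr a.star) z * inl (inv a)) := eq_neg_of_add_eq_zero_left h0.symm
      calc dgal m (inv a) z = inr (inv a) * (inr (1 + arr a * arr a.star) * dgal m (inv a) z) := by
            rw [← mul_assoc, hv, one_mul]
        _ = _ := by rw [h2, mul_neg, mul_assoc]
    have h3 : ∀ ξ, inr (inv a) * innerSym (1 + arr a * arr a.star) ξ * inl (inv a) =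
        innerSym (inv a) ξ := fun ξ => by
      rw [innerSym, innerSym, mul_add, add_mul, ← mul_assoc, hv, one_mul, mul_assoc, mul_assoc ξ,
        hv', mul_one, add_comm]
    have h4 : ∀ ξ, inr (inv a) * innerComm (1 + arr a * arr a.star) ξ * inl (inv a) =
        -innerComm (inv a) ξ := fun ξ => by
      rw [innerComm, innerComm, mul_sub, sub_mul, ← mul_assoc, hv, one_mul, mul_assoc, mul_assoc ξ,
        hv', mul_one, neg_sub]
    have h5 : ∀ (p : Prop) [Decidable p] (ξ : PathAlg m ⊗[ℂ] PathAlg m),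
        (if p then -ξ else 0) = -(if p then ξ else 0) := by
      intros; split_ifs <;> simp
    rw [factor, if_pos ha, h1, dgal_oneAdd]
    simp only [mul_smul_comm, smul_mul_assoc, mul_add, add_mul, mul_sub, sub_mul, Finset.mul_sum,
      Finset.sum_mul, mul_ite, ite_mul, mul_zero, zero_mul, h3, h4, h5, Finset.sum_neg_distrib,
      Arrow.sign, ha, if_true]
    module
  · rw [factor, if_neg ha, dgal_oneAdd, Arrow.sign, if_neg ha, one_smul]

end MomentMap

end CyclicQuiver

namespace CyclicQuiver

variable {m : ℕ} [NeZero m]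

/-! ### The sum of the F_a at a vertex, and the ordered product of the factors of Φ -/

section MomentMap

open PathAlg

theorem arr_mul_e (b : Arrow m) (s : Vertex m) :
    arr b * e s = if b.head = s then arr b else 0 := by
  split_ifs with h
  · rw [← h, mul_e_head]
  · rw [← mul_e_head, mul_assoc, e_mul_ne h, mul_zero]

theorem e_mul_arr (b : Arrow m) (s : Vertex m) :
    e s * arr b = if b.tail = s then arr b else 0 := by
  split_ifs with h
  · rw [← h, e_tail_mul]
  · rw [← e_tail_mul, ← mul_assoc, e_mul_ne (Ne.symm h), zero_mul]

theorem IsOuterDer.sum {ι : Type*} (s : Finset ι)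
    {δ : ι → PathAlg m →ₗ[ℂ] PathAlg m ⊗[ℂ] PathAlg m}
    (h : ∀ i, IsOuterDer (δ i)) : IsOuterDer (∑ i ∈ s, δ i) := by
  induction s using Finset.cons_induction with
  | empty => intro u u'; simp
  | cons i s hi ih => rw [Finset.sum_cons]; exact (h i).add ih

/-- Both sides are outer derivations. On an arrow b, the term b ⊗ e_s comes from a = b* and is
present when b ends at s; the term e_s ⊗ b comes from a = b and is present when b starts at s. -/
theorem sum_fusionF (s : Vertex m) (z : PathAlg m) :
    ∑ a : Arrow m, (if a.tail = s then fusionF a z else 0) = gaugeDer s z := by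
  have hd : ∀ a : Arrow m, IsOuterDer (if a.tail = s then fusionF a else 0) := fun a => by
    split_ifs
    · exact isOuterDer_fusionF a
    · intro u u'; simp
  have hap : ∀ (a : Arrow m) (z : PathAlg m), (if a.tail = s then fusionF a else 0) z =
      if a.tail = s then fusionF a z else 0 := fun a z => by split_ifs <;> rfl
  have : ∑ a : Arrow m, (if a.tail = s then fusionF a else 0) = gaugeDer s := by
    refine (IsOuterDer.sum _ hd).ext (isOuterDer_gaugeDer s) (fun i => ?_) fun b => ?_
    · simp only [LinearMap.sum_apply, hap, fusionF_e, gaugeDer_apply]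
      by_cases h : i = s
      · subst h; simp [e_mul_self]
      · simp [e_mul_ne h, e_mul_ne (Ne.symm h)]
    · have h1 : ∀ a : Arrow m, (if a.tail = s then fusionF a (arr b) else 0) =
          (if a = b.star then if a.tail = s then arr b ⊗ₜ[ℂ] e s else 0 else 0) -
            if a = b then if a.tail = s then e s ⊗ₜ[ℂ] arr b else 0 else 0 := fun a => by
        have h2 : (b = a.star) ↔ (a = b.star) :=
          ⟨fun h => by rw [h, star_star], fun h => by rw [h, star_star]⟩
        rw [fusionF_arr]
        by_cases ht : a.tail = s
        · simp only [ht, if_true, h2, eq_comm (a := b) (b := a)]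
          congr 1
          · split_ifs with h
            · rw [h, star_star]
            · rfl
          · split_ifs with h
            · rw [h]
            · rfl
        · simp [ht]
      simp only [LinearMap.sum_apply, hap, h1, Finset.sum_sub_distrib, Finset.sum_ite_eq',
        Finset.mem_univ, if_true, gaugeDer_apply, arr_mul_e, e_mul_arr]
      congr 1
      · by_cases h : b.head = s
        · rw [if_pos h, if_pos (show b.star.tail = s from h)]
        · rw [if_neg h, if_neg (show b.star.tail ≠ s from h), TensorProduct.zero_tmul]
      · split_ifs <;> simp
  rw [← this, LinearMap.sum_apply]
  simp only [hap]

theorem sum_tail_none {M : Type*} [AddCommMonoid M] (f : Arrow m → M) :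
    ∑ a : Arrow m, (if a.tail = none then f a else 0) = f (none, true) := by
  rw [sum_arrow]; simp [Arrow.tail]

theorem sum_tail_some {M : Type*} [AddCommMonoid M] (f : Arrow m → M) (i : ZMod m) :
    ∑ a : Arrow m, (if a.tail = some i then f a else 0) =
      f (some (i - 1), true) + f (some i, false) + if i = 0 then f (none, false) else 0 := by
  have h : ∀ j : ZMod m, (j + 1 = i) ↔ (j = i - 1) := fun j => eq_sub_iff_add_eq.symm
  rw [sum_arrow]; simp [Arrow.tail, h, Finset.sum_add_distrib, eq_comm (a := (0 : ZMod m))]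
  abel

theorem sum_before_right {M : Type*} [AddCommMonoid M] (f : Arrow m → M) (a : Arrow m) :
    ∑ b : Arrow m, (if a.Before b then f b else 0) =
      ∑ b : Arrow m, if b.tail = a.tail then if a.rank < b.rank then f b else 0 else 0 := by
  refine Finset.sum_congr rfl fun b _ => ?_
  simp only [Arrow.Before, ite_and, eq_comm]

theorem sum_before_left {M : Type*} [AddCommMonoid M] (f : Arrow m → M) (a : Arrow m) :
    ∑ b : Arrow m, (if b.Before a then f b else 0) =
      ∑ b : Arrow m, if b.tail = a.tail then if b.rank < a.rank then f b else 0 else 0 := by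
  refine Finset.sum_congr rfl fun b _ => ?_
  simp only [Arrow.Before, ite_and]

omit [NeZero m] in
theorem tail_y (i : ZMod m) : Arrow.tail ((some (i - 1), true) : Arrow m) = some i := by
  simp [Arrow.tail]

theorem dgal_factor_none (z : PathAlg m) : dgal m (factor (none, true)) z =
    (1 / 2 : ℂ) • innerSym (factor (none, true)) (fusionF (none, true) z) := by
  rw [dgal_factor, sum_before_right, sum_before_left,
    show Arrow.tail ((none, true) : Arrow m) = none from rfl, sum_tail_none, sum_tail_none]
  simp [Arrow.rank]

theorem dgal_factor_y (i : ZMod m) (z : PathAlg m) : dgal m (factor (some (i - 1), true)) z =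
    (1 / 2 : ℂ) • (innerSym (factor (some (i - 1), true)) (fusionF (some (i - 1), true) z) -
      (innerComm (factor (some (i - 1), true)) (fusionF (some i, false) z) +
        if i = 0 then innerComm (factor (some (i - 1), true)) (fusionF (none, false) z)
          else 0)) := by
  rw [dgal_factor, sum_before_right, sum_before_left, tail_y, sum_tail_some, sum_tail_some]
  simp [Arrow.rank]

theorem dgal_factor_x (i : ZMod m) (z : PathAlg m) : dgal m (factor (some i, false)) z =
    (1 / 2 : ℂ) • (innerSym (factor (some i, false)) (fusionF (some i, false) z) -
      (if i = 0 then innerComm (factor (some i, false)) (fusionF (none, false) z) else 0) +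
      innerComm (factor (some i, false)) (fusionF (some (i - 1), true) z)) := by
  rw [dgal_factor, sum_before_right, sum_before_left,
    show Arrow.tail ((some i, false) : Arrow m) = some i from rfl, sum_tail_some, sum_tail_some]
  simp [Arrow.rank]

theorem dgal_factor_v (z : PathAlg m) : dgal m (factor (none, false)) z =
    (1 / 2 : ℂ) • (innerSym (factor (none, false)) (fusionF (none, false) z) +
      (innerComm (factor (none, false)) (fusionF (some (0 - 1), true) z) +
        innerComm (factor (none, false)) (fusionF (some 0, false) z))) := by
  rw [dgal_factor, sum_before_right, sum_before_left,
    show Arrow.tail ((none, false) : Arrow m) = some 0 from rfl, sum_tail_some, sum_tail_some]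
  simp [Arrow.rank]

theorem dgal_mul_left' (a b c : PathAlg m) :
    dgal m (a * b) c = inr a * dgal m b c + dgal m a c * inl b := dgal_mul_left a b c

/-- The factor e_s has zero bracket, so it only multiplies from the left. The product e_s v e_s is
left as it is, since on {Φ = q̃} it simplifies at once. -/
theorem dgal_e_mul_of_innerSym (s : Vertex m) {v z : PathAlg m}
    (h : dgal m v z = (1 / 2 : ℂ) • innerSym v (gaugeDer s z)) :
    dgal m (e s * v) z = (1 / 2 : ℂ) •
      ((z * (e s * v)) ⊗ₜ[ℂ] e s - (e s * v) ⊗ₜ[ℂ] (e s * z) + (z * e s) ⊗ₜ[ℂ] (e s * v * e s) -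
        e s ⊗ₜ[ℂ] (e s * v * e s * z)) := by
  rw [dgal_mul_left', dgal_e_left, h]
  simp [innerSym, gaugeDer_apply, mul_add, mul_sub, sub_mul, mul_assoc]
  simp only [← mul_assoc, e_mul_self]
  module

/-- The moment map property of `Φ`. -/
theorem dgal_moment (s : Vertex m) (z : PathAlg m) :
    dgal m (moment s) z = (1 / 2 : ℂ) •
      ((z * moment s) ⊗ₜ[ℂ] e s - moment s ⊗ₜ[ℂ] (e s * z) + (z * e s) ⊗ₜ[ℂ] (moment s * e s) -
        e s ⊗ₜ[ℂ] (moment s * e s * z)) := by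
  have hs := sum_fusionF s z
  cases s with
  | none =>
    rw [sum_tail_none] at hs
    exact dgal_e_mul_of_innerSym none (by rw [dgal_factor_none, hs])
  | some i =>
    rw [sum_tail_some] at hs
    have hm : moment (some i) = e (some i) * (factor (some (i - 1), true) *
        factor (some i, false) * if i = 0 then factor (none, false) else 1) := by
      rw [moment, mul_assoc, mul_assoc, mul_assoc]
    rw [hm]
    refine dgal_e_mul_of_innerSym (some i) ?_
    by_cases hi : i = 0
    · subst hi
      simp only [if_true] at hs ⊢
      -- The commutators cancel telescopically: for two factors, u₁ {{u₂, z}} + {{u₁, z}} u₂ with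
      -- the commutator [u₂, F₁] in the first and -[u₁, F₂] in the second is the anticommutator of
      -- u₁ u₂ with F₁ + F₂, up to 1/2. The same happens with three factors, and `hs` identifies the
      -- sum of the F's.
      rw [dgal_mul_left', dgal_mul_left', dgal_factor_y, dgal_factor_x, dgal_factor_v, ← hs]
      simp only [if_true, innerSym, innerComm, map_mul, mul_smul_comm, smul_mul_assoc,
        mul_add, add_mul, mul_sub, sub_mul, mul_assoc]
      module
    · simp only [if_neg hi, mul_one, add_zero] at hs ⊢
      rw [dgal_mul_left', dgal_factor_y, dgal_factor_x, ← hs]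
      simp only [if_neg hi, innerSym, innerComm, map_mul, mul_smul_comm, smul_mul_assoc,
        mul_add, add_mul, mul_sub, sub_mul, mul_assoc, sub_zero, add_zero]
      module

end MomentMap

section Brackets

open PathAlg

/-! ## The brackets between `x`, `y` and `1 + x y` -/

/-- `x = ∑_i x_i`. -/
noncomputable def sumX (m : ℕ) [NeZero m] : PathAlg m := ∑ i : ZMod m, arr (some i, false)

/-- `y = ∑_i y_i`. -/
noncomputable def sumY (m : ℕ) [NeZero m] : PathAlg m := ∑ i : ZMod m, arr (some i, true)

theorem e_mul_sumX (i : ZMod m) : e (some i) * sumX m = arr (some i, false) := by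
  simp [sumX, Finset.mul_sum, e_mul_arr, Arrow.tail]

theorem sumX_mul_e (i : ZMod m) : sumX m * e (some (i + 1)) = arr (some i, false) := by
  simp [sumX, Finset.sum_mul, arr_mul_e, Arrow.tail, Arrow.head, Arrow.star]

theorem e_mul_sumY (i : ZMod m) : e (some (i + 1)) * sumY m = arr (some i, true) := by
  simp [sumY, Finset.mul_sum, e_mul_arr, Arrow.tail]

theorem sumY_mul_e (i : ZMod m) : sumY m * e (some i) = arr (some i, true) := by
  simp [sumY, Finset.sum_mul, arr_mul_e, Arrow.tail, Arrow.head, Arrow.star]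

theorem sumX_mul_e_none : sumX m * e none = 0 := by
  simp [sumX, Finset.sum_mul, arr_mul_e, Arrow.tail, Arrow.head, Arrow.star]

theorem e_mul_sumX_comm (i : ZMod m) : e (some i) * sumX m = sumX m * e (some (i + 1)) := by
  rw [e_mul_sumX, sumX_mul_e]

theorem e_mul_sumY_comm (i : ZMod m) : e (some (i + 1)) * sumY m = sumY m * e (some i) := by
  rw [e_mul_sumY, sumY_mul_e]

theorem fusionF_x_sumX (i : ZMod m) :
    fusionF (some i, false) (sumX m) = -(e (some i) ⊗ₜ[ℂ] (e (some i) * sumX m)) := by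
  rw [sumX, map_sum, Finset.sum_eq_single i]
  · rw [fusionF_self, ← sumX, e_mul_sumX]; rfl
  · intro j _ hj; exact fusionF_ne (by simpa using hj) (by simp [Arrow.star])
  · simp

theorem fusionF_y_sumX (i : ZMod m) :
    fusionF (some (i - 1), true) (sumX m) = (sumX m * e (some i)) ⊗ₜ[ℂ] e (some i) := by
  have := sumX_mul_e (i - 1)
  rw [sub_add_cancel] at this
  rw [this, sumX, map_sum, Finset.sum_eq_single (i - 1)]
  · have := fusionF_star ((some (i - 1), true) : Arrow m)
    rw [tail_y] at this
    exact this
  · intro j _ hj; exact fusionF_ne (by simp) (by simpa [Arrow.star] using hj)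
  · simp

theorem fusionF_x_sumY (i : ZMod m) :
    fusionF (some i, false) (sumY m) = (sumY m * e (some i)) ⊗ₜ[ℂ] e (some i) := by
  rw [sumY_mul_e, sumY, map_sum, Finset.sum_eq_single i]
  · exact fusionF_star ((some i, false) : Arrow m)
  · intro j _ hj; exact fusionF_ne (by simp) (by simpa [Arrow.star] using hj)
  · simp

theorem fusionF_y_sumY (i : ZMod m) :
    fusionF (some (i - 1), true) (sumY m) = -(e (some i) ⊗ₜ[ℂ] (e (some i) * sumY m)) := by
  have := e_mul_sumY (i - 1)
  rw [sub_add_cancel] at this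
  rw [this, sumY, map_sum, Finset.sum_eq_single (i - 1)]
  · rw [fusionF_self, tail_y]
  · intro j _ hj; exact fusionF_ne (by simpa using hj) (by simp [Arrow.star])
  · simp

theorem fusionF_v_sumX : fusionF (none, false) (sumX m) = 0 := by
  rw [sumX, map_sum]
  exact Finset.sum_eq_zero fun i _ => fusionF_ne (by simp) (by simp [Arrow.star])

theorem fusionF_v_sumY : fusionF (none, false) (sumY m) = 0 := by
  rw [sumY, map_sum]
  exact Finset.sum_eq_zero fun i _ => fusionF_ne (by simp) (by simp [Arrow.star])

theorem dPartial_sumX (i : ZMod m) :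
    dPartial (some i, false) (sumX m) = e (some i) ⊗ₜ[ℂ] e (some (i + 1)) := by
  rw [sumX, map_sum, Finset.sum_eq_single i]
  · rw [dPartial_arr, partialArr, if_pos rfl]; rfl
  · intro j _ hj; rw [dPartial_arr, partialArr, if_neg (by simpa using hj)]
  · simp

theorem dPartial_sumY (i : ZMod m) :
    dPartial (some i, true) (sumY m) = e (some (i + 1)) ⊗ₜ[ℂ] e (some i) := by
  rw [sumY, map_sum, Finset.sum_eq_single i]
  · rw [dPartial_arr, partialArr, if_pos rfl]; rfl
  · intro j _ hj; rw [dPartial_arr, partialArr, if_neg (by simpa using hj)]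
  · simp

theorem dPartial_sumX_ne {a : Arrow m} (h : ∀ i, (some i, false) ≠ a) :
    dPartial a (sumX m) = 0 := by
  rw [sumX, map_sum]
  exact Finset.sum_eq_zero fun i _ => by rw [dPartial_arr, partialArr, if_neg (h i)]

theorem dPartial_sumY_ne {a : Arrow m} (h : ∀ i, (some i, true) ≠ a) :
    dPartial a (sumY m) = 0 := by
  rw [sumY, map_sum]
  exact Finset.sum_eq_zero fun i _ => by rw [dPartial_arr, partialArr, if_neg (h i)]

/-- The first sum of the bivector contains ∂/∂a* in each term and drops out, and F_v kills x; only
the pairs F_{y_{i-1}} F_{x_i} remain. -/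
theorem dgal_sumX_sumX : dgal m (sumX m) (sumX m) = (1 / 2 : ℂ) • ∑ i : ZMod m,
    (e (some i) ⊗ₜ[ℂ] (sumX m * e (some i) * sumX m) -
      (sumX m * e (some i) * sumX m) ⊗ₜ[ℂ] e (some i)) := by
  have hp : ∀ o : Option (ZMod m), pairBracket (o, false) (sumX m) (sumX m) = 0 := fun o => by
    have h1 : dPartial (Arrow.star (o, false)) (sumX m) = 0 :=
      dPartial_sumX_ne fun i => by simp [Arrow.star]
    simp only [pairBracket, bracketOf_eq, inner_apply, h1, mul_zero, zero_mul, map_zero,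
      LinearMap.zero_apply, sub_self]
  rw [dgal_eq]
  simp only [hp, bracketOf_eq, fusionF_x_sumX, fusionF_y_sumX, fusionF_v_sumX, map_zero,
    LinearMap.zero_apply, map_neg, LinearMap.neg_apply, glue_tmul, ← mul_assoc, e_mul_self,
    Finset.sum_const_zero, sub_zero, add_zero, smul_zero, zero_sub, neg_zero]
  rw [← smul_neg, ← Finset.sum_neg_distrib]
  congr 1
  refine Finset.sum_congr rfl fun i _ => ?_
  rw [mul_assoc _ (e _) (e _), e_mul_self]
  abel

/-- The same pairs as for x survive, but F_{x_i} and F_{y_{i-1}} exchange roles on y, which reverses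
the sign. -/
theorem dgal_sumY_sumY : dgal m (sumY m) (sumY m) = (1 / 2 : ℂ) • ∑ i : ZMod m,
    ((sumY m * e (some i) * sumY m) ⊗ₜ[ℂ] e (some i) -
      e (some i) ⊗ₜ[ℂ] (sumY m * e (some i) * sumY m)) := by
  have hp : ∀ o : Option (ZMod m), pairBracket (o, false) (sumY m) (sumY m) = 0 := fun o => by
    have h1 : dPartial (o, false) (sumY m) = 0 :=
      dPartial_sumY_ne fun i => by simp
    simp only [pairBracket, bracketOf_eq, inner_apply, h1, mul_zero, zero_mul, map_zero,
      LinearMap.zero_apply, sub_self]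
  rw [dgal_eq]
  simp only [hp, bracketOf_eq, fusionF_x_sumY, fusionF_y_sumY, fusionF_v_sumY, map_zero,
    LinearMap.zero_apply, map_neg, LinearMap.neg_apply, glue_tmul, ← mul_assoc, e_mul_self,
    Finset.sum_const_zero, sub_zero, add_zero, smul_zero, zero_sub]
  rw [← smul_neg, ← Finset.sum_neg_distrib]
  congr 1
  refine Finset.sum_congr rfl fun i _ => ?_
  rw [mul_assoc _ (e _) (e _), e_mul_self]
  abel

theorem e_mul_oneAdd_mul_e (a : Arrow m) :
    e a.tail * ((1 + arr a * arr a.star) * e a.tail) = e a.tail + arr a * arr a.star := by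
  rw [add_mul, mul_add, mul_assoc, mul_e_tail_star, one_mul, e_mul_self, ← mul_assoc, e_tail_mul]

theorem dgal_sumX_sumY : dgal m (sumX m) (sumY m) = (1 / 2 : ℂ) • ∑ i : ZMod m,
    ((sumY m * e (some i) * sumX m) ⊗ₜ[ℂ] e (some i) + (2 : ℂ) • e (some (i + 1)) ⊗ₜ[ℂ] e (some i) +
      e (some i) ⊗ₜ[ℂ] (sumX m * e (some i) * sumY m) -
      (sumY m * e (some i)) ⊗ₜ[ℂ] (sumX m * e (some i)) +
      (e (some i) * sumX m) ⊗ₜ[ℂ] (e (some i) * sumY m)) := by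
  have h1 : ∀ o : Option (ZMod m), dPartial (o, false) (sumY m) = 0 := fun o =>
    dPartial_sumY_ne fun i => by simp
  have h2 : ∀ o : Option (ZMod m), dPartial (o, true) (sumX m) = 0 := fun o =>
    dPartial_sumX_ne fun i => by simp
  have h3 : dPartial (none, false) (sumX m) = 0 := dPartial_sumX_ne fun i => by simp
  have hs : ∀ o : Option (ZMod m), Arrow.star (o, false) = (o, true) := fun o => rfl
  have hp0 : pairBracket (none, false) (sumX m) (sumY m) = 0 := by
    simp only [pairBracket, hs, bracketOf_eq, inner_apply, h1, h2, h3, mul_zero, zero_mul, map_zero,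
      LinearMap.zero_apply, sub_self]
  -- The contribution of ∂/∂x_i ∂/∂y_i: the two summands 1 of 1 + y_i x_i and 1 + x_i y_i add up to
  -- the coefficient 2.
  have hp : ∀ i : ZMod m, pairBracket (some i, false) (sumX m) (sumY m) =
      (sumY m * e (some i) * sumX m) ⊗ₜ[ℂ] e (some i) + (2 : ℂ) • e (some (i + 1)) ⊗ₜ[ℂ] e (some i) +
      e (some (i + 1)) ⊗ₜ[ℂ] (sumX m * e (some (i + 1)) * sumY m) := fun i => by
    have t1 : ∀ b c d : PathAlg m, (inr b : PathAlg m ⊗[ℂ] PathAlg m) * c ⊗ₜ[ℂ] d * inl 1 =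
      c ⊗ₜ[ℂ] (b * d) := fun b c d => by simp [← Algebra.TensorProduct.one_def]
    simp only [pairBracket, hs, bracketOf_eq, inner_apply, h1, h2, mul_zero, zero_mul,
      map_zero, dPartial_sumX, dPartial_sumY, t1, glue_tmul]
    have hA : e (some (i + 1)) * ((1 + arr (some i, true) * arr (some i, false)) *
        e (some (i + 1))) = e (some (i + 1)) + sumY m * e (some i) * sumX m := by
      refine (e_mul_oneAdd_mul_e (some i, true)).trans (congrArg _ ?_)
      rw [← sumY_mul_e, mul_assoc]
      exact congrArg _ (e_tail_mul (some i, false)) |>.trans (by rw [mul_assoc, e_mul_sumX])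
    have hB : e (some i) * ((1 + arr (some i, false) * arr (some i, true)) *
        e (some i)) = e (some i) + sumX m * e (some (i + 1)) * sumY m := by
      refine (e_mul_oneAdd_mul_e (some i, false)).trans (congrArg _ ?_)
      rw [← sumX_mul_e, mul_assoc]
      exact congrArg _ (e_tail_mul (some i, true)) |>.trans (by rw [mul_assoc, e_mul_sumY])
    rw [hA, hB, e_mul_self, e_mul_self]
    simp only [TensorProduct.add_tmul, TensorProduct.tmul_add]
    module
  -- The term at the head i + 1 of x_i is moved to i, so that it combines with the fusion terms at
  -- the same vertex.
  have hsh : ∑ i : ZMod m, e (some (i + 1)) ⊗ₜ[ℂ] (sumX m * e (some (i + 1)) * sumY m) =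
      ∑ i : ZMod m, e (some i) ⊗ₜ[ℂ] (sumX m * e (some i) * sumY m) :=
    Equiv.sum_comp (Equiv.addRight (1 : ZMod m))
      fun i => e (some i) ⊗ₜ[ℂ] (sumX m * e (some i) * sumY m)
  rw [dgal_eq, hp0]
  simp only [hp, bracketOf_eq, fusionF_x_sumY, fusionF_y_sumY, fusionF_v_sumY, fusionF_x_sumX,
    fusionF_y_sumX, fusionF_v_sumX, map_zero, LinearMap.zero_apply, map_neg, LinearMap.neg_apply,
    glue_tmul, sub_zero, add_zero]
  rw [← smul_sub]
  congr 1
  rw [Finset.sum_add_distrib, hsh, ← Finset.sum_add_distrib, ← Finset.sum_sub_distrib]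
  refine Finset.sum_congr rfl fun i _ => ?_
  simp only [mul_assoc, e_mul_self, neg_neg, ← mul_assoc (e (some i)) (e (some i))]
  abel

theorem sumX_mul_sumY : sumX m * sumY m =
    ∑ i : ZMod m, arr (some i, false) * arr (some i, true) := by
  nth_rewrite 1 [sumX]
  rw [Finset.sum_mul]
  refine Finset.sum_congr rfl fun i _ => ?_
  nth_rewrite 1 [← mul_e_head]
  rw [mul_assoc, show Arrow.head ((some i, false) : Arrow m) = some (i + 1) from rfl, e_mul_sumY]

theorem e_mul_oneAdd (i : ZMod m) :
    e (some i) * (1 + sumX m * sumY m) = (1 + sumX m * sumY m) * e (some i) := by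
  rw [mul_add, add_mul, ← mul_assoc, e_mul_sumX_comm, mul_assoc, e_mul_sumY_comm, mul_assoc,
    mul_one, one_mul]

/-- Since xy is the sum of the x_i y_i, the bracket is a sum of brackets with the moment map factors
1 + x_i y_i, which `dgal_factor_x` gives. Only F_{x_i} acts nontrivially on u = 1 + xy, so no
commutators occur; the mixed terms of the anticommutator cancel because u commutes with e_i. -/
theorem dgal_oneAdd_self : dgal m (1 + sumX m * sumY m) (1 + sumX m * sumY m) =
    (1 / 2 : ℂ) • ∑ i : ZMod m,
      (((1 + sumX m * sumY m) * e (some i) * (1 + sumX m * sumY m)) ⊗ₜ[ℂ] e (some i) -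
        e (some i) ⊗ₜ[ℂ] ((1 + sumX m * sumY m) * e (some i) * (1 + sumX m * sumY m))) := by
  set u := 1 + sumX m * sumY m with hu
  have hF : ∀ a : Arrow m, fusionF a u = inl (sumX m) * fusionF a (sumY m) +
      fusionF a (sumX m) * inr (sumY m) := fun a => by
    rw [hu, map_add, fusionF_one, zero_add, fusionF_mul]
  have hFv : fusionF (none, false) u = 0 := by
    rw [hF, fusionF_v_sumX, fusionF_v_sumY]; simp
  -- The contributions of x and y to F_{y_{i-1}}(xy) are x e_i ⊗ e_i y with opposite signs.
  have hFy : ∀ i : ZMod m, fusionF (some (i - 1), true) u = 0 := fun i => by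
    rw [hF, fusionF_y_sumX, fusionF_y_sumY]; simp
  have hFx : ∀ i : ZMod m, fusionF (some i, false) u =
      (u * e (some i)) ⊗ₜ[ℂ] e (some i) - e (some i) ⊗ₜ[ℂ] (e (some i) * u) := fun i => by
    rw [hF, fusionF_x_sumX, fusionF_x_sumY, hu]
    simp [add_mul, mul_add, TensorProduct.add_tmul, TensorProduct.tmul_add, mul_assoc]
    abel
  have h1 : dgal m u u = ∑ i : ZMod m, dgal m (factor (some i, false)) u := by
    have : ∀ i : ZMod m, dgal m (factor (some i, false)) u =
        dgal m (arr (some i, false) * arr (some i, true)) u := fun i => by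
      rw [factor, if_neg (by simp), LinearMap.map_add₂, dgal_one_left, zero_add]; rfl
    nth_rewrite 1 [hu]
    rw [LinearMap.map_add₂, dgal_one_left, zero_add, sumX_mul_sumY, map_sum,
      LinearMap.sum_apply]
    simp only [this]
  have hfe : ∀ i : ZMod m, factor (some i, false) * e (some i) = u * e (some i) := fun i => by
    rw [factor, if_neg (by simp), hu, add_mul, add_mul, mul_assoc, mul_assoc (sumX m), sumY_mul_e,
      show Arrow.star ((some i, false) : Arrow m) = (some i, true) from rfl]
    congr 1
    rw [← sumY_mul_e, mul_assoc (sumY m), e_mul_self, ← sumX_mul_e, mul_assoc, ← e_mul_sumY_comm,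
      ← mul_assoc (e _), e_mul_self]
  have hef : ∀ i : ZMod m, e (some i) * factor (some i, false) = e (some i) * u := fun i => by
    rw [factor, if_neg (by simp), hu, mul_add, mul_add, ← mul_assoc, ← mul_assoc, e_mul_sumX]
    congr 1
    rw [show Arrow.star ((some i, false) : Arrow m) = (some i, true) from rfl]
    rw [← e_mul_sumX, ← mul_assoc, e_mul_self, ← e_mul_sumY, ← mul_assoc, e_mul_sumX_comm,
      mul_assoc (sumX m), e_mul_self]
  rw [h1, Finset.smul_sum]
  refine Finset.sum_congr rfl fun i _ => ?_
  rw [dgal_factor_x, hFv, hFy, hFx]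
  have hc := e_mul_oneAdd (m := m) i
  rw [← hu] at hc
  simp only [innerSym, innerComm, mul_zero, zero_mul, sub_zero, ite_self, add_zero]
  congr 1
  simp only [mul_sub, sub_mul, Algebra.TensorProduct.includeLeft_apply,
    Algebra.TensorProduct.includeRight_apply, Algebra.TensorProduct.tmul_mul_tmul, one_mul, mul_one,
    mul_assoc, hef, hfe]
  rw [← mul_assoc (factor (some i, false)) (e _) u, hfe, mul_assoc u, hc]
  abel

end Brackets

end CyclicQuiver

namespace CyclicQuiver

section InfinitesimalInvariance

open RepRing

/-! ## Invariant functions are annihilated by the Lie algebra -/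

/-- A polynomial over a `ℂ`-algebra that vanishes at all non-zero complex numbers is zero. -/
theorem polynomial_eq_zero_of_eval {R : Type*} [CommRing R] [Algebra ℂ R] (p : Polynomial R)
    (h : ∀ s : ℂ, s ≠ 0 → p.eval (algebraMap ℂ R s) = 0) : p = 0 := by
  ext n
  -- R may have zero divisors, so roots cannot be counted over R. A linear functional l : R → ℂ
  -- turns p into a complex polynomial r with infinitely many zeros, and functionals separate the
  -- points of R.
  rw [Polynomial.coeff_zero, ← Module.forall_dual_apply_eq_zero_iff ℂ]
  intro l
  set r : Polynomial ℂ := ∑ i ∈ Finset.range (p.natDegree + 1),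
    Polynomial.C (l (p.coeff i)) * Polynomial.X ^ i with hr
  have hev : ∀ s : ℂ, r.eval s = l (p.eval (algebraMap ℂ R s)) := fun s => by
    rw [hr, Polynomial.eval_finsetSum, Polynomial.eval_eq_sum_range, map_sum]
    refine Finset.sum_congr rfl fun i _ => ?_
    rw [← map_pow, mul_comm (p.coeff i), ← Algebra.smul_def, map_smul, Polynomial.eval_mul,
      Polynomial.eval_C, Polynomial.eval_pow, Polynomial.eval_X, smul_eq_mul, mul_comm]
  have hr0 : r = 0 := by
    refine Polynomial.eq_zero_of_infinite_isRoot r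
      (((Set.finite_singleton (0 : ℂ)).infinite_compl).mono fun s hs => ?_)
    change r.eval s = 0
    rw [hev, h s hs, map_zero]
  have hc : r.coeff n = if n < p.natDegree + 1 then l (p.coeff n) else 0 := by
    rw [hr, Polynomial.finsetSum_coeff]
    simp [Polynomial.coeff_X_pow]
  rw [hr0, Polynomial.coeff_zero] at hc
  split_ifs at hc with hn
  · exact hc.symm
  · rw [Polynomial.coeff_eq_zero_of_natDegree_lt (by omega), map_zero]

variable {V : Type} [Fintype V] [DecidableEq V] {C : Type} [Ring C] [Algebra ℂ C]
  {e : V → C} {α : V → ℕ}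

theorem RepRing.induction_on {P : RepRing e α → Prop} (f : RepRing e α)
    (algebraMap : ∀ c : ℂ, P (algebraMap ℂ _ c)) (coord : ∀ a i j, P (coord e α a i j))
    (add : ∀ f g, P f → P g → P (f + g)) (mul : ∀ f g, P f → P g → P (f * g)) : P f := by
  obtain ⟨p, rfl⟩ := RepRing.mk_surjective f
  induction p using MvPolynomial.induction_on with
  | C c => rw [← MvPolynomial.algebraMap_eq, AlgHom.commutes]; exact algebraMap c
  | add p r hp hr => rw [map_add]; exact add _ _ hp hr
  | mul_X p x hp => rw [map_mul]; exact mul _ _ hp (coord x.1 x.2.1 x.2.2)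

theorem blockIdem_mul_apply {K : Type*} [CommRing K] (s : V) (U : Matrix (RepIdx α) (RepIdx α) K)
    (i j : RepIdx α) : (blockIdem α K s * U) i j = if i.1 = s then U i j else 0 := by
  rw [blockIdem, Matrix.diagonal_mul]; simp

theorem mul_blockIdem_apply {K : Type*} [CommRing K] (s : V) (U : Matrix (RepIdx α) (RepIdx α) K)
    (i j : RepIdx α) : (U * blockIdem α K s) i j = if j.1 = s then U i j else 0 := by
  rw [blockIdem, Matrix.mul_diagonal]; simp

/-- The matrix unit `E_{kl}` if `k` and `l` belong to the block at `s`, and `0` otherwise. -/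
def blockUnit (K : Type*) [CommRing K] (s : V) (k l : RepIdx α) :
    Matrix (RepIdx α) (RepIdx α) K :=
  if k.1 = s ∧ l.1 = s then Matrix.single k l 1 else 0

theorem blockUnit_comm (K : Type*) [CommRing K] (s t : V) (k l : RepIdx α) :
    blockUnit K s k l * blockIdem α K t = blockIdem α K t * blockUnit K s k l := by
  ext i j
  rw [blockIdem_mul_apply, mul_blockIdem_apply, blockUnit]
  by_cases h : k.1 = s ∧ l.1 = s
  · rw [if_pos h]
    by_cases hi : k = i
    · by_cases hj : l = j
      · subst hi hj; rw [h.1, h.2]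
      · simp [hj]
    · simp [hi]
  · simp [h]

/-- The infinitesimal action `a_{uv} ↦ (𝒳(a) E - E 𝒳(a))_{uv}` of a matrix unit. -/
noncomputable def gaugeDeriv (e : V → C) (α : V → ℕ) (s : V) (k l : RepIdx α) :
    Derivation ℂ (RepRing e α) (RepRing e α) :=
  derOf
    { toFun := fun a => univ e α a * blockUnit (RepRing e α) s k l -
        blockUnit (RepRing e α) s k l * univ e α a
      map_add' := fun a b => by rw [map_add, add_mul, mul_add]; abel
      map_smul' := fun c a => by
        rw [map_smul, smul_mul_assoc, mul_smul_comm, RingHom.id_apply, smul_sub] }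
    (fun a b i j => by
      simp only [LinearMap.coe_mk, AddHom.coe_mk]
      generalize blockUnit (RepRing e α) s k l = E
      have : univ e α (a * b) * E - E * univ e α (a * b) =
          univ e α a * (univ e α b * E - E * univ e α b) +
          (univ e α a * E - E * univ e α a) * univ e α b := by
        rw [map_mul]; noncomm_ring
      rw [this, Matrix.add_apply, Matrix.mul_apply, Matrix.mul_apply, ← Finset.sum_add_distrib]
      refine Finset.sum_congr rfl fun x _ => ?_
      simp only [univ_apply, smul_eq_mul]
      ring)
    (fun t => by
      simp only [LinearMap.coe_mk, AddHom.coe_mk]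
      rw [univ_idem, blockUnit_comm, sub_self])
    (by simp)

theorem gaugeDeriv_coord (s : V) (k l : RepIdx α) (a : C) (u v : RepIdx α) :
    gaugeDeriv e α s k l (coord e α a u v) =
      (univ e α a * blockUnit (RepRing e α) s k l -
        blockUnit (RepRing e α) s k l * univ e α a) u v :=
  derOf_coord _ _ _ _ _ _ _

/-- The homomorphism given by a conjugate `g 𝒳(a) g⁻¹` of the universal representation. -/
noncomputable def conjHom {K : Type} [CommRing K] [Algebra ℂ K] (ψ : RepRing e α →ₐ[ℂ] K)
    (g h : Matrix (RepIdx α) (RepIdx α) K) (hgh : g * h = 1) (hhg : h * g = 1)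
    (hg : ∀ s, g * blockIdem α K s = blockIdem α K s * g) : RepRing e α →ₐ[ℂ] K :=
  lift
    (AlgHom.ofLinearMap
      (LinearMap.mulLeftRight ℂ (g, h) ∘ₗ (ψ.mapMatrix.comp (univ e α)).toLinearMap)
      (by simp [hgh])
      (fun a b => by
        simp only [LinearMap.comp_apply, LinearMap.mulLeftRight_apply, AlgHom.toLinearMap_apply,
          map_mul]
        generalize (ψ.mapMatrix.comp (univ e α)) a = A
        generalize (ψ.mapMatrix.comp (univ e α)) b = B
        calc g * (A * B) * h = g * A * 1 * B * h := by simp only [mul_one, mul_assoc]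
          _ = _ := by rw [← hhg]; simp only [mul_assoc]))
    (fun s => by
      have : ψ.mapMatrix (univ e α (e s)) = blockIdem α K s := by
        rw [univ_idem]
        ext i j
        by_cases h : i = j
        · subst h; by_cases hs : i.1 = s <;> simp [blockIdem, hs]
        · simp [blockIdem, h]
      change g * ψ.mapMatrix (univ e α (e s)) * h = _
      rw [this, hg, mul_assoc, hgh, mul_one])

theorem conjHom_coord {K : Type} [CommRing K] [Algebra ℂ K] (ψ : RepRing e α →ₐ[ℂ] K)
    (g h : Matrix (RepIdx α) (RepIdx α) K) (hgh : g * h = 1) (hhg : h * g = 1)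
    (hg : ∀ s, g * blockIdem α K s = blockIdem α K s * g) (a : C) (i j : RepIdx α) :
    conjHom ψ g h hgh hhg hg (coord e α a i j) = (g * (univ e α a).map ψ * h) i j :=
  lift_coord _ _ _ _ _

/-- The coefficient `φ(t)` with `(1 + (t - 1) E_{kl})⁻¹ = 1 + φ(t) E_{kl}`. -/
def invCoeff {K : Type*} [CommRing K] (k l : RepIdx α) (t : Kˣ) : K :=
  if k = l then ((t⁻¹ : Kˣ) : K) - 1 else 1 - (t : K)

/-- E_{kl}² is E_{kl} for k = l and 0 otherwise: the matrix is diagonal in the first case and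
unipotent in the second, which explains the two cases of `invCoeff`. -/
theorem oneParam_mul_inv {K : Type*} [CommRing K] (s : V) (k l : RepIdx α) (t : Kˣ) :
    (1 + ((t : K) - 1) • blockUnit K s k l) * (1 + invCoeff k l t • blockUnit K s k l) = 1 := by
  have h : blockUnit K s k l * blockUnit K s k l =
      if k = l then blockUnit K s k l else 0 := by
    rw [blockUnit]
    by_cases h : k = l
    · subst h; rw [if_pos rfl]; split_ifs <;> simp
    · split_ifs <;> simp [Ne.symm h]
  rw [add_mul, one_mul, mul_add, mul_one, smul_mul_smul_comm, h, invCoeff]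
  split_ifs
  · have := t.mul_inv
    have h2 : ((t : K) - 1) * ((t⁻¹ : Kˣ) - 1 : K) = 2 - t - (t⁻¹ : Kˣ) := by
      linear_combination this
    rw [h2]; module
  · module

theorem oneParam_comm {K : Type*} [CommRing K] (s v : V) (k l : RepIdx α) (c : K) :
    (1 + c • blockUnit K s k l) * blockIdem α K v =
      blockIdem α K v * (1 + c • blockUnit K s k l) := by
  rw [add_mul, mul_add, one_mul, mul_one, smul_mul_assoc, mul_smul_comm, blockUnit_comm]

theorem inv_mul_oneParam {K : Type*} [CommRing K] (s : V) (k l : RepIdx α) (t : Kˣ) :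
    (1 + invCoeff k l t • blockUnit K s k l) * (1 + ((t : K) - 1) • blockUnit K s k l) = 1 :=
  mul_eq_one_comm.1 (oneParam_mul_inv s k l t)

omit [Fintype V] in
theorem map_oneParam {K K' : Type*} [CommRing K] [CommRing K'] (φ : K →+* K') (s : V)
    (k l : RepIdx α) (c : K) :
    (1 + c • blockUnit K s k l).map φ = 1 + φ c • blockUnit K' s k l := by
  ext i j
  rw [blockUnit, blockUnit]
  by_cases h : i = j
  · subst h
    split_ifs
    · simp [Matrix.single_apply, apply_ite φ]
    · simp
  · split_ifs
    · simp [Matrix.single_apply, apply_ite φ, h]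
    · simp [h]

omit [Fintype V] in
theorem map_invCoeff {K K' : Type*} [CommRing K] [CommRing K'] (φ : K →+* K')
    (k l : RepIdx α) (t : Kˣ) :
    φ (invCoeff k l t) = invCoeff k l (Units.map φ.toMonoidHom t) := by
  rw [invCoeff, invCoeff, ← map_inv]
  split_ifs <;> simp

/-- A matrix that commutes with every block idempotent is block diagonal, hence its blocks are the
components of an element of GL_α. The same γ serves all coefficient algebras. -/
theorem exists_blockGL (M N : Matrix (RepIdx α) (RepIdx α) ℂ) (hMN : M * N = 1) (hNM : N * M = 1)
    (hM : ∀ s, M * blockIdem α ℂ s = blockIdem α ℂ s * M)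
    (hN : ∀ s, N * blockIdem α ℂ s = blockIdem α ℂ s * N) :
    ∃ γ : ∀ i : V, GL (Fin (α i)) ℂ, ∀ (K : Type) [CommRing K] [Algebra ℂ K],
      blockGL K γ = M.map (algebraMap ℂ K) ∧ blockGL K γ⁻¹ = N.map (algebraMap ℂ K) := by
  have hd : ∀ M : Matrix (RepIdx α) (RepIdx α) ℂ,
      (∀ s, M * blockIdem α ℂ s = blockIdem α ℂ s * M) →
      Matrix.blockDiagonal' (Matrix.blockDiag' M) = M := fun M hM => by
    ext ⟨i, k⟩ ⟨j, l⟩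
    rw [Matrix.blockDiagonal'_apply]
    split_ifs with h
    · cases h; rfl
    · have := congrFun (congrFun (hM j) ⟨i, k⟩) ⟨j, l⟩
      rw [mul_blockIdem_apply, blockIdem_mul_apply, if_pos rfl, if_neg h] at this
      exact this.symm
  have hprod : ∀ M N : Matrix (RepIdx α) (RepIdx α) ℂ,
      (∀ s, M * blockIdem α ℂ s = blockIdem α ℂ s * M) →
      (∀ s, N * blockIdem α ℂ s = blockIdem α ℂ s * N) → M * N = 1 → ∀ i,
      Matrix.blockDiag' M i * Matrix.blockDiag' N i = 1 := fun M N hM hN h i => by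
    have := congrArg Matrix.blockDiag' (Matrix.blockDiagonal'_mul (Matrix.blockDiag' M)
      (Matrix.blockDiag' N))
    rw [hd M hM, hd N hN, h, Matrix.blockDiag'_blockDiagonal', Matrix.blockDiag'_one] at this
    exact congrFun this i
  refine ⟨fun i => ⟨Matrix.blockDiag' M i, Matrix.blockDiag' N i, hprod M N hM hN hMN i,
    hprod N M hN hM hNM i⟩, fun K _ _ => ⟨?_, ?_⟩⟩
  · refine Eq.trans ?_ (congrArg (fun U => Matrix.map U (algebraMap ℂ K)) (hd M hM))
    rw [Matrix.blockDiagonal'_map _ _ (map_zero _)]; rfl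
  · refine Eq.trans ?_ (congrArg (fun U => Matrix.map U (algebraMap ℂ K)) (hd N hN))
    rw [Matrix.blockDiagonal'_map _ _ (map_zero _)]; rfl

/-- The pull-back of functions along the action of `1 + (t - 1) E_{kl}`. -/
noncomputable def oneParamHom {K : Type} [CommRing K] [Algebra ℂ K] (ψ : RepRing e α →ₐ[ℂ] K)
    (s : V) (k l : RepIdx α) (t : Kˣ) : RepRing e α →ₐ[ℂ] K :=
  conjHom ψ _ _ (oneParam_mul_inv s k l t) (inv_mul_oneParam s k l t)
    fun _ => oneParam_comm _ _ _ _ _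

/-- Naturality in the coefficient ring: the entries of 1 + (t - 1) E_{kl} and of its inverse are
carried to the same expressions in the image of t. So the action with an indeterminate T specialises
to all others. -/
theorem comp_oneParamHom {K K' : Type} [CommRing K] [Algebra ℂ K] [CommRing K'] [Algebra ℂ K']
    (ψ : RepRing e α →ₐ[ℂ] K) (φ : K →ₐ[ℂ] K') (s : V) (k l : RepIdx α) (t : Kˣ) :
    φ.comp (oneParamHom ψ s k l t) =
      oneParamHom (φ.comp ψ) s k l (Units.map (φ : K →+* K').toMonoidHom t) := by
  refine algHom_ext fun a i j => ?_
  have h1 := map_oneParam (φ : K →+* K') s k l ((t : K) - 1)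
  have h2 := map_oneParam (φ : K →+* K') s k l (invCoeff k l t)
  rw [map_invCoeff] at h2
  rw [map_sub, map_one] at h1
  rw [AlgHom.comp_apply, oneParamHom, oneParamHom, conjHom_coord, conjHom_coord]
  refine Eq.trans ?_ (congrFun (congrFun (congrArg₂ (fun A B => A * _ * B) h1 h2) i) j)
  have h3 := (map_mul (φ : K →+* K').mapMatrix ((1 + ((t : K) - 1) • blockUnit K s k l) *
    (univ e α a).map ψ) (1 + invCoeff k l t • blockUnit K s k l)).trans
    (congrArg (· * _) (map_mul (φ : K →+* K').mapMatrix _ _))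
  exact congrFun (congrFun h3 i) j

theorem exists_act_eq_oneParamHom (s : V) (k l : RepIdx α) (t : ℂˣ) :
    ∃ γ : ∀ i : V, GL (Fin (α i)) ℂ, act γ = oneParamHom (AlgHom.id ℂ (RepRing e α)) s k l
      (Units.map (algebraMap ℂ (RepRing e α)).toMonoidHom t) := by
  obtain ⟨γ, hγ⟩ := exists_blockGL _ _ (oneParam_mul_inv s k l t) (inv_mul_oneParam s k l t)
    (fun _ => oneParam_comm _ _ _ _ _) (fun _ => oneParam_comm _ _ _ _ _)
  refine ⟨γ, algHom_ext fun a i j => ?_⟩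
  rw [oneParamHom, conjHom_coord, act_coord, (hγ _).1, (hγ _).2, map_oneParam, map_oneParam,
    map_invCoeff, map_sub, map_one]
  rfl

/-! ### The action with an indeterminate parameter, over Laurent polynomials -/

/-- The inclusion of constants into Laurent polynomials. -/
noncomputable def laurentConst (R : Type*) [CommRing R] [Algebra ℂ R] :
    R →ₐ[ℂ] LaurentPolynomial R :=
  { LaurentPolynomial.C with commutes' := fun _ => rfl }

/-- The unit `T`. -/
noncomputable def laurentUnit (R : Type*) [CommRing R] : (LaurentPolynomial R)ˣ :=
  ⟨.T 1, .T (-1), by rw [← LaurentPolynomial.T_add]; simp,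
    by rw [← LaurentPolynomial.T_add]; simp⟩

/-- The evaluation of a Laurent polynomial over `R` at a unit of a `ℂ`-algebra. -/
noncomputable def laurentEval {R K : Type*} [CommRing R] [Algebra ℂ R] [CommRing K] [Algebra ℂ K]
    (f : R →ₐ[ℂ] K) (t : Kˣ) : LaurentPolynomial R →ₐ[ℂ] K :=
  { LaurentPolynomial.eval₂ f.toRingHom t with
    commutes' := fun c => (LaurentPolynomial.eval₂_C f.toRingHom t _).trans (f.commutes c) }

theorem laurentEval_comp_const {R K : Type*} [CommRing R] [Algebra ℂ R] [CommRing K] [Algebra ℂ K]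
    (f : R →ₐ[ℂ] K) (t : Kˣ) : (laurentEval f t).comp (laurentConst R) = f :=
  AlgHom.ext fun _ => LaurentPolynomial.eval₂_C f.toRingHom t _

theorem laurentEval_unit {R K : Type*} [CommRing R] [Algebra ℂ R] [CommRing K] [Algebra ℂ K]
    (f : R →ₐ[ℂ] K) (t : Kˣ) : Units.map (laurentEval f t : LaurentPolynomial R →+* K).toMonoidHom
      (laurentUnit R) = t := by
  refine Units.ext ((LaurentPolynomial.eval₂_T f.toRingHom t 1).trans ?_)
  rw [zpow_one]

/-- The pull-back of functions along the action of `1 + (T - 1) E_{kl}`. -/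
noncomputable def coaction (e : V → C) (α : V → ℕ) (s : V) (k l : RepIdx α) :
    RepRing e α →ₐ[ℂ] LaurentPolynomial (RepRing e α) :=
  oneParamHom (laurentConst _) s k l (laurentUnit _)

theorem laurentEval_coaction {K : Type} [CommRing K] [Algebra ℂ K] (f : RepRing e α →ₐ[ℂ] K)
    (t : Kˣ) (s : V) (k l : RepIdx α) :
    (laurentEval f t).comp (coaction e α s k l) = oneParamHom f s k l t := by
  rw [coaction, comp_oneParamHom, laurentEval_comp_const, laurentEval_unit]

-- At each complex t ≠ 0 the coaction specialises to the action of a point of GL_α, which fixes F.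
-- After multiplication by a power T^n it becomes a polynomial that agrees with F T^n at all these
-- t, hence equals it.
open LaurentPolynomial in
theorem coaction_of_invariant {F : RepRing e α} (hF : F ∈ invariants e α) (s : V)
    (k l : RepIdx α) : coaction e α s k l F = LaurentPolynomial.C F := by
  have hev : ∀ t : ℂˣ, laurentEval (AlgHom.id ℂ (RepRing e α)) (Units.map
      (algebraMap ℂ (RepRing e α)).toMonoidHom t) (coaction e α s k l F) = F := fun t => by
    obtain ⟨γ, hγ⟩ := exists_act_eq_oneParamHom (e := e) s k l t
    rw [← AlgHom.comp_apply, laurentEval_coaction, ← hγ]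
    exact hF γ
  obtain ⟨n, p, hp⟩ := exists_T_pow (coaction e α s k l F)
  have hp0 : p - Polynomial.C F * Polynomial.X ^ n = 0 := by
    refine polynomial_eq_zero_of_eval _ fun t ht => ?_
    have h1 := hev (Units.mk0 t ht)
    have h2 := congrArg (laurentEval (AlgHom.id ℂ (RepRing e α)) (Units.map
      (algebraMap ℂ (RepRing e α)).toMonoidHom (Units.mk0 t ht))) hp
    rw [map_mul, h1] at h2
    have h3 : laurentEval (AlgHom.id ℂ (RepRing e α)) (Units.map
      (algebraMap ℂ (RepRing e α)).toMonoidHom (Units.mk0 t ht)) (T n) =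
        algebraMap ℂ (RepRing e α) t ^ n := by
      refine (eval₂_T_n _ _ n).trans ?_
      simp
    have h4 : laurentEval (AlgHom.id ℂ (RepRing e α)) (Units.map
      (algebraMap ℂ (RepRing e α)).toMonoidHom (Units.mk0 t ht)) (Polynomial.toLaurent p) =
        p.eval (algebraMap ℂ (RepRing e α) t) := eval₂_toLaurent _ _ p
    rw [h3, h4] at h2
    simp [h2]
  rw [sub_eq_zero] at hp0
  rw [hp0, Polynomial.toLaurent_C_mul_X_pow] at hp
  exact ((isUnit_T (n : ℤ)).mul_right_cancel hp).symm

/-- Invariant functions are annihilated by the Lie algebra. -/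
theorem gaugeDeriv_of_invariant {F : RepRing e α} (hF : F ∈ invariants e α) (s : V)
    (k l : RepIdx α) : gaugeDeriv e α s k l F = 0 := by
  -- T is specialised to 1 + ε, with inverse 1 - ε. Conjugation by 1 + ε E_{kl} is the identity
  -- minus ε times `gaugeDeriv`; on an invariant F it is also the constant F, by
  -- `coaction_of_invariant`.
  let t : (TrivSqZeroExt (RepRing e α) (RepRing e α))ˣ :=
    ⟨.inl 1 + .inr 1, .inl 1 - .inr 1, by ext <;> simp, by ext <;> simp⟩
  have key : ∀ f : RepRing e α,
      laurentEval (TrivSqZeroExt.inlAlgHom ℂ (RepRing e α) (RepRing e α)) t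
        (coaction e α s k l f) = .inl f - .inr (gaugeDeriv e α s k l f) := fun f => by
    rw [← AlgHom.comp_apply, laurentEval_coaction]
    induction f using RepRing.induction_on with
    | algebraMap c => 
      rw [AlgHom.commutes, Derivation.map_algebraMap, TrivSqZeroExt.inr_zero, sub_zero]
      exact ((TrivSqZeroExt.inlAlgHom ℂ (RepRing e α) (RepRing e α)).commutes c).symm
    | add f g hf hg => rw [map_add, map_add, hf, hg]; ext <;> simp; abel
    | mul f g hf hg =>
      rw [map_mul, Derivation.leibniz, hf, hg]; ext <;> simp; ring
    | coord a i j =>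
      rw [oneParamHom, conjHom_coord, gaugeDeriv_coord]
      have h1 : ((t : TrivSqZeroExt (RepRing e α) (RepRing e α)) - 1) = .inr 1 := by
        ext <;> simp [t]
      -- Both cases of `invCoeff` give -ε at 1 + ε, so diagonal and off-diagonal matrix units need
      -- no distinction from here on.
      have h2 : invCoeff k l t = -(.inr 1 : TrivSqZeroExt (RepRing e α) (RepRing e α)) := by
        rw [invCoeff]
        split_ifs <;> ext <;> simp [t]
      rw [h1, h2]
      have h3 : blockUnit (TrivSqZeroExt (RepRing e α) (RepRing e α)) s k l =
          (blockUnit (RepRing e α) s k l).map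
            (TrivSqZeroExt.inlAlgHom ℂ (RepRing e α) (RepRing e α)) := by
        rw [blockUnit, blockUnit]
        split_ifs
        · ext a b <;> by_cases hk : k = a <;> by_cases hl : l = b <;> simp [hk, hl]
        · ext a b <;> simp
      rw [h3, ← univ_apply]
      generalize blockUnit (RepRing e α) s k l = E
      generalize univ e α a = U
      have h4 : ∀ W : Matrix (RepIdx α) (RepIdx α) (RepRing e α),
          W.map (TrivSqZeroExt.inlAlgHom ℂ (RepRing e α) (RepRing e α)) =
            (TrivSqZeroExt.inlHom (RepRing e α) (RepRing e α)).mapMatrix W := fun _ => rfl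
      have h5 : (1 + (TrivSqZeroExt.inr 1 : TrivSqZeroExt (RepRing e α) (RepRing e α)) •
            E.map (TrivSqZeroExt.inlAlgHom ℂ (RepRing e α) (RepRing e α))) *
          U.map (TrivSqZeroExt.inlAlgHom ℂ (RepRing e α) (RepRing e α)) *
          (1 + (-TrivSqZeroExt.inr 1 : TrivSqZeroExt (RepRing e α) (RepRing e α)) •
            E.map (TrivSqZeroExt.inlAlgHom ℂ (RepRing e α) (RepRing e α))) =
          U.map (TrivSqZeroExt.inlAlgHom ℂ (RepRing e α) (RepRing e α)) -
          (TrivSqZeroExt.inr 1 : TrivSqZeroExt (RepRing e α) (RepRing e α)) •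
            (U * E - E * U).map (TrivSqZeroExt.inlAlgHom ℂ (RepRing e α) (RepRing e α)) := by
        have h6 : (TrivSqZeroExt.inr 1 : TrivSqZeroExt (RepRing e α) (RepRing e α)) *
            TrivSqZeroExt.inr 1 = 0 := TrivSqZeroExt.inr_mul_inr _ _ _
        simp only [h4, map_sub, map_mul, add_mul, mul_add, one_mul, mul_one, smul_mul_assoc,
          mul_smul_comm, neg_smul, smul_add, smul_smul, h6, mul_neg, zero_smul, smul_sub]
        abel
      rw [h5]
      ext <;> simp
  have h := key F
  rw [coaction_of_invariant hF] at h
  have h' := congrArg TrivSqZeroExt.snd h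
  rw [show laurentEval (TrivSqZeroExt.inlAlgHom ℂ (RepRing e α) (RepRing e α)) t
    (LaurentPolynomial.C F) = .inl F from LaurentPolynomial.eval₂_C _ _ _] at h'
  simpa using h'

end InfinitesimalInvariance

end CyclicQuiver

namespace CyclicQuiver

variable {m : ℕ} [NeZero m] {α : ZMod m → ℕ}

section BracketSymmetries

open RepRing PathAlg

/-! ## Antisymmetry and equivariance of the bracket -/

theorem ev_comm (u j i v : RepIdx (framed α)) (ξ : PathAlg m ⊗[ℂ] PathAlg m) :
    ev α i v u j (TensorProduct.comm ℂ _ _ ξ) = ev α u j i v ξ := by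
  induction ξ with
  | zero => simp
  | tmul p q => simp [ev_tmul, mul_comm]
  | add p q hp hq => simp only [map_add, hp, hq]

theorem repBracket_add_left (f f' g : RepA α) :
    repBracket α (f + f') g = repBracket α f g + repBracket α f' g := by
  rw [map_add, Derivation.add_apply]

theorem repBracket_mul_left (f f' g : RepA α) :
    repBracket α (f * f') g = f * repBracket α f' g + f' * repBracket α f g := by
  rw [Derivation.leibniz]; rfl

theorem repBracket_mul_right (f g g' : RepA α) :
    repBracket α f (g * g') = g * repBracket α f g' + g' * repBracket α f g := by
  rw [Derivation.leibniz]; rfl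

theorem repBracket_algebraMap_left (c : ℂ) (g : RepA α) :
    repBracket α (algebraMap ℂ _ c) g = 0 := by
  rw [Derivation.map_algebraMap]; rfl

/-- By the Leibniz rules it is enough to take coordinate functions, where it is the antisymmetry
`dgal_comm` of the double bracket. -/
theorem repBracket_antisymm (f g : RepA α) : repBracket α f g = -repBracket α g f := by
  induction f using RepRing.induction_on with
  | algebraMap c => rw [repBracket_algebraMap_left, Derivation.map_algebraMap, neg_zero]
  | add f f' hf hf' => rw [repBracket_add_left, map_add, hf, hf', neg_add]
  | mul f f' hf hf' => rw [repBracket_mul_left, repBracket_mul_right, hf, hf']; ring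
  | coord a i j =>
    induction g using RepRing.induction_on with
    | algebraMap c => rw [repBracket_algebraMap_left, Derivation.map_algebraMap, neg_zero]
    | add f f' hf hf' => rw [repBracket_add_left, map_add, hf, hf', neg_add]
    | mul f f' hf hf' => rw [repBracket_mul_left, repBracket_mul_right, hf, hf']; ring
    | coord b u v =>
      rw [repBracket_coord, repBracket_coord, ← ev_comm, dgal_comm, map_neg]

theorem act_coord_sum {V : Type} [Fintype V] [DecidableEq V] {C : Type} [Ring C] [Algebra ℂ C]
    {e : V → C} {α : V → ℕ} (g : ∀ i : V, GL (Fin (α i)) ℂ) (a : C) (i j : RepIdx α) :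
    act g (coord e α a i j) = ∑ l, ∑ k,
      (blockGL ℂ g i k * blockGL ℂ g⁻¹ l j) • coord e α a k l := by
  have h : ∀ (g : ∀ i : V, GL (Fin (α i)) ℂ) i j, blockGL (RepRing e α) g i j =
      algebraMap ℂ _ (blockGL ℂ g i j) := fun g i j => by
    obtain ⟨i, i'⟩ := i
    obtain ⟨j, j'⟩ := j
    rw [blockGL, blockGL, Matrix.blockDiagonal'_apply, Matrix.blockDiagonal'_apply]
    split_ifs with hij
    · simp
    · simp
  rw [act_coord, Matrix.mul_apply]
  refine Finset.sum_congr rfl fun l _ => ?_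
  rw [Matrix.mul_apply, Finset.sum_mul]
  refine Finset.sum_congr rfl fun k _ => ?_
  rw [h, h, univ_apply, Algebra.smul_def, map_mul]
  ring

theorem repBracket_smul_smul (c d : ℂ) (f g : RepA α) :
    repBracket α (c • f) (d • g) = (c * d) • repBracket α f g := by
  rw [Algebra.smul_def c f, repBracket_mul_left, repBracket_algebraMap_left, mul_zero, add_zero,
    Derivation.map_smul, ← Algebra.smul_def, smul_smul]

theorem act_ev (g : ∀ i : Vertex m, GL (Fin (framed α i)) ℂ) (u j i v : RepIdx (framed α))
    (ξ : PathAlg m ⊗[ℂ] PathAlg m) :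
    act g (ev α u j i v ξ) = ∑ r, ∑ p, ∑ l, ∑ k,
      ((blockGL ℂ g i k * blockGL ℂ g⁻¹ l j) * (blockGL ℂ g u p * blockGL ℂ g⁻¹ r v)) •
        ev α p l k r ξ := by
  induction ξ with
  | zero => simp
  | add x y hx hy => simp only [map_add, hx, hy, smul_add, Finset.sum_add_distrib]
  | tmul x y =>
    have h : act g (ev α u j i v (x ⊗ₜ[ℂ] y)) = ∑ l, ∑ p, ∑ r, ∑ k,
        ((blockGL ℂ g i k * blockGL ℂ g⁻¹ l j) * (blockGL ℂ g u p * blockGL ℂ g⁻¹ r v)) •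
          ev α p l k r (x ⊗ₜ[ℂ] y) := by
      rw [ev_tmul, map_mul, act_coord_sum, act_coord_sum, Finset.sum_mul]
      refine Finset.sum_congr rfl fun l _ => ?_
      rw [Finset.sum_mul]
      refine Finset.sum_congr rfl fun p _ => ?_
      rw [Finset.mul_sum]
      refine Finset.sum_congr rfl fun r _ => ?_
      rw [Finset.mul_sum]
      refine Finset.sum_congr rfl fun k _ => ?_
      rw [smul_mul_smul_comm, ev_tmul]
      congr 1
      ring
    rw [h, Finset.sum_comm, Finset.sum_congr rfl fun p _ => Finset.sum_comm, Finset.sum_comm]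

/-- On coordinates, the indices u, i of {{a,b}}'_{uj} {{a,b}}''_{iv} transform by g and j, v by g⁻¹,
exactly as in the product a_{ij} b_{uv}; this is the content of `act_ev`. -/
theorem act_repBracket (g : ∀ i : Vertex m, GL (Fin (framed α i)) ℂ) (f f' : RepA α) :
    act g (repBracket α f f') = repBracket α (act g f) (act g f') := by
  induction f using RepRing.induction_on with
  | algebraMap c =>
    rw [repBracket_algebraMap_left, AlgHom.commutes, repBracket_algebraMap_left, map_zero]
  | add f f'' hf hf' => rw [repBracket_add_left, map_add, map_add, hf, hf', repBracket_add_left]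
  | mul f f'' hf hf' =>
    rw [repBracket_mul_left, map_add, map_mul, map_mul, map_mul, hf, hf', repBracket_mul_left]
  | coord a i j =>
    induction f' using RepRing.induction_on with
    | algebraMap c =>
      rw [AlgHom.commutes, Derivation.map_algebraMap, Derivation.map_algebraMap, map_zero]
    | add f f'' hf hf' => rw [map_add, map_add, map_add, map_add, hf, hf']
    | mul f f'' hf hf' =>
      rw [repBracket_mul_right, map_add, map_mul, map_mul, map_mul, hf, hf', repBracket_mul_right]
    | coord b u v =>
      rw [repBracket_coord, act_ev, act_coord_sum, act_coord_sum]
      simp only [map_sum, derivation_sum_apply, repBracket_smul_smul, repBracket_coord]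

end BracketSymmetries

section Reduction

open RepRing PathAlg

variable (α) (q : ZMod m → ℂˣ)

/-! ## Quasi-Hamiltonian reduction -/

theorem restrict_coord (a : PathAlg m) (i j : RepIdx (framed α)) :
    restrict α q (coord PathAlg.e (framed α) a i j) =
      coord (fun i : Vertex m => toPreproj α q (e i)) (framed α) (toPreproj α q a) i j := by
  rw [restrict, RepRing.map, lift_coord]
  rfl

theorem toPreproj_surjective : Function.Surjective (toPreproj α q) :=
  RingQuot.mkAlgHom_surjective ℂ _

theorem toPreproj_moment (s : Vertex m) :
    toPreproj α q (moment s) = (framedParam α q s : ℂ) • toPreproj α q (e s) := by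
  rw [← map_smul]
  exact RingQuot.mkAlgHom_rel ℂ (RelPreproj.moment s)

theorem restrict_surjective : Function.Surjective (restrict α q) := fun f => by
  induction f using RepRing.induction_on with
  | algebraMap c => exact ⟨algebraMap ℂ _ c, AlgHom.commutes _ c⟩
  | coord a i j =>
    obtain ⟨a, rfl⟩ := toPreproj_surjective α q a
    exact ⟨_, restrict_coord α q a i j⟩
  | add f g hf hg =>
    obtain ⟨f, rfl⟩ := hf
    obtain ⟨g, rfl⟩ := hg
    exact ⟨f + g, map_add _ _ _⟩
  | mul f g hf hg =>
    obtain ⟨f, rfl⟩ := hf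
    obtain ⟨g, rfl⟩ := hg
    exact ⟨f * g, map_mul _ _ _⟩

/-- The ideal generated by the entries of `Φ - q̃`. -/
noncomputable def momentIdeal : Ideal (RepA α) :=
  Ideal.span {f | ∃ s i j, f = coord PathAlg.e (framed α)
    (moment s - (framedParam α q s : ℂ) • e s) i j}

/-- Over the quotient of O(Rep(A, α̃)) by the entries of Φ - q̃, the universal representation of A
factors through Λ^{q̃}. By the universal property the quotient map factors through `restrict`, so it
kills all that `restrict` kills. -/
theorem mem_momentIdeal {f : RepA α} (hf : restrict α q f = 0) : f ∈ momentIdeal α q := by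
  let J := momentIdeal α q
  let π : RepA α →ₐ[ℂ] RepA α ⧸ J := Ideal.Quotient.mkₐ ℂ J
  let τ : PathAlg m →ₐ[ℂ] Matrix (RepIdx (framed α)) (RepIdx (framed α)) (RepA α ⧸ J) :=
    π.mapMatrix.comp (univ PathAlg.e (framed α))
  have hτ : ∀ ⦃a b : PathAlg m⦄, RelPreproj α q a b → τ a = τ b := by
    rintro _ _ ⟨s⟩
    rw [← sub_eq_zero, ← map_sub]
    ext i j
    exact Ideal.Quotient.eq_zero_iff_mem.2 (Ideal.subset_span ⟨s, i, j, rfl⟩)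
  let σ : Preproj α q →ₐ[ℂ] Matrix (RepIdx (framed α)) (RepIdx (framed α)) (RepA α ⧸ J) :=
    RingQuot.liftAlgHom ℂ ⟨τ, hτ⟩
  have hσ : ∀ a, σ (toPreproj α q a) = τ a := fun a =>
    RingQuot.liftAlgHom_mkAlgHom_apply ℂ τ hτ a
  have hσe : ∀ s : Vertex m, σ (toPreproj α q (e s)) = blockIdem (framed α) (RepA α ⧸ J) s := by
    intro s
    rw [hσ]
    change π.mapMatrix (univ PathAlg.e (framed α) (e s)) = _
    rw [univ_idem]
    ext i j
    by_cases h : i = j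
    · subst h; by_cases hs : i.1 = s <;> simp [blockIdem, hs]
    · simp [blockIdem, h]
  have hcomp : (RepRing.lift σ hσe).comp (restrict α q) = π := algHom_ext fun a i j => by
    rw [AlgHom.comp_apply, restrict_coord, lift_coord, hσ]
    rfl
  have : π f = 0 := by rw [← hcomp, AlgHom.comp_apply, hf, map_zero]
  exact Ideal.Quotient.eq_zero_iff_mem.1 this

theorem coord_smul {V C : Type} [Fintype V] [DecidableEq V] [Ring C] [Algebra ℂ C] {e : V → C}
    {α : V → ℕ} (c : ℂ) (a : C) (i j : RepIdx α) :
    coord e α (c • a) i j = c • coord e α a i j := by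
  simp only [← univ_apply, map_smul, Matrix.smul_apply]

theorem blockIdem_apply {V : Type} [DecidableEq V] {α : V → ℕ} {K : Type*}
    [CommRing K] (s : V) (i j : RepIdx α) :
    blockIdem α K s i j = if i = j then if i.1 = s then 1 else 0 else 0 := by
  rw [blockIdem, Matrix.diagonal_apply]

theorem blockUnit_commutator_apply {V : Type} [Fintype V] [DecidableEq V] {α : V → ℕ} {K : Type*}
    [CommRing K] (s : V) (k l u v : RepIdx α) (U : Matrix (RepIdx α) (RepIdx α) K) :
    (U * blockUnit K s k l - blockUnit K s k l * U) u v =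
      (if k.1 = s then U u k else 0) * blockIdem α K s l v -
        blockIdem α K s u k * if l.1 = s then U l v else 0 := by
  rw [Matrix.sub_apply, blockUnit]
  by_cases hk : k.1 = s
  · by_cases hl : l.1 = s
    · rw [if_pos ⟨hk, hl⟩, if_pos hk, if_pos hl, blockIdem_apply, blockIdem_apply]
      congr 1
      · by_cases h : l = v
        · subst h; simp [hl]
        · simp [h, Matrix.mul_single_apply_of_ne _ _ _ _ _ (Ne.symm h)]
      · by_cases h : u = k
        · subst h; simp [hk]
        · simp [h, Matrix.single_mul_apply_of_ne _ _ _ _ _ h]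
    · by_cases h : l = v
      · subst h; simp [hl, blockIdem_apply]
      · simp [hl, blockIdem_apply, h]
  · by_cases h : u = k
    · subst h; simp [hk, blockIdem_apply]
    · simp [hk, blockIdem_apply, h]

/-- On `{Φ = q̃}`, the Hamiltonian vector fields of the entries of `Φ` are given by the
infinitesimal action. -/
theorem restrict_repBracket_moment (s : Vertex m) (i j : RepIdx (framed α)) (g : RepA α) :
    restrict α q (repBracket α (coord PathAlg.e (framed α)
      (moment s - (framedParam α q s : ℂ) • e s) i j) g) =
      (framedParam α q s : ℂ) • gaugeDeriv _ _ s j i (restrict α q g) := by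
  induction g using RepRing.induction_on with
  | algebraMap c =>
    rw [AlgHom.commutes, Derivation.map_algebraMap, Derivation.map_algebraMap, map_zero, smul_zero]
  | add f g hf hg => rw [map_add, map_add, hf, hg, map_add, map_add, smul_add]
  | mul f g hf hg =>
    rw [Derivation.leibniz, map_add, smul_eq_mul, smul_eq_mul, map_mul, map_mul, hf, hg, map_mul,
      Derivation.leibniz, smul_add, smul_eq_mul, smul_eq_mul, mul_smul_comm, mul_smul_comm]
  | coord b u v =>
    have h1 : dgal m (moment s - (framedParam α q s : ℂ) • e s) b = dgal m (moment s) b := by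
      rw [map_sub, map_smul, LinearMap.sub_apply, LinearMap.smul_apply, dgal_e_left, smul_zero,
        sub_zero]
    have he : ∀ i j, coord (fun i : Vertex m => toPreproj α q (e i)) (framed α)
        (toPreproj α q (e s)) i j = blockIdem (framed α) _ s i j := fun i j => by
      rw [← univ_apply, univ_idem (e := fun i : Vertex m => toPreproj α q (e i))]
    have hbe : ∀ (b : Preproj α q) i j, coord (fun i : Vertex m => toPreproj α q (e i)) (framed α)
        (b * toPreproj α q (e s)) i j = if j.1 = s then coord _ _ b i j else 0 := fun b i j => by
      rw [← univ_apply, map_mul, univ_idem (e := fun i : Vertex m => toPreproj α q (e i)),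
        mul_blockIdem_apply]; rfl
    have heb : ∀ (b : Preproj α q) i j, coord (fun i : Vertex m => toPreproj α q (e i)) (framed α)
        (toPreproj α q (e s) * b) i j = if i.1 = s then coord _ _ b i j else 0 := fun b i j => by
      rw [← univ_apply, map_mul, univ_idem (e := fun i : Vertex m => toPreproj α q (e i)),
        blockIdem_mul_apply]; rfl
    rw [repBracket_coord, h1, dgal_moment, restrict_coord, gaugeDeriv_coord]
    -- On {Φ = q̃} both Φ_s and Φ_s e_s become q̃_s e_s. The four terms of `dgal_moment` then
    -- coincide in pairs, which absorbs the factor 1/2 and leaves the commutator with the matrix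
    -- unit E_{ji}.
    simp only [map_smul, map_add, map_sub, ev_tmul, map_mul, restrict_coord, toPreproj_moment,
      mul_smul_comm, smul_mul_assoc, coord_smul, hbe, heb, he, mul_assoc]
    rw [blockUnit_commutator_apply]
    have h2 : ∀ v : RepIdx (framed α), (if v.1 = s then
        blockIdem (framed α) (RepPreproj α q) s i v else 0) =
          blockIdem (framed α) (RepPreproj α q) s i v := fun v => by
      rw [blockIdem_apply]
      by_cases h : i = v
      · subst h; by_cases hi : i.1 = s <;> simp [hi]
      · simp [h]
    rw [h2, univ_apply, univ_apply]
    have h3 : ∀ x : RepPreproj α q, (if i.1 = s then if i.1 = s then x else 0 else 0) =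
        if i.1 = s then x else 0 := fun x => by split_ifs <;> rfl
    rw [h3]
    module

/-- A function that vanishes on `{Φ = q̃}` Poisson commutes there with the functions that restrict
to invariants. -/
theorem restrict_repBracket_of_restrict_eq_zero {f g : RepA α} (hf : restrict α q f = 0)
    (hg : restrict α q g ∈ QuiverVariety α q) : restrict α q (repBracket α f g) = 0 := by
  -- The vanishing of f is carried along in the induction: for a product a f, the Leibniz term {a,
  -- g} f disappears only because f restricts to zero.
  have h : restrict α q f = 0 ∧ restrict α q (repBracket α f g) = 0 := by
    have hmem := mem_momentIdeal α q hf
    clear hf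
    induction hmem using Submodule.span_induction with
    | mem f hf =>
      obtain ⟨s, i, j, rfl⟩ := hf
      refine ⟨?_, ?_⟩
      · rw [restrict_coord, map_sub, map_smul, toPreproj_moment, sub_self, ← univ_apply, map_zero,
          Matrix.zero_apply]
      · rw [restrict_repBracket_moment, gaugeDeriv_of_invariant hg, smul_zero]
    | zero => exact ⟨map_zero _, by rw [map_zero, Derivation.zero_apply, map_zero]⟩
    | add f f' _ _ hf hf' =>
      refine ⟨by rw [map_add, hf.1, hf'.1, add_zero], ?_⟩
      rw [repBracket_add_left, map_add, hf.2, hf'.2, add_zero]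
    | smul a f _ hf =>
      refine ⟨by rw [smul_eq_mul, map_mul, hf.1, mul_zero], ?_⟩
      rw [smul_eq_mul, repBracket_mul_left, map_add, map_mul, map_mul, hf.1, hf.2, mul_zero,
        zero_mul, add_zero]
  exact h.2

/-- The two arguments are changed one at a time, the second with the help of antisymmetry. Each
change adds the bracket of a function vanishing on {Φ = q̃} with one whose restriction is invariant.
-/
theorem restrict_repBracket_congr {f f' g g' : RepA α} (hf : restrict α q f = restrict α q f')
    (hg : restrict α q g = restrict α q g') (hF : restrict α q f ∈ QuiverVariety α q)
    (hG : restrict α q g ∈ QuiverVariety α q) :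
    restrict α q (repBracket α f g) = restrict α q (repBracket α f' g') := by
  have h1 : restrict α q (repBracket α (f - f') g) = 0 :=
    restrict_repBracket_of_restrict_eq_zero α q (by rw [map_sub, hf, sub_self]) hG
  have h2 : restrict α q (repBracket α (g - g') f') = 0 :=
    restrict_repBracket_of_restrict_eq_zero α q (by rw [map_sub, hg, sub_self]) (hf ▸ hF)
  rw [map_sub, Derivation.sub_apply, map_sub, sub_eq_zero] at h1 h2
  rw [h1, repBracket_antisymm, map_neg, h2, ← map_neg, ← repBracket_antisymm]

theorem act_restrict (g : ∀ i : Vertex m, GL (Fin (framed α i)) ℂ) (f : RepA α) :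
    act g (restrict α q f) = restrict α q (act g f) := by
  have : (act g).comp (restrict α q) = (restrict α q).comp (act g) :=
    algHom_ext fun a i j => by
      rw [AlgHom.comp_apply, AlgHom.comp_apply, restrict_coord, act_coord_sum, act_coord_sum,
        map_sum]
      refine Finset.sum_congr rfl fun l _ => ?_
      rw [map_sum]
      refine Finset.sum_congr rfl fun k _ => ?_
      rw [map_smul, restrict_coord]
  exact DFunLike.congr_fun this f

/-- f itself need not be invariant. By equivariance γ moves {f, g} to {γf, γg}, and γf restricts to
the same function as f, so `restrict_repBracket_congr` applies. -/
theorem restrict_repBracket_mem {f g : RepA α} (hF : restrict α q f ∈ QuiverVariety α q)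
    (hG : restrict α q g ∈ QuiverVariety α q) :
    restrict α q (repBracket α f g) ∈ QuiverVariety α q := fun γ => by
  rw [act_restrict, act_repBracket]
  refine (restrict_repBracket_congr α q ?_ ?_ hF hG).symm
  · rw [← act_restrict, hF γ]
  · rw [← act_restrict, hG γ]

/-- An arbitrary set-theoretic section of `restrict` serves as a choice of lifts. Bilinearity holds
although the section is not linear, because the restricted bracket does not depend on the lifts. -/
theorem exists_isReducedBracket : ∃ br, IsReducedBracket α q br := by
  let lft : QuiverVariety α q → RepA α := fun F =>
    Function.surjInv (restrict_surjective α q) (F : RepPreproj α q)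
  have hl : ∀ F : QuiverVariety α q, restrict α q (lft F) = F := fun F =>
    Function.surjInv_eq (restrict_surjective α q) _
  have hmem : ∀ F : QuiverVariety α q, restrict α q (lft F) ∈ QuiverVariety α q := fun F => by
    rw [hl]; exact F.2
  let br : QuiverVariety α q →ₗ[ℂ] QuiverVariety α q →ₗ[ℂ] QuiverVariety α q :=
    LinearMap.mk₂ ℂ
      (fun F G => ⟨restrict α q (repBracket α (lft F) (lft G)),
        restrict_repBracket_mem α q (hmem F) (hmem G)⟩)
      (fun F F' G => Subtype.ext <| by
        refine (restrict_repBracket_congr α q (f' := lft F + lft F') ?_ rfl (hmem _) (hmem _)).trans ?_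
        · rw [map_add, hl, hl, hl]; rfl
        · rw [repBracket_add_left, map_add]; rfl)
      (fun c F G => Subtype.ext <| by
        refine (restrict_repBracket_congr α q (f' := c • lft F) ?_ rfl (hmem _) (hmem _)).trans ?_
        · rw [map_smul, hl, hl]; rfl
        · have := repBracket_smul_smul c 1 (lft F) (lft G)
          rw [one_smul, mul_one] at this
          rw [this, map_smul]; rfl)
      (fun F G G' => Subtype.ext <| by
        refine (restrict_repBracket_congr α q (g' := lft G + lft G') rfl ?_ (hmem _) (hmem _)).trans ?_
        · rw [map_add, hl, hl, hl]; rfl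
        · rw [map_add, map_add]; rfl)
      (fun c F G => Subtype.ext <| by
        refine (restrict_repBracket_congr α q (g' := c • lft G) rfl ?_ (hmem _) (hmem _)).trans ?_
        · rw [map_smul, hl, hl]; rfl
        · rw [Derivation.map_smul, map_smul]; rfl)
  refine ⟨br, fun f g F G hf hg => ?_⟩
  exact restrict_repBracket_congr α q (by rw [hl, hf]) (by rw [hl, hg]) (hmem F) (hmem G)

variable {α q} in
theorem IsReducedBracket.unique {br br' : QuiverVariety α q →ₗ[ℂ] QuiverVariety α q →ₗ[ℂ]
    QuiverVariety α q} (h : IsReducedBracket α q br) (h' : IsReducedBracket α q br') :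
    br = br' := by
  refine LinearMap.ext₂ fun F G => Subtype.ext ?_
  obtain ⟨f, hf⟩ := restrict_surjective α q F
  obtain ⟨g, hg⟩ := restrict_surjective α q G
  rw [h f g F G hf hg, h' f g F G hf hg]

variable {α q} in
theorem IsReducedBracket.mul_right {br : QuiverVariety α q →ₗ[ℂ] QuiverVariety α q →ₗ[ℂ]
    QuiverVariety α q} (h : IsReducedBracket α q br) (F G H : QuiverVariety α q) :
    br F (G * H) = G * br F H + br F G * H := by
  obtain ⟨f, hf⟩ := restrict_surjective α q F
  obtain ⟨g, hg⟩ := restrict_surjective α q G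
  obtain ⟨k, hk⟩ := restrict_surjective α q H
  refine Subtype.ext ?_
  rw [h f (g * k) F (G * H) hf (by rw [map_mul, hg, hk]; rfl), repBracket_mul_right, map_add,
    map_mul, map_mul, hg, hk, mul_comm (H : RepPreproj α q)]
  change _ = (G : RepPreproj α q) * (br F H : RepPreproj α q) + (br F G : RepPreproj α q) * H
  rw [h f k F H hf hk, h f g F G hf hg]

variable {α q} in
theorem IsReducedBracket.mul_left {br : QuiverVariety α q →ₗ[ℂ] QuiverVariety α q →ₗ[ℂ]
    QuiverVariety α q} (h : IsReducedBracket α q br) (F G H : QuiverVariety α q) :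
    br (F * G) H = F * br G H + br F H * G := by
  obtain ⟨f, hf⟩ := restrict_surjective α q F
  obtain ⟨g, hg⟩ := restrict_surjective α q G
  obtain ⟨k, hk⟩ := restrict_surjective α q H
  refine Subtype.ext ?_
  rw [h (f * g) k (F * G) H (by rw [map_mul, hf, hg]; rfl) hk, repBracket_mul_left, map_add,
    map_mul, map_mul, hf, hg, mul_comm (G : RepPreproj α q)]
  change _ = (F : RepPreproj α q) * (br G H : RepPreproj α q) + (br F H : RepPreproj α q) * G
  rw [h g k G H hg hk, h f k F H hf hk]

end Reduction

end CyclicQuiver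

namespace CyclicQuiver

section MatrixBrackets

open Matrix Kronecker

/-! ## Brackets of matrix entries -/

variable {R : Type*} [CommRing R] [Algebra ℂ R] {n : Type*} [Fintype n] [DecidableEq n]

omit [DecidableEq n] in
theorem map_derivation_mul (D : Derivation ℂ R R) (U V : Matrix n n R) :
    (U * V).map D = U * V.map D + U.map D * V := by
  ext i j
  simp only [Matrix.map_apply, Matrix.mul_apply, map_sum, Derivation.leibniz, smul_eq_mul,
    Matrix.add_apply, ← Finset.sum_add_distrib]
  exact Finset.sum_congr rfl fun k _ => by ring

omit [Fintype n] in
theorem map_derivation_one (D : Derivation ℂ R R) : (1 : Matrix n n R).map D = 0 := by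
  ext i j
  by_cases h : i = j
  · subst h; simp
  · simp [h]

theorem map_derivation_inv (D : Derivation ℂ R R) {U V : Matrix n n R} (hUV : U * V = 1)
    (hVU : V * U = 1) : V.map D = -(V * U.map D * V) := by
  have h := map_derivation_mul D U V
  rw [hUV, map_derivation_one] at h
  have h2 : V * (U * V.map D) = V * (-(U.map D * V)) := by
    rw [eq_neg_of_add_eq_zero_left h.symm]
  rw [← mul_assoc, hVU, one_mul] at h2
  rw [h2, mul_neg, mul_assoc]

/-- The quantifier over M is inside the induction: in M D(U^{k+1}) U the last factor is moved round
the trace, and the induction hypothesis is applied to U M. -/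
theorem trace_mul_map_pow_succ (D : Derivation ℂ R R) (U : Matrix n n R) (k : ℕ) :
    ∀ {M : Matrix n n R}, M * U = U * M →
      (M * (U ^ (k + 1)).map D).trace = (k + 1 : ℕ) * (M * U ^ k * U.map D).trace := by
  induction k with
  | zero => intro M _; simp
  | succ k ih =>
    intro M hM
    have h1 : (M * ((U ^ (k + 1)).map D * U)).trace = (U * M * (U ^ (k + 1)).map D).trace := by
      rw [← mul_assoc, Matrix.trace_mul_comm, mul_assoc]
    have h2 : U * M * U = U * (U * M) := by rw [mul_assoc, hM]
    have h3 : U * M * U ^ k = M * U ^ (k + 1) := by rw [← hM, mul_assoc, pow_succ']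
    rw [pow_succ, map_derivation_mul, mul_add, trace_add, h1, ih h2, h3, ← mul_assoc]
    push_cast
    ring

/-- The derivatives of `f` are given by `D f = c tr(M D U)`, for a matrix `M` that commutes
with `U`. -/
def HasTraceGradient (U : Matrix n n R) (f : R) : Prop :=
  ∃ (c : R) (M : Matrix n n R), M * U = U * M ∧
    ∀ D : Derivation ℂ R R, D f = c * (M * U.map D).trace

omit [Fintype n] [DecidableEq n] in
theorem derivation_trace [Fintype n] (D : Derivation ℂ R R) (U : Matrix n n R) :
    D U.trace = (U.map D).trace := by
  simp [Matrix.trace]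

theorem hasTraceGradient_pow (U : Matrix n n R) (k : ℕ) : HasTraceGradient U (U ^ k).trace := by
  cases k with
  | zero => exact ⟨0, 0, by simp, fun D => by simp⟩
  | succ k =>
    refine ⟨(k + 1 : ℕ), U ^ k, (Commute.refl U).pow_left k, fun D => ?_⟩
    have := trace_mul_map_pow_succ D U k (M := 1) (by simp)
    rwa [one_mul, one_mul, ← derivation_trace] at this

/-- The gradient with respect to W = U⁻¹ is converted by D W = -W (D U) W; conjugating M by
cyclicity gives -W M W, which commutes with U. -/
theorem hasTraceGradient_inv_pow {U W : Matrix n n R} (hUW : U * W = 1) (hWU : W * U = 1)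
    (k : ℕ) : HasTraceGradient U (W ^ k).trace := by
  obtain ⟨c, M, hM, hD⟩ := hasTraceGradient_pow W k
  refine ⟨-c, W * M * W, ?_, fun D => ?_⟩
  · rw [mul_assoc, hWU, mul_one, ← mul_assoc, ← mul_assoc, hUW, one_mul, hM]
  · rw [hD, map_derivation_inv D hUW hWU, mul_neg, trace_neg, mul_neg, neg_mul, ← mul_assoc M,
      trace_mul_comm, ← mul_assoc, ← mul_assoc]

theorem hasTraceGradient_zpow {U : Matrix n n R} (hU : IsUnit U) (k : ℤ) :
    HasTraceGradient U (U ^ k).trace := by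
  have hdet := (Matrix.isUnit_iff_isUnit_det U).1 hU
  cases k with
  | ofNat k => rw [Int.ofNat_eq_natCast, zpow_natCast]; exact hasTraceGradient_pow U k
  | negSucc k =>
    rw [zpow_negSucc, ← Matrix.inv_pow']
    exact hasTraceGradient_inv_pow (mul_nonsing_inv U hdet) (nonsing_inv_mul U hdet) _

variable (B : Derivation ℂ R (Derivation ℂ R R))

/-- The derivation `{-, g}`. -/
def flipBracket (g : R) : Derivation ℂ R R :=
  Derivation.mk' { toFun := fun f => B f g, map_add' := by simp, map_smul' := by simp }
    (by simp)

theorem flipBracket_apply (f g : R) : flipBracket B g f = B f g := rfl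

/-- The brackets of the entries of `U` and `V` are the entries of `ξ`:
`{U_{ij}, V_{uv}} = ξ_{(u,i),(j,v)}`. -/
def HasBracket (U V : Matrix n n R) (ξ : Matrix (n × n) (n × n) R) : Prop :=
  ∀ i j u v, B (U i j) (V u v) = ξ (u, i) (j, v)

variable {B}

omit [Fintype n] [DecidableEq n] in
theorem HasBracket.add_left {U U' V : Matrix n n R} {ξ ξ' : Matrix (n × n) (n × n) R}
    (h : HasBracket B U V ξ) (h' : HasBracket B U' V ξ') : HasBracket B (U + U') V (ξ + ξ') :=
  fun i j u v => by
    rw [Matrix.add_apply, map_add, Derivation.add_apply, h, h', Matrix.add_apply]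

omit [Fintype n] [DecidableEq n] in
theorem HasBracket.add_right {U V V' : Matrix n n R} {ξ ξ' : Matrix (n × n) (n × n) R}
    (h : HasBracket B U V ξ) (h' : HasBracket B U V' ξ') : HasBracket B U (V + V') (ξ + ξ') :=
  fun i j u v => by rw [Matrix.add_apply, map_add, h, h', Matrix.add_apply]

omit [Fintype n] [DecidableEq n] in
theorem HasBracket.symm (hB : ∀ f g, B f g = -B g f) {U V : Matrix n n R}
    {ξ : Matrix (n × n) (n × n) R} (h : HasBracket B U V ξ) :
    HasBracket B V U (-ξ.submatrix Prod.swap Prod.swap) := fun i j u v => by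
  rw [hB, h]; rfl

theorem HasBracket.inv_right {U V W : Matrix n n R} {ξ : Matrix (n × n) (n × n) R}
    (h : HasBracket B U V ξ) (hVW : V * W = 1) (hWV : W * V = 1) :
    HasBracket B U W (-((W ⊗ₖ 1) * ξ * (1 ⊗ₖ W))) := fun i j u v => by
  have := congrFun (congrFun (map_derivation_inv (B (U i j)) hVW hWV) u) v
  rw [Matrix.map_apply] at this
  rw [this]
  simp only [Matrix.neg_apply, Matrix.mul_apply, Matrix.map_apply, h i j, Fintype.sum_prod_type,
    Matrix.kroneckerMap_apply, Matrix.one_apply]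
  simp

theorem HasBracket.inv_left {U V W : Matrix n n R} {ξ : Matrix (n × n) (n × n) R}
    (h : HasBracket B U V ξ) (hUW : U * W = 1) (hWU : W * U = 1) :
    HasBracket B W V (-((1 ⊗ₖ W) * ξ * (W ⊗ₖ 1))) := fun i j u v => by
  have := congrFun (congrFun (map_derivation_inv (flipBracket B (V u v)) hUW hWU) i) j
  rw [Matrix.map_apply, flipBracket_apply] at this
  rw [this]
  simp only [Matrix.neg_apply, Matrix.mul_apply, Matrix.map_apply, flipBracket_apply, h _ _ u v,
    Fintype.sum_prod_type, Matrix.kroneckerMap_apply, Matrix.one_apply]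
  simp

-- The gradient formulas are applied to the derivation {f, -} for g, and then to {-, V_{uv}} for f.
omit [DecidableEq n] in
theorem HasBracket.trace_gradient {U V : Matrix n n R} {ξ : Matrix (n × n) (n × n) R}
    (h : HasBracket B U V ξ) {f g c d : R} {M N : Matrix n n R}
    (hf : ∀ D : Derivation ℂ R R, D f = c * (M * U.map D).trace)
    (hg : ∀ D : Derivation ℂ R R, D g = d * (N * V.map D).trace) :
    B f g = d * ∑ v, ∑ u, N v u * (c * ∑ j, ∑ i, M j i * ξ (u, i) (j, v)) := by
  rw [hg]
  congr 1
  refine Finset.sum_congr rfl fun v _ => ?_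
  refine Finset.sum_congr rfl fun u _ => ?_
  have := hf (flipBracket B (V u v))
  rw [flipBracket_apply] at this
  change N v u * B f (V u v) = _
  rw [this]
  congr 2
  refine Finset.sum_congr rfl fun j _ => ?_
  refine Finset.sum_congr rfl fun i _ => ?_
  change M j i * B (U i j) (V u v) = _
  rw [h]

omit [Algebra ℂ R] [DecidableEq n] in
theorem sum_mul_kronecker (M N P Q : Matrix n n R) :
    ∑ v, ∑ u, N v u * ∑ j, ∑ i, M j i * (P ⊗ₖ Q) (u, i) (j, v) = (N * P * M * Q).trace := by
  simp only [Matrix.mul_assoc]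
  refine Finset.sum_congr rfl fun v _ => ?_
  rw [Matrix.diag_apply, Matrix.mul_apply]
  refine Finset.sum_congr rfl fun u _ => ?_
  rw [Matrix.mul_apply]
  congr 1
  refine Finset.sum_congr rfl fun j _ => ?_
  rw [Matrix.mul_apply, Finset.mul_sum]
  refine Finset.sum_congr rfl fun i _ => ?_
  rw [Matrix.kroneckerMap_apply]
  ring

omit [DecidableEq n] in
/-- Two invariant functions of a matrix `U` commute if the brackets of the entries of `U` are
given by `∑_s (e_s ⊗ U e_s U - U e_s U ⊗ e_s)`, up to a constant. -/
theorem HasBracket.commute {ι : Type*} [Fintype ι] {e : ι → Matrix n n R} {U : Matrix n n R}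
    {a : ℂ} (h : HasBracket B U U (a • ∑ s, (e s ⊗ₖ (U * e s * U) - (U * e s * U) ⊗ₖ e s)))
    {f g : R} (hf : HasTraceGradient U f) (hg : HasTraceGradient U g) : B f g = 0 := by
  obtain ⟨c, M, hM, hf⟩ := hf
  obtain ⟨d, N, hN, hg⟩ := hg
  rw [h.trace_gradient hf hg]
  -- The last U is moved cyclically to the front and past N, and the U after M is moved in front of
  -- M. This is the only place where the commutation of M and N with U enters.
  have h1 : ∀ s, (N * e s * M * (U * e s * U)).trace = (N * (U * e s * U) * M * e s).trace :=
    fun s => by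
      have h2 : N * e s * M * (U * e s * U) = N * e s * M * U * e s * U := by
        simp only [mul_assoc]
      have h3 : U * (N * e s * M * U * e s) = N * (U * e s * U) * M * e s := by
        simp only [mul_assoc]
        rw [← mul_assoc U N, ← hN, mul_assoc, ← mul_assoc M U, hM]
        simp only [mul_assoc]
      rw [h2, trace_mul_comm, h3]
  have h4 : ∀ ξ : Matrix (n × n) (n × n) R,
      ∑ v, ∑ u, N v u * (c * ∑ j, ∑ i, M j i * ξ (u, i) (j, v)) =
        c * ∑ v, ∑ u, N v u * ∑ j, ∑ i, M j i * ξ (u, i) (j, v) := fun ξ => by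
    simp only [Finset.mul_sum]
    simp only [mul_left_comm c]
  let Θ : Matrix (n × n) (n × n) R →ₗ[ℂ] R :=
    { toFun := fun ξ => ∑ v, ∑ u, N v u * ∑ j, ∑ i, M j i * ξ (u, i) (j, v)
      map_add' := fun ξ η => by
        simp only [Matrix.add_apply, mul_add, Finset.sum_add_distrib]
      map_smul' := fun b ξ => by
        simp only [Matrix.smul_apply, mul_smul_comm, ← Finset.smul_sum, RingHom.id_apply] }
  have h5 : ∀ P Q : Matrix n n R, Θ (P ⊗ₖ Q) = (N * P * M * Q).trace := sum_mul_kronecker M N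
  rw [h4]
  change d * (c * Θ _) = 0
  rw [map_smul, map_sum, Finset.sum_eq_zero, smul_zero, mul_zero, mul_zero]
  intro s _
  rw [map_sub, h5, h5, h1, sub_self]

/-- The brackets of the entries of `Y + X⁻¹`. -/
theorem HasBracket.add_inv {ι : Type*} [Fintype ι] (σ : Equiv.Perm ι) (hB : ∀ f g, B f g = -B g f)
    {e : ι → Matrix n n R} {X Y W : Matrix n n R} (hXW : X * W = 1) (hWX : W * X = 1)
    (heX : ∀ i, e i * X = X * e (σ i)) (heY : ∀ i, e (σ i) * Y = Y * e i)
    (hXX : HasBracket B X X ((1 / 2 : ℂ) • ∑ i, (e i ⊗ₖ (X * e i * X) - (X * e i * X) ⊗ₖ e i)))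
    (hYY : HasBracket B Y Y ((1 / 2 : ℂ) • ∑ i, ((Y * e i * Y) ⊗ₖ e i - e i ⊗ₖ (Y * e i * Y))))
    (hXY : HasBracket B X Y ((1 / 2 : ℂ) • ∑ i, ((Y * e i * X) ⊗ₖ e i + (2 : ℂ) • e (σ i) ⊗ₖ e i +
      e i ⊗ₖ (X * e i * Y) - (Y * e i) ⊗ₖ (X * e i) + (e i * X) ⊗ₖ (e i * Y)))) :
    HasBracket B (Y + W) (Y + W) ((-(1 / 2) : ℂ) • ∑ i, (e i ⊗ₖ ((Y + W) * e i * (Y + W)) -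
      ((Y + W) * e i * (Y + W)) ⊗ₖ e i)) := by
  -- X⁻¹ shifts the grading as Y does, so Y + X⁻¹ is homogeneous with respect to the e_i.
  have heW : ∀ i, e (σ i) * W = W * e i := fun i => by
    calc e (σ i) * W = W * (X * e (σ i)) * W := by rw [← mul_assoc W, hWX, one_mul]
      _ = W * e i := by rw [← heX, mul_assoc, mul_assoc, hXW, mul_one]
  have hXW' : ∀ A, X * (W * A) = A := fun A => by rw [← mul_assoc, hXW, one_mul]
  have hWX' : ∀ A, W * (X * A) = A := fun A => by rw [← mul_assoc, hWX, one_mul]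
  have hWW := (hXX.inv_left hXW hWX).inv_right hXW hWX
  have hWY := hXY.inv_left hXW hWX
  have hYW := hWY.symm hB
  have hWW' : HasBracket B W W
      ((1 / 2 : ℂ) • ∑ i, ((W * e i * W) ⊗ₖ e i - e i ⊗ₖ (W * e i * W))) := by
    convert hWW using 1
    simp only [mul_neg, neg_mul, neg_neg, mul_smul_comm, smul_mul_assoc, Finset.mul_sum,
      Finset.sum_mul, mul_sub, sub_mul, ← Matrix.mul_kronecker_mul, one_mul, mul_one]
    congr 1
    refine Finset.sum_congr rfl fun i _ => ?_
    simp only [mul_assoc, hXW, hWX', mul_one]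
  have hWY' : HasBracket B W Y ((-(1 / 2) : ℂ) • ∑ i, ((Y * e i) ⊗ₖ (W * e i) +
      (2 : ℂ) • (W * e i) ⊗ₖ (W * e i) + (W * e i) ⊗ₖ (Y * e i) - (Y * e i * W) ⊗ₖ e i +
        e i ⊗ₖ (W * e i * Y))) := by
    convert hWY using 1
    have hsh : ∑ i, (W * e i) ⊗ₖ (Y * e i) = ∑ i, (e i * W) ⊗ₖ (e i * Y) := by
      rw [← Equiv.sum_comp σ fun i => (e i * W) ⊗ₖ (e i * Y)]
      simp only [heW, heY]
    simp only [Finset.sum_add_distrib, Finset.sum_sub_distrib, hsh]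
    simp only [mul_smul_comm, smul_mul_assoc, Finset.mul_sum,
      Finset.sum_mul, mul_sub, sub_mul, mul_add, add_mul, ← Matrix.mul_kronecker_mul, one_mul,
      mul_one, mul_assoc, hXW, hWX', heW]
    module
  have hYW' : HasBracket B Y W ((1 / 2 : ℂ) • ∑ i, ((W * e i) ⊗ₖ (Y * e i) +
      (2 : ℂ) • (W * e i) ⊗ₖ (W * e i) + (Y * e i) ⊗ₖ (W * e i) - e i ⊗ₖ (Y * e i * W) +
        (W * e i * Y) ⊗ₖ e i)) := by
    convert hWY'.symm hB using 1
    have hs : ∀ P Q : Matrix n n R, (P ⊗ₖ Q).submatrix Prod.swap Prod.swap = Q ⊗ₖ P :=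
      fun P Q => by ext; simp [mul_comm]
    let S : Matrix (n × n) (n × n) R →ₗ[ℂ] Matrix (n × n) (n × n) R :=
      { toFun := fun ξ => ξ.submatrix Prod.swap Prod.swap
        map_add' := fun _ _ => rfl
        map_smul' := fun _ _ => rfl }
    have hS : ∀ P Q : Matrix n n R, S (P ⊗ₖ Q) = Q ⊗ₖ P := hs
    change _ = -S _
    simp only [map_smul, map_sum, map_add, map_sub, hS]
    module
  -- {W, Y} and {Y, W} contain the terms Y e ⊗ W e, W e ⊗ Y e and W e ⊗ W e with opposite signs.
  -- What is left of them are the mixed terms in the expansion of Z e Z ⊗ e - e ⊗ Z e Z for Z = Y +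
  -- W.
  convert (hYY.add_right hYW').add_left (hWY'.add_right hWW') using 1
  simp only [add_mul, mul_add, Matrix.add_kronecker, Matrix.kronecker_add,
    Finset.sum_add_distrib, Finset.sum_sub_distrib]
  module

end MatrixBrackets

end CyclicQuiver

namespace CyclicQuiver

section LocalizedBrackets

/-! ## Biderivations of localizations -/

variable {R S : Type} [CommRing R] [CommRing S] [Algebra ℂ R] [Algebra ℂ S] [Algebra R S]
  [IsScalarTower ℂ R S] (d : R) [IsLocalization.Away d S]

-- For s = r / dⁿ the Leibniz rule expresses dⁿ D s through the values of D on the images of r and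
-- dⁿ, and dⁿ is invertible in S.
omit [Algebra ℂ R] [IsScalarTower ℂ R S] in
include d in
theorem derivation_ext_of_isLocalization {N : Type*} [AddCommGroup N] [Module ℂ N] [Module S N]
    {D D' : Derivation ℂ S N} (h : ∀ r : R, D (algebraMap R S r) = D' (algebraMap R S r)) :
    D = D' := by
  refine Derivation.ext fun s => ?_
  obtain ⟨n, r, hr⟩ := IsLocalization.Away.surj d s
  have hu : IsUnit (algebraMap R S d ^ n) := (IsLocalization.Away.algebraMap_isUnit d).pow n
  have h1 : ∀ D : Derivation ℂ S N, algebraMap R S d ^ n • D s =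
      D (algebraMap R S r) - s • D (algebraMap R S (d ^ n)) := fun D => by
    rw [← hr, ← map_pow (algebraMap R S), Derivation.leibniz, add_sub_cancel_left]
  have h2 : algebraMap R S d ^ n • D s = algebraMap R S d ^ n • D' s := by
    rw [h1, h1, h, h]
  exact hu.smul_left_cancel.1 h2

open KaehlerDifferential in
/-- The extension of a derivation to a localization. -/
noncomputable def extendDer (S : Type) [CommRing S] [Algebra ℂ S] [Algebra R S]
    [IsScalarTower ℂ R S] (d : R) [IsLocalization.Away d S] {N : Type*} [AddCommGroup N]
    [Module ℂ N] [Module R N] [Module S N] [IsScalarTower R S N] [IsScalarTower ℂ S N]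
    [IsScalarTower ℂ R N]
    (D : Derivation ℂ R N) : Derivation ℂ S N :=
  -- A localization is formally étale, so S ⊗ Ω_R is isomorphic to Ω_S, and the S-linear extension
  -- of the map Ω_R → N that represents D gives the derivation.
  haveI := Algebra.FormallyEtale.of_isLocalization (Rₘ := S) (Submonoid.powers d)
  ((LinearMap.liftBaseChange S D.liftKaehlerDifferential) ∘ₗ
    (tensorKaehlerEquivOfFormallyEtale ℂ R S).symm.toLinearMap).compDer (KaehlerDifferential.D ℂ S)

theorem extendDer_algebraMap {N : Type*} [AddCommGroup N]
    [Module ℂ N] [Module R N] [Module S N] [IsScalarTower R S N] [IsScalarTower ℂ S N]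
    [IsScalarTower ℂ R N]
    (D : Derivation ℂ R N) (r : R) : extendDer S d D (algebraMap R S r) = D r := by
  have := Algebra.FormallyEtale.of_isLocalization (Rₘ := S) (Submonoid.powers d)
  have h := KaehlerDifferential.tensorKaehlerEquivOfFormallyEtale_symm_D_algebraMap ℂ R S r
  exact (congrArg (LinearMap.liftBaseChange S D.liftKaehlerDifferential) h).trans (by simp)

/-- The extension of a biderivation to a localization. -/
noncomputable def extendBracket (S : Type) [CommRing S] [Algebra ℂ S] [Algebra R S]
    [IsScalarTower ℂ R S] (d : R) [IsLocalization.Away d S]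
    (B : Derivation ℂ R (Derivation ℂ R R)) : Derivation ℂ S (Derivation ℂ S S) :=
  extendDer S d (Derivation.mk'
    { toFun := fun f => extendDer S d ((Algebra.linearMap R S).compDer (B f))
      map_add' := fun f g => derivation_ext_of_isLocalization d fun r => by
        simp [extendDer_algebraMap]
      map_smul' := fun c f => derivation_ext_of_isLocalization d fun r => by
        simp [extendDer_algebraMap, Algebra.smul_def] }
    fun f g => derivation_ext_of_isLocalization d fun r => by
      simp [extendDer_algebraMap, Algebra.smul_def])

theorem extendBracket_algebraMap (B : Derivation ℂ R (Derivation ℂ R R)) (f g : R) :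
    extendBracket S d B (algebraMap R S f) (algebraMap R S g) = algebraMap R S (B f g) := by
  rw [extendBracket, extendDer_algebraMap]
  exact extendDer_algebraMap d _ g

/-- The extension principle for derivations is used in each argument in turn, first with the other
argument taken from R. -/
theorem extendBracket_antisymm {B : Derivation ℂ R (Derivation ℂ R R)}
    (hB : ∀ f g, B f g = -B g f) (F G : S) :
    extendBracket S d B F G = -extendBracket S d B G F := by
  have h1 : ∀ (r : R) (G : S), extendBracket S d B (algebraMap R S r) G =
      -extendBracket S d B G (algebraMap R S r) := fun r G => by
    have : extendBracket S d B (algebraMap R S r) =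
        -flipBracket (extendBracket S d B) (algebraMap R S r) :=
      derivation_ext_of_isLocalization d fun r' => by
        rw [Derivation.neg_apply, flipBracket_apply, extendBracket_algebraMap,
          extendBracket_algebraMap, hB, map_neg]
    rw [this, Derivation.neg_apply, flipBracket_apply]
  have h2 : extendBracket S d B F = -flipBracket (extendBracket S d B) F :=
    derivation_ext_of_isLocalization d fun r' => by
      rw [Derivation.neg_apply, flipBracket_apply, h1, neg_neg]
  rw [h2, Derivation.neg_apply, flipBracket_apply]

include d in
theorem exists_extended_bracket {br : R →ₗ[ℂ] R →ₗ[ℂ] R}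
    (mul_right : ∀ F G H, br F (G * H) = G * br F H + br F G * H)
    (mul_left : ∀ F G H, br (F * G) H = F * br G H + br F H * G) :
    ∃ br₀ : S →ₗ[ℂ] S →ₗ[ℂ] S,
      (∀ F G, br₀ (algebraMap R S F) (algebraMap R S G) = algebraMap R S (br F G)) ∧
      (∀ F G H, br₀ F (G * H) = G * br₀ F H + br₀ F G * H) ∧
      ∀ F G H, br₀ (F * G) H = F * br₀ G H + br₀ F H * G := by
  let B : Derivation ℂ R (Derivation ℂ R R) :=
    Derivation.mk'
      { toFun := fun F => Derivation.mk' (br F) fun G H => by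
          rw [mul_right, smul_eq_mul, smul_eq_mul, mul_comm H]
        map_add' := fun F G => by ext H; simp
        map_smul' := fun c F => by ext H; simp }
      fun F G => by
        refine Derivation.ext fun H => ?_
        change br (F * G) H = F * br G H + G * br F H
        rw [mul_left, mul_comm G]
  refine ⟨LinearMap.mk₂ ℂ (fun F G => extendBracket S d B F G) (fun F F' G => by simp)
    (fun c F G => by simp) (fun F G G' => by simp) (fun c F G => by simp), ?_, ?_, ?_⟩
  · intro F G
    exact extendBracket_algebraMap d B F G
  · intro F G H
    simp only [LinearMap.mk₂_apply]
    rw [Derivation.leibniz, smul_eq_mul, smul_eq_mul, mul_comm H]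
  · intro F G H
    simp only [LinearMap.mk₂_apply]
    rw [Derivation.leibniz, mul_comm _ G]; rfl

omit [Algebra ℂ R] [IsScalarTower ℂ R S] in
include d in
theorem extended_bracket_unique {br₀ br₀' : S →ₗ[ℂ] S →ₗ[ℂ] S}
    (mul_right : ∀ F G H, br₀ F (G * H) = G * br₀ F H + br₀ F G * H)
    (mul_left : ∀ F G H, br₀ (F * G) H = F * br₀ G H + br₀ F H * G)
    (mul_right' : ∀ F G H, br₀' F (G * H) = G * br₀' F H + br₀' F G * H)
    (mul_left' : ∀ F G H, br₀' (F * G) H = F * br₀' G H + br₀' F H * G)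
    (h : ∀ F G, br₀ (algebraMap R S F) (algebraMap R S G) =
      br₀' (algebraMap R S F) (algebraMap R S G)) : br₀ = br₀' := by
  have h1 : ∀ (F : R) G, br₀ (algebraMap R S F) G = br₀' (algebraMap R S F) G := fun F G => by
    let D : Derivation ℂ S S := Derivation.mk' (br₀ (algebraMap R S F)) fun G H => by
      rw [mul_right, smul_eq_mul, smul_eq_mul, mul_comm H]
    let D' : Derivation ℂ S S := Derivation.mk' (br₀' (algebraMap R S F)) fun G H => by
      rw [mul_right', smul_eq_mul, smul_eq_mul, mul_comm H]
    have : D = D' := derivation_ext_of_isLocalization d (h F)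
    exact DFunLike.congr_fun this G
  refine LinearMap.ext₂ fun F G => ?_
  let D : Derivation ℂ S S := Derivation.mk' (br₀.flip G) fun F H => by
    rw [LinearMap.flip_apply, mul_left, smul_eq_mul, smul_eq_mul, mul_comm H]; rfl
  let D' : Derivation ℂ S S := Derivation.mk' (br₀'.flip G) fun F H => by
    rw [LinearMap.flip_apply, mul_left', smul_eq_mul, smul_eq_mul, mul_comm H]; rfl
  have : D = D' := derivation_ext_of_isLocalization d fun r => h1 r G
  exact DFunLike.congr_fun this F

end LocalizedBrackets

/-! ### The bracket on M⁰ -/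

section ExtendedBracket

variable {m : ℕ} [NeZero m] {α : ZMod m → ℕ} {q : ZMod m → ℂˣ}

theorem IsReducedBracket.exists_extended {br : QuiverVariety α q →ₗ[ℂ] QuiverVariety α q →ₗ[ℂ]
    QuiverVariety α q} (h : IsReducedBracket α q br) : ∃ br₀, IsExtendedBracket α q br br₀ := by
  obtain ⟨br₀, h1, h2, h3⟩ :=
    exists_extended_bracket (S := QuiverVariety₀ α q) (detX α q) h.mul_right h.mul_left
  exact ⟨br₀, h1, h2, h3⟩

theorem IsExtendedBracket.unique
    {br : QuiverVariety α q →ₗ[ℂ] QuiverVariety α q →ₗ[ℂ] QuiverVariety α q}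
    {br₀ br₀' : QuiverVariety₀ α q →ₗ[ℂ] QuiverVariety₀ α q →ₗ[ℂ] QuiverVariety₀ α q}
    (h : IsExtendedBracket α q br br₀) (h' : IsExtendedBracket α q br br₀') : br₀ = br₀' :=
  extended_bracket_unique (detX α q) h.mul_right h.mul_left h'.mul_right h'.mul_left
    fun F G => (h.extends_br F G).trans (h'.extends_br F G).symm

end ExtendedBracket

end CyclicQuiver

namespace CyclicQuiver

variable {m : ℕ} [NeZero m] {α : ZMod m → ℕ} {q : ZMod m → ℂˣ}

open RepRing PathAlg Matrix Kronecker

section CyclicPart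

/-! ## The matrices of functions on `Rep(A, α̃)` -/

/-- The endomorphism of `𝒱` which represents an element of `A`, as a matrix of functions on
`Rep(A, α̃)`. -/
noncomputable def cyc (α : ZMod m → ℕ) :
    PathAlg m →ₗ[ℂ] Matrix (CycIdx α) (CycIdx α) (RepA α) where
  toFun c := (univ PathAlg.e (framed α) c).submatrix CycIdx.incl CycIdx.incl
  map_add' _ _ := by rw [map_add]; rfl
  map_smul' _ _ := by rw [map_smul]; rfl

theorem cyc_apply (c : PathAlg m) (i j : CycIdx α) :
    cyc α c i j = coord PathAlg.e (framed α) c i.incl j.incl := rfl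

/-- Cutting out the block of 𝒱 is linear but not multiplicative, because a product may pass through
∞. It is multiplicative if one of the factors does not meet ∞ at the middle vertex. -/
theorem cyc_mul_of_sum_eq_zero {a b : PathAlg m}
    (h : ∀ i j : CycIdx α, ∀ x, coord PathAlg.e (framed α) a i.incl ⟨none, x⟩ *
      coord PathAlg.e (framed α) b ⟨none, x⟩ j.incl = 0) : cyc α (a * b) = cyc α a * cyc α b := by
  ext i j
  rw [cyc_apply, coord_mul, Matrix.mul_apply]
  simp only [Fintype.sum_sigma, Fintype.sum_option]
  rw [Finset.sum_eq_zero fun x _ => h i j x, zero_add]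
  rfl

theorem cyc_mul_of_left {a : PathAlg m} (h : a * e none = 0) (b : PathAlg m) :
    cyc α (a * b) = cyc α a * cyc α b :=
  cyc_mul_of_sum_eq_zero fun i j x => by
    have h1 : (univ PathAlg.e (framed α) a * univ PathAlg.e (framed α) (e none)) i.incl ⟨none, x⟩ =
        0 := by rw [← map_mul, h, map_zero, Matrix.zero_apply]
    rw [univ_idem, mul_blockIdem_apply, if_pos rfl, univ_apply] at h1
    rw [h1, zero_mul]

theorem cyc_mul_of_right (a : PathAlg m) {b : PathAlg m} (h : e none * b = 0) :
    cyc α (a * b) = cyc α a * cyc α b :=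
  cyc_mul_of_sum_eq_zero fun i j x => by
    have h1 : (univ PathAlg.e (framed α) (e none) * univ PathAlg.e (framed α) b) ⟨none, x⟩ j.incl =
        0 := by rw [← map_mul, h, map_zero, Matrix.zero_apply]
    rw [univ_idem, blockIdem_mul_apply, if_pos rfl, univ_apply] at h1
    rw [h1, mul_zero]

omit [NeZero m] in
theorem incl_injective : Function.Injective (CycIdx.incl (α := α)) := by
  rintro ⟨i, k⟩ ⟨j, l⟩ h
  obtain ⟨h1, h2⟩ := Sigma.ext_iff.1 h
  obtain rfl : i = j := Option.some.inj h1
  rw [show k = l from eq_of_heq h2]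

theorem cyc_one : cyc α 1 = 1 := by
  change (univ PathAlg.e (framed α) 1).submatrix _ _ = _
  rw [map_one]
  exact Matrix.submatrix_one _ incl_injective

theorem cyc_e_mul_left (a b : PathAlg m) (i : ZMod m) :
    cyc α (a * e (some i) * b) = cyc α a * cyc α (e (some i)) * cyc α b := by
  have h : e (none : Vertex m) * e (some i) = 0 := e_mul_ne (by simp)
  have h' : e (some i) * e (none : Vertex m) = 0 := e_mul_ne (by simp)
  rw [cyc_mul_of_left (by rw [mul_assoc, h', mul_zero]), cyc_mul_of_right _ h]

theorem cyc_e_mul (i : ZMod m) (b : PathAlg m) :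
    cyc α (e (some i) * b) = cyc α (e (some i)) * cyc α b :=
  cyc_mul_of_left (e_mul_ne (by simp)) b

theorem cyc_mul_e (a : PathAlg m) (i : ZMod m) :
    cyc α (a * e (some i)) = cyc α a * cyc α (e (some i)) :=
  cyc_mul_of_right a (e_mul_ne (by simp))

/-- The tensor `c ⊗ d` as the matrix of functions `c_{uj} d_{iv}`. -/
noncomputable def cycKronecker (α : ZMod m → ℕ) : PathAlg m ⊗[ℂ] PathAlg m →ₗ[ℂ]
    Matrix (CycIdx α × CycIdx α) (CycIdx α × CycIdx α) (RepA α) where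
  toFun ξ := Matrix.of fun x y => ev α x.1.incl y.1.incl x.2.incl y.2.incl ξ
  map_add' _ _ := by ext; simp
  map_smul' _ _ := by ext; simp

theorem cycKronecker_tmul (c d : PathAlg m) :
    cycKronecker α (c ⊗ₜ[ℂ] d) = cyc α c ⊗ₖ cyc α d := rfl

/-- The index convention of `HasBracket` is chosen so that c ⊗ d becomes the Kronecker product of
the matrices of c and d; formulas in A ⊗ A thus turn into matrix formulas verbatim. -/
theorem hasBracket_cyc (a b : PathAlg m) :
    HasBracket (repBracket α) (cyc α a) (cyc α b) (cycKronecker α (dgal m a b)) :=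
  fun _ _ _ _ => repBracket_coord _ _ _ _ _ _

/-- The matrix `X` on `Rep(A, α̃)`. -/
noncomputable def genX (α : ZMod m → ℕ) : Matrix (CycIdx α) (CycIdx α) (RepA α) :=
  cyc α (sumX m)

/-- The matrix `Y` on `Rep(A, α̃)`. -/
noncomputable def genY (α : ZMod m → ℕ) : Matrix (CycIdx α) (CycIdx α) (RepA α) :=
  cyc α (sumY m)

/-- The projection of `𝒱` onto `𝒱_i`. -/
noncomputable def genE (α : ZMod m → ℕ) (i : ZMod m) :
    Matrix (CycIdx α) (CycIdx α) (RepA α) :=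
  cyc α (e (some i))

theorem cyc_oneAdd : cyc α (1 + sumX m * sumY m) = 1 + genX α * genY α := by
  rw [map_add, cyc_one, cyc_mul_of_left sumX_mul_e_none]; rfl

theorem genE_mul_genX (i : ZMod m) : genE α i * genX α = genX α * genE α (i + 1) := by
  rw [genE, genX, ← cyc_e_mul, e_mul_sumX_comm, cyc_mul_e]; rfl

theorem genE_mul_genY (i : ZMod m) : genE α (i + 1) * genY α = genY α * genE α i := by
  rw [genE, genY, ← cyc_e_mul, e_mul_sumY_comm, cyc_mul_e]; rfl

theorem hasBracket_genX_genX : HasBracket (repBracket α) (genX α) (genX α)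
    ((1 / 2 : ℂ) • ∑ i, (genE α i ⊗ₖ (genX α * genE α i * genX α) -
      (genX α * genE α i * genX α) ⊗ₖ genE α i)) := by
  have := hasBracket_cyc (α := α) (sumX m) (sumX m)
  simpa only [dgal_sumX_sumX, map_smul, map_sum, map_sub, cycKronecker_tmul,
    cyc_e_mul_left, genX, genE] using this

theorem hasBracket_genY_genY : HasBracket (repBracket α) (genY α) (genY α)
    ((1 / 2 : ℂ) • ∑ i, ((genY α * genE α i * genY α) ⊗ₖ genE α i -
      genE α i ⊗ₖ (genY α * genE α i * genY α))) := by
  have := hasBracket_cyc (α := α) (sumY m) (sumY m)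
  simpa only [dgal_sumY_sumY, map_smul, map_sum, map_sub, cycKronecker_tmul,
    cyc_e_mul_left, genY, genE] using this

theorem hasBracket_genX_genY : HasBracket (repBracket α) (genX α) (genY α)
    ((1 / 2 : ℂ) • ∑ i, ((genY α * genE α i * genX α) ⊗ₖ genE α i +
      (2 : ℂ) • genE α (i + 1) ⊗ₖ genE α i + genE α i ⊗ₖ (genX α * genE α i * genY α) -
      (genY α * genE α i) ⊗ₖ (genX α * genE α i) +
      (genE α i * genX α) ⊗ₖ (genE α i * genY α))) := by
  have := hasBracket_cyc (α := α) (sumX m) (sumY m)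
  simpa only [dgal_sumX_sumY, map_smul, map_sum, map_sub, map_add, cycKronecker_tmul,
    cyc_e_mul_left, cyc_e_mul, cyc_mul_e, genX, genY, genE] using this

theorem hasBracket_oneAdd : HasBracket (repBracket α) (1 + genX α * genY α) (1 + genX α * genY α)
    ((1 / 2 : ℂ) • ∑ i, (((1 + genX α * genY α) * genE α i * (1 + genX α * genY α)) ⊗ₖ genE α i -
      genE α i ⊗ₖ ((1 + genX α * genY α) * genE α i * (1 + genX α * genY α)))) := by
  have := hasBracket_cyc (α := α) (1 + sumX m * sumY m) (1 + sumX m * sumY m)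
  simpa only [dgal_oneAdd_self, map_smul, map_sum, map_sub, cycKronecker_tmul,
    cyc_e_mul_left, cyc_oneAdd, genX, genY, genE] using this

theorem neg_half_smul_sum {ι M : Type*} [Fintype ι] [AddCommGroup M] [Module ℂ M] (f g : ι → M) :
    (1 / 2 : ℂ) • ∑ i, (f i - g i) = (-(1 / 2) : ℂ) • ∑ i, (g i - f i) := by
  rw [neg_smul, ← smul_neg, ← Finset.sum_neg_distrib]
  simp only [neg_sub]

theorem repBracket_genX {f g : RepA α} (hf : HasTraceGradient (genX α) f)
    (hg : HasTraceGradient (genX α) g) : repBracket α f g = 0 :=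
  hasBracket_genX_genX.commute hf hg

theorem repBracket_genY {f g : RepA α} (hf : HasTraceGradient (genY α) f)
    (hg : HasTraceGradient (genY α) g) : repBracket α f g = 0 := by
  have h := hasBracket_genY_genY (α := α)
  rw [neg_half_smul_sum] at h
  exact h.commute hf hg

theorem repBracket_oneAdd {f g : RepA α} (hf : HasTraceGradient (1 + genX α * genY α) f)
    (hg : HasTraceGradient (1 + genX α * genY α) g) : repBracket α f g = 0 := by
  have h := hasBracket_oneAdd (α := α)
  rw [neg_half_smul_sum] at h
  exact h.commute hf hg

/-- On the summand at i, 1 + xy acts as 1 + x_i y_i, which is invertible in A. The inverses glue to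
∑_i e_i (1 + x_i y_i)⁻¹, with product 1 - e_∞, and e_∞ is zero on 𝒱. A one-sided inverse suffices
for square matrices. -/
theorem isUnit_oneAdd_gen : IsUnit (1 + genX α * genY α) := by
  have hx : ∀ i : ZMod m, arr (some i, false) * sumY m = arr (some i, false) * arr (some i, true) :=
    fun i => by
      nth_rewrite 1 [← mul_e_head]
      rw [mul_assoc, show Arrow.head ((some i, false) : Arrow m) = some (i + 1) from rfl, e_mul_sumY]
  have hi : ∀ i : ZMod m, e (some i) * (1 + sumX m * sumY m) =
      e (some i) * (1 + arr (some i, false) * arr (Arrow.star (some i, false))) := fun i => by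
    have h1 : e (some i) * arr (some i, false) = arr (some i, false) := e_tail_mul (some i, false)
    rw [mul_add, mul_add, ← mul_assoc, ← mul_assoc, e_mul_sumX, hx, h1]; rfl
  have h0 : e none * ∑ i : ZMod m, e (some i) * inv (some i, false) = 0 := by
    rw [Finset.mul_sum]
    exact Finset.sum_eq_zero fun i _ => by rw [← mul_assoc, e_mul_ne (by simp), zero_mul]
  have h1 : (1 + sumX m * sumY m) * ∑ i : ZMod m, e (some i) * inv (some i, false) =
      1 - e none := by
    have hs : 1 - e none = ∑ i : ZMod m, e (some i) := by
      rw [← sum_e, Fintype.sum_option, add_sub_cancel_left]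
    rw [Finset.mul_sum, hs]
    refine Finset.sum_congr rfl fun i _ => ?_
    rw [← mul_assoc, ← e_mul_oneAdd, hi, mul_assoc, one_add_mul_inv, mul_one]
  have h2 : cyc α (e none) = 0 := by
    ext i j
    rw [cyc_apply, ← univ_apply, univ_idem, blockIdem_apply]
    simp [CycIdx.incl]
  refine IsUnit.of_mul_eq_one (cyc α (∑ i : ZMod m, e (some i) * inv (some i, false))) ?_
  rw [← cyc_oneAdd, ← cyc_mul_of_right _ h0, h1, map_sub, cyc_one, h2, sub_zero]

end CyclicPart

end CyclicQuiver

namespace CyclicQuiver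

open RepRing PathAlg Matrix Kronecker

/-! ### Ring homomorphisms applied to inverses and powers of matrices -/

section MatrixMaps

variable {R S : Type*} [CommRing R] [CommRing S] {n : Type*} [Fintype n] [DecidableEq n]

theorem mapMatrix_inv (f : R →+* S) {U : Matrix n n R} (hU : IsUnit U) :
    f.mapMatrix U⁻¹ = (f.mapMatrix U)⁻¹ := by
  refine (Matrix.inv_eq_right_inv ?_).symm
  rw [← map_mul, mul_nonsing_inv U ((Matrix.isUnit_iff_isUnit_det U).1 hU), map_one]

theorem mapMatrix_zpow (f : R →+* S) {U : Matrix n n R} (hU : IsUnit U) (k : ℤ) :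
    f.mapMatrix (U ^ k) = f.mapMatrix U ^ k := by
  cases k with
  | ofNat k => rw [Int.ofNat_eq_natCast, zpow_natCast, zpow_natCast, map_pow]
  | negSucc k => rw [zpow_negSucc, zpow_negSucc, mapMatrix_inv f (hU.pow _), map_pow]

theorem map_trace_zpow (f : R →+* S) {U : Matrix n n R} (hU : IsUnit U) (k : ℤ) :
    f (U ^ k).trace = (f.mapMatrix U ^ k).trace := by
  rw [← mapMatrix_zpow f hU]
  exact AddMonoidHom.map_trace f _

theorem map_trace_pow (f : R →+* S) (U : Matrix n n R) (k : ℕ) :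
    f (U ^ k).trace = (f.mapMatrix U ^ k).trace := by
  rw [← map_pow]
  exact AddMonoidHom.map_trace f _

end MatrixMaps

variable {m : ℕ} [NeZero m] {α : ZMod m → ℕ} {q : ZMod m → ℂˣ}

section Equivariance

/-! ## Equivariant matrices -/

/-- The matrix of functions on `Rep(Λ^{q̃}, α̃)` given by the action of `g` on `𝒱`. -/
noncomputable def cycGL (α : ZMod m → ℕ) (q : ZMod m → ℂˣ)
    (g : ∀ i : Vertex m, GL (Fin (framed α i)) ℂ) :
    Matrix (CycIdx α) (CycIdx α) (RepPreproj α q) :=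
  (blockGL (RepPreproj α q) g).submatrix CycIdx.incl CycIdx.incl

theorem cycGL_mul_inv (g : ∀ i : Vertex m, GL (Fin (framed α i)) ℂ) :
    cycGL α q g * cycGL α q g⁻¹ = 1 := by
  rw [cycGL, cycGL, ← blockGL_mul_submatrix, blockGL_mul_inv]
  exact Matrix.submatrix_one _ incl_injective

theorem cycGL_inv_mul (g : ∀ i : Vertex m, GL (Fin (framed α i)) ℂ) :
    cycGL α q g⁻¹ * cycGL α q g = 1 := by
  simpa using cycGL_mul_inv (q := q) g⁻¹

/-- The matrix `M` represents an equivariant map from `Rep(Λ^{q̃}, α̃)` to `End 𝒱`. -/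
def IsEquivariant (M : Matrix (CycIdx α) (CycIdx α) (RepPreproj α q)) : Prop :=
  ∀ g : ∀ i : Vertex m, GL (Fin (framed α i)) ℂ,
    (act g).mapMatrix M = cycGL α q g * M * cycGL α q g⁻¹

variable {M N : Matrix (CycIdx α) (CycIdx α) (RepPreproj α q)}

theorem isEquivariant_one :
    IsEquivariant (1 : Matrix (CycIdx α) (CycIdx α) (RepPreproj α q)) := fun g => by
  rw [map_one, mul_one, cycGL_mul_inv]

theorem IsEquivariant.add (hM : IsEquivariant M) (hN : IsEquivariant N) :
    IsEquivariant (M + N) := fun g => by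
  rw [map_add, hM g, hN g, mul_add, add_mul]

theorem IsEquivariant.mul (hM : IsEquivariant M) (hN : IsEquivariant N) :
    IsEquivariant (M * N) := fun g => by
  rw [map_mul, hM g, hN g]
  have : cycGL α q g * M * cycGL α q g⁻¹ * (cycGL α q g * N * cycGL α q g⁻¹) =
      cycGL α q g * M * (cycGL α q g⁻¹ * cycGL α q g) * N * cycGL α q g⁻¹ := by
    simp only [mul_assoc]
  rw [this, cycGL_inv_mul, mul_one, mul_assoc (cycGL α q g)]

theorem IsEquivariant.pow (hM : IsEquivariant M) (k : ℕ) : IsEquivariant (M ^ k) := by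
  induction k with
  | zero => rw [pow_zero]; exact isEquivariant_one
  | succ k ih => rw [pow_succ]; exact ih.mul hM

theorem IsEquivariant.smul {c : RepPreproj α q} (hc : c ∈ QuiverVariety α q)
    (hM : IsEquivariant M) : IsEquivariant (c • M) := fun g => by
  rw [mul_smul_comm, smul_mul_assoc, ← hM g]
  ext i j
  change act g (c * M i j) = c * act g (M i j)
  rw [map_mul, hc g]

theorem IsEquivariant.inv (hM : IsEquivariant M) (hU : IsUnit M) : IsEquivariant M⁻¹ := fun g => by
  have h1 := mul_nonsing_inv M ((Matrix.isUnit_iff_isUnit_det M).1 hU)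
  refine (mapMatrix_inv (act g).toRingHom hU).trans ?_
  refine Matrix.inv_eq_right_inv ?_
  have h2 : (act g).toRingHom.mapMatrix M = _ := hM g
  rw [h2]
  have : cycGL α q g * M * cycGL α q g⁻¹ * (cycGL α q g * M⁻¹ * cycGL α q g⁻¹) =
      cycGL α q g * (M * ((cycGL α q g⁻¹ * cycGL α q g) * M⁻¹)) * cycGL α q g⁻¹ := by
    simp only [mul_assoc]
  rw [this, cycGL_inv_mul, one_mul, h1, mul_one, cycGL_mul_inv]

/-- adj(g M g⁻¹) is adj(g⁻¹) adj(M) adj(g). Each outer adjugate is a determinant times an inverse,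
and the two determinants cancel. This needs no invertibility of M. -/
theorem IsEquivariant.adjugate (hM : IsEquivariant M) : IsEquivariant M.adjugate := fun g => by
  rw [AlgHom.map_adjugate, hM g, adjugate_mul_distrib, adjugate_mul_distrib]
  have h : ∀ g : ∀ i : Vertex m, GL (Fin (framed α i)) ℂ,
      (cycGL α q g).adjugate = (cycGL α q g).det • cycGL α q g⁻¹ := fun g => by
    have := congrArg (fun A => A * cycGL α q g⁻¹) (adjugate_mul (cycGL α q g))
    simp only [mul_assoc, cycGL_mul_inv, mul_one, smul_mul_assoc, one_mul] at this
    exact this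
  rw [h, h, inv_inv, smul_mul_assoc, mul_smul_comm, mul_smul_comm, smul_smul, ← det_mul,
    cycGL_inv_mul, det_one, one_smul, mul_assoc]

theorem IsEquivariant.trace_mem (hM : IsEquivariant M) : M.trace ∈ QuiverVariety α q := fun g => by
  refine (AddMonoidHom.map_trace (act g) M).trans ?_
  have h : M.map (act g) = _ := hM g
  rw [h, trace_mul_comm, ← mul_assoc, cycGL_inv_mul, one_mul]

theorem IsEquivariant.sum {ι : Type*} (s : Finset ι)
    {M : ι → Matrix (CycIdx α) (CycIdx α) (RepPreproj α q)} (hM : ∀ i ∈ s, IsEquivariant (M i)) :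
    IsEquivariant (∑ i ∈ s, M i) := fun g => by
  rw [map_sum, Finset.mul_sum, Finset.sum_mul]
  exact Finset.sum_congr rfl fun i hi => hM i hi g

theorem isEquivariant_matX : IsEquivariant (matX α q) :=
  .sum _ fun _ _ g => act_cycBlock g _

theorem isEquivariant_matY : IsEquivariant (matY α q) :=
  .sum _ fun _ _ g => act_cycBlock g _

variable (α q)

theorem restrict_cyc (c : PathAlg m) : (restrict α q).mapMatrix (cyc α c) = cycBlock α q c := by
  ext i j
  exact restrict_coord α q c _ _

theorem restrict_genX : (restrict α q).toRingHom.mapMatrix (genX α) = matX α q := by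
  change (restrict α q).mapMatrix (genX α) = matX α q
  rw [genX, sumX, map_sum, map_sum]
  exact Finset.sum_congr rfl fun _ _ => restrict_cyc α q _

theorem restrict_genY : (restrict α q).toRingHom.mapMatrix (genY α) = matY α q := by
  change (restrict α q).mapMatrix (genY α) = matY α q
  rw [genY, sumY, map_sum, map_sum]
  exact Finset.sum_congr rfl fun _ _ => restrict_cyc α q _

theorem restrict_oneAdd : (restrict α q).toRingHom.mapMatrix (1 + genX α * genY α) =
    1 + matX α q * matY α q := by
  rw [map_add, map_one, map_mul, restrict_genX, restrict_genY]

theorem isUnit_oneAdd_mat : IsUnit (1 + matX α q * matY α q) := by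
  rw [← restrict_oneAdd]
  exact isUnit_oneAdd_gen.map _

theorem isEquivariant_oneAdd : IsEquivariant (1 + matX α q * matY α q) :=
  isEquivariant_one.add (isEquivariant_matX.mul isEquivariant_matY)

theorem isEquivariant_oneAdd_zpow (k : ℤ) : IsEquivariant ((1 + matX α q * matY α q) ^ k) := by
  cases k with
  | ofNat k =>
    rw [Int.ofNat_eq_natCast, zpow_natCast]
    exact (isEquivariant_oneAdd α q).pow k
  | negSucc k =>
    rw [zpow_negSucc]
    exact ((isEquivariant_oneAdd α q).pow _).inv ((isUnit_oneAdd_mat α q).pow _)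

end Equivariance

/-! ### The three commuting families on the quiver variety -/

section CommutingTraces

/-- It is enough to find commuting lifts to Rep(A, α̃). The lifts need not be invariant; only their
restrictions must be. -/
theorem IsReducedBracket.commuting
    {br : QuiverVariety α q →ₗ[ℂ] QuiverVariety α q →ₗ[ℂ] QuiverVariety α q}
    (h : IsReducedBracket α q br) {J : Type} {H : J → RepPreproj α q} (f : J → RepA α)
    (hf : ∀ j, restrict α q (f j) = H j) (hH : ∀ j, H j ∈ QuiverVariety α q)
    (hff : ∀ j k, repBracket α (f j) (f k) = 0) : Commuting Subtype.val br H :=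
  ⟨fun j => ⟨H j, hH j⟩, fun _ => rfl, fun j k => Subtype.ext <| by
    rw [h (f j) (f k) _ _ (hf j) (hf k), hff, map_zero]; rfl⟩

variable {br : QuiverVariety α q →ₗ[ℂ] QuiverVariety α q →ₗ[ℂ] QuiverVariety α q}

theorem IsReducedBracket.commuting_trace_matX (h : IsReducedBracket α q br) (r : ℕ) :
    Commuting Subtype.val br (fun j : ℕ => (matX α q ^ (j * r)).trace) :=
  h.commuting (fun j => (genX α ^ (j * r)).trace)
    (fun j => by
      rw [← restrict_genX]
      exact map_trace_pow (restrict α q).toRingHom _ _)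
    (fun _ => (isEquivariant_matX.pow _).trace_mem)
    fun _ _ => repBracket_genX (hasTraceGradient_pow _ _) (hasTraceGradient_pow _ _)

theorem IsReducedBracket.commuting_trace_matY (h : IsReducedBracket α q br) (r : ℕ) :
    Commuting Subtype.val br (fun j : ℕ => (matY α q ^ (j * r)).trace) :=
  h.commuting (fun j => (genY α ^ (j * r)).trace)
    (fun j => by
      rw [← restrict_genY]
      exact map_trace_pow (restrict α q).toRingHom _ _)
    (fun _ => (isEquivariant_matY.pow _).trace_mem)
    fun _ _ => repBracket_genY (hasTraceGradient_pow _ _) (hasTraceGradient_pow _ _)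

theorem IsReducedBracket.commuting_trace_oneAdd (h : IsReducedBracket α q br) :
    Commuting Subtype.val br (fun j : ℤ => ((1 + matX α q * matY α q) ^ j).trace) :=
  h.commuting (fun j => ((1 + genX α * genY α) ^ j).trace)
    (fun j => by
      rw [← restrict_oneAdd]
      exact map_trace_zpow (restrict α q).toRingHom isUnit_oneAdd_gen j)
    (fun j => (isEquivariant_oneAdd_zpow α q j).trace_mem)
    fun _ _ => repBracket_oneAdd (hasTraceGradient_zpow isUnit_oneAdd_gen _)
      (hasTraceGradient_zpow isUnit_oneAdd_gen _)

end CommutingTraces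

end CyclicQuiver

namespace CyclicQuiver

open RepRing PathAlg Matrix Kronecker

section InverseSum

/-! ## The matrix `Y + X⁻¹` -/

theorem map_kronecker {R S n : Type*} [CommRing R] [CommRing S] (f : R →+* S)
    (A B : Matrix n n R) : (A ⊗ₖ B).map f = A.map f ⊗ₖ B.map f := by
  ext; simp

variable {R : Type*} [CommRing R] {n : Type*} [Fintype n] [DecidableEq n]

theorem mapMatrix_smul {S : Type*} [CommRing S] (f : R →+* S) (c : R) (U : Matrix n n R) :
    f.mapMatrix (c • U) = f c • f.mapMatrix U := by
  ext i j
  exact map_mul f c (U i j)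

theorem isUnit_add_inv {X Y : Matrix n n R} (hX : IsUnit X) (h : IsUnit (1 + X * Y)) :
    IsUnit (Y + X⁻¹) := by
  have hdet := (Matrix.isUnit_iff_isUnit_det X).1 hX
  have h1 : X * (Y + X⁻¹) = 1 + X * Y := by rw [mul_add, mul_nonsing_inv X hdet, add_comm]
  rw [← h1] at h
  rw [Matrix.isUnit_iff_isUnit_det, det_mul] at h
  exact (Matrix.isUnit_iff_isUnit_det _).2 (isUnit_of_mul_isUnit_right h)

/-- From X (Y + X⁻¹) = 1 + XY. The right-hand side contains no inverse of X, so negative powers of Y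
+ X⁻¹ have no pole along det X = 0. -/
theorem inv_add_inv {X Y : Matrix n n R} (hX : IsUnit X) (h : IsUnit (1 + X * Y)) :
    (Y + X⁻¹)⁻¹ = (1 + X * Y)⁻¹ * X := by
  have hdet := (Matrix.isUnit_iff_isUnit_det X).1 hX
  have h1 : 1 + X * Y = X * (Y + X⁻¹) := by rw [mul_add, mul_nonsing_inv X hdet, add_comm]
  refine inv_eq_left_inv ?_
  rw [mul_assoc, ← h1, nonsing_inv_mul _ ((Matrix.isUnit_iff_isUnit_det _).1 h)]

theorem det_smul_add_inv {X Y : Matrix n n R} (hX : IsUnit X) :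
    X.det • (Y + X⁻¹) = X.det • Y + X.adjugate := by
  have hdet := (Matrix.isUnit_iff_isUnit_det X).1 hX
  have h1 : X.adjugate * X * X⁻¹ = X.det • X⁻¹ := by
    rw [adjugate_mul, smul_mul_assoc, one_mul]
  rw [smul_add, ← h1, mul_assoc, mul_nonsing_inv X hdet, mul_one]

end InverseSum

/-! ### Transfer of brackets to localizations -/

section Localization

variable {R S : Type} [CommRing R] [CommRing S] [Algebra ℂ R] [Algebra ℂ S] [Algebra R S]
  [IsScalarTower ℂ R S] (d : R) [IsLocalization.Away d S] {n : Type*}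

theorem HasBracket.localize {B : Derivation ℂ R (Derivation ℂ R R)} {U V : Matrix n n R}
    {ξ : Matrix (n × n) (n × n) R} (h : HasBracket B U V ξ) :
    HasBracket (extendBracket S d B) (U.map (algebraMap R S)) (V.map (algebraMap R S))
      (ξ.map (algebraMap R S)) := fun i j u v => by
  simp only [Matrix.map_apply, extendBracket_algebraMap, h i j u v]

/-- Compatibility of two derivations along ring homomorphisms passes to quotients. -/
theorem leibniz_cancel {O R S : Type*} [CommRing O] [CommRing R] [CommRing S] (p : O →+* S)
    (ρ : R →+* S) {D : O → O} {D' : R → R} (hD : ∀ G H, D (G * H) = G * D H + D G * H)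
    (hD' : ∀ G H, D' (G * H) = G * D' H + D' G * H) {G E : O} {G' E' : R}
    (hG : p G = ρ G') (hE : p E = ρ E') (hu : IsUnit (p E)) (h1 : p (D E) = ρ (D' E'))
    (h2 : p (D (G * E)) = ρ (D' (G' * E'))) : p (D G) = ρ (D' G') := by
  rw [hD, hD', map_add, map_add, map_mul, map_mul, map_mul, map_mul, h1, hG] at h2
  have h3 := add_left_cancel h2
  rw [← hE] at h3
  exact hu.mul_right_cancel h3

end Localization

variable {m : ℕ} [NeZero m] (α : ZMod m → ℕ) (q : ZMod m → ℂˣ)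

/-! ### The bracket on the open subset where X is invertible -/

section OpenSubset

/-- The coordinate ring of the open subset of `Rep(A, α̃)` on which `X` is invertible. -/
abbrev RepA₀ : Type := Localization.Away (genX α).det

/-- The bracket on the open subset of `Rep(A, α̃)` on which `X` is invertible. -/
noncomputable def repBracket₀ : Derivation ℂ (RepA₀ α) (Derivation ℂ (RepA₀ α) (RepA₀ α)) :=
  extendBracket (RepA₀ α) (genX α).det (repBracket α)

theorem restrict_det_genX : restrict α q (genX α).det = detX α q := by
  rw [AlgHom.map_det]
  exact congrArg det (restrict_genX α q)

theorem isUnit_algebraMap_restrict_det :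
    IsUnit (((algebraMap (RepPreproj α q) (RepPreproj₀ α q)).comp (restrict α q).toRingHom)
      (genX α).det) := by
  have h : (restrict α q).toRingHom (genX α).det = detX α q := restrict_det_genX α q
  rw [RingHom.comp_apply, h]
  exact IsLocalization.Away.algebraMap_isUnit _

/-- The restriction of functions, on the open subsets on which `X` is invertible. -/
noncomputable def restrict₀ : RepA₀ α →+* RepPreproj₀ α q :=
  IsLocalization.Away.lift (genX α).det (isUnit_algebraMap_restrict_det α q)

theorem restrict₀_algebraMap (f : RepA α) :
    restrict₀ α q (algebraMap _ _ f) = algebraMap _ _ (restrict α q f) :=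
  IsLocalization.Away.lift_eq _ (isUnit_algebraMap_restrict_det α q) f

theorem pullback₀_algebraMap (F : QuiverVariety α q) :
    pullback₀ α q (algebraMap _ _ F) = algebraMap _ _ (F : RepPreproj α q) :=
  IsLocalization.map_eq (M := Submonoid.powers (detX α q))
    (T := Submonoid.powers ((QuiverVariety α q).val.toRingHom (detX α q)))
    (Q := Localization.Away ((QuiverVariety α q).val.toRingHom (detX α q)))
    (by rw [Submonoid.powers_le]; exact Submonoid.mem_powers _) F

/-- Localization keeps the inclusion of the invariants injective: a numerator that vanishes upstairs
is killed by a power of det X, which is itself invariant, so it is killed already among the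
invariants. -/
theorem pullback₀_injective : Function.Injective (pullback₀ α q) := by
  rw [injective_iff_map_eq_zero]
  intro F hF
  obtain ⟨k, f, hf⟩ := IsLocalization.Away.surj (detX α q) F
  have hu : IsUnit (algebraMap (QuiverVariety α q) (QuiverVariety₀ α q) (detX α q) ^ k) :=
    (IsLocalization.Away.algebraMap_isUnit _).pow k
  have h1 : algebraMap (RepPreproj α q) (RepPreproj₀ α q) (f : RepPreproj α q) = 0 := by
    rw [← pullback₀_algebraMap, ← hf, map_mul, hF, zero_mul]
  obtain ⟨⟨_, l, rfl⟩, hl⟩ := (IsLocalization.map_eq_zero_iff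
    (Submonoid.powers (detX α q : RepPreproj α q)) _ _).1 h1
  have h2 : detX α q ^ l * f = 0 := Subtype.ext hl
  have h3 : algebraMap (QuiverVariety α q) (QuiverVariety₀ α q) f = 0 :=
    (IsLocalization.map_eq_zero_iff (Submonoid.powers (detX α q)) _ _).2 ⟨⟨_, l, rfl⟩, h2⟩
  rw [h3] at hf
  exact (hu.mul_left_eq_zero).1 hf

/-- The function `F` on `M⁰_{α,q}` and the function `f` are related by a fraction with an
invariant numerator. -/
def IsInvariantLift (F : QuiverVariety₀ α q) (f : RepA₀ α) : Prop :=
  ∃ (k : ℕ) (G : QuiverVariety α q) (g : RepA α), restrict α q g = G ∧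
    F * algebraMap _ _ (detX α q ^ k) = algebraMap _ _ G ∧
    f * algebraMap _ _ ((genX α).det ^ k) = algebraMap _ _ g

variable {α q}

theorem isUnit_pullback₀_detX_pow (k : ℕ) :
    IsUnit (pullback₀ α q (algebraMap _ _ (detX α q ^ k))) := by
  rw [map_pow, map_pow]
  exact ((IsLocalization.Away.algebraMap_isUnit (detX α q)).map _).pow k

theorem pullback₀_eq_restrict₀ {G : QuiverVariety α q} {g : RepA α} (h : restrict α q g = G) :
    pullback₀ α q (algebraMap _ _ G) = restrict₀ α q (algebraMap _ _ g) := by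
  rw [pullback₀_algebraMap, restrict₀_algebraMap, h]

theorem restrict_det_pow (k : ℕ) :
    restrict α q ((genX α).det ^ k) = ((detX α q ^ k : QuiverVariety α q) : RepPreproj α q) := by
  rw [map_pow, restrict_det_genX]; rfl

theorem IsInvariantLift.pullback₀_eq {F : QuiverVariety₀ α q} {f : RepA₀ α}
    (h : IsInvariantLift α q F f) : pullback₀ α q F = restrict₀ α q f := by
  obtain ⟨k, G, g, hg, hF, hf⟩ := h
  have h1 := pullback₀_eq_restrict₀ hg
  rw [← hF, ← hf, map_mul, map_mul, ← pullback₀_eq_restrict₀ (restrict_det_pow k)] at h1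
  exact (isUnit_pullback₀_detX_pow k).mul_right_cancel h1

/-- For functions without denominators this is the defining property of the reduced bracket.
Denominators are introduced first in the second argument and then in the first; each time the
Leibniz rule on both sides lets the invertible power of det X be cancelled (`leibniz_cancel`). -/
theorem IsExtendedBracket.pullback₀_eq
    {br : QuiverVariety α q →ₗ[ℂ] QuiverVariety α q →ₗ[ℂ] QuiverVariety α q}
    {br₀ : QuiverVariety₀ α q →ₗ[ℂ] QuiverVariety₀ α q →ₗ[ℂ] QuiverVariety₀ α q}
    (h : IsReducedBracket α q br) (h₀ : IsExtendedBracket α q br br₀)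
    {F G : QuiverVariety₀ α q} {f g : RepA₀ α} (hF : IsInvariantLift α q F f)
    (hG : IsInvariantLift α q G g) :
    pullback₀ α q (br₀ F G) = restrict₀ α q (repBracket₀ α f g) := by
  have h1 : ∀ {F G : QuiverVariety α q} {f g : RepA α}, restrict α q f = F → restrict α q g = G →
      pullback₀ α q (br₀ (algebraMap _ _ F) (algebraMap _ _ G)) =
        restrict₀ α q (repBracket₀ α (algebraMap _ _ f) (algebraMap _ _ g)) := by
    intro F G f g hF hG
    rw [h₀.extends_br, repBracket₀, extendBracket_algebraMap]
    exact pullback₀_eq_restrict₀ (h f g F G hF hG).symm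
  have h2 : ∀ {F : QuiverVariety α q} {f : RepA α}, restrict α q f = F →
      pullback₀ α q (br₀ (algebraMap _ _ F) G) =
        restrict₀ α q (repBracket₀ α (algebraMap _ _ f) g) := by
    intro F f hF
    obtain ⟨k, G', g', hg', hG', hgg'⟩ := id hG
    refine leibniz_cancel (pullback₀ α q) (restrict₀ α q) (h₀.mul_right _)
      (D' := fun g => repBracket₀ α (algebraMap _ _ f) g) ?_ hG.pullback₀_eq
      (pullback₀_eq_restrict₀ (restrict_det_pow k)) (isUnit_pullback₀_detX_pow k)
      (h1 hF (restrict_det_pow k)) ?_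
    · intro G H
      rw [Derivation.leibniz, smul_eq_mul, smul_eq_mul, mul_comm H]
    · rw [hG']
      rw [hgg']
      exact h1 hF hg'
  obtain ⟨k, F', f', hf', hF', hff'⟩ := id hF
  refine leibniz_cancel (pullback₀ α q) (restrict₀ α q) (D := fun F => br₀ F G)
    (fun F H => h₀.mul_left F H G) (D' := fun f => repBracket₀ α f g) ?_ hF.pullback₀_eq
    (pullback₀_eq_restrict₀ (restrict_det_pow k)) (isUnit_pullback₀_detX_pow k)
    (h2 (restrict_det_pow k)) ?_
  · intro F H
    rw [Derivation.leibniz, mul_comm _ H]; rfl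
  · rw [hF', hff']
    exact h2 hf'

/-- The matrix `X` on the open subset of `Rep(A, α̃)` on which it is invertible. -/
noncomputable def genX₀ (α : ZMod m → ℕ) : Matrix (CycIdx α) (CycIdx α) (RepA₀ α) :=
  (genX α).map (algebraMap _ _)

/-- The matrix `Y` on the open subset of `Rep(A, α̃)` on which `X` is invertible. -/
noncomputable def genY₀ (α : ZMod m → ℕ) : Matrix (CycIdx α) (CycIdx α) (RepA₀ α) :=
  (genY α).map (algebraMap _ _)

/-- The projection of `𝒱` onto `𝒱_i`. -/
noncomputable def genE₀ (α : ZMod m → ℕ) (i : ZMod m) :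
    Matrix (CycIdx α) (CycIdx α) (RepA₀ α) :=
  (genE α i).map (algebraMap _ _)

theorem det_genX₀ : (genX₀ α).det = algebraMap _ _ (genX α).det :=
  (RingHom.map_det _ _).symm

theorem isUnit_genX₀ : IsUnit (genX₀ α) := by
  rw [Matrix.isUnit_iff_isUnit_det, det_genX₀]
  exact IsLocalization.Away.algebraMap_isUnit _

theorem map_oneAdd_gen :
    (algebraMap (RepA α) (RepA₀ α)).mapMatrix (1 + genX α * genY α) =
      1 + genX₀ α * genY₀ α := by
  rw [map_add, map_one, map_mul]; rfl

theorem isUnit_oneAdd_gen₀ : IsUnit (1 + genX₀ α * genY₀ α) := by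
  rw [← map_oneAdd_gen]
  exact isUnit_oneAdd_gen.map _

/-- The matrix `Y + X⁻¹` on the open subset of `Rep(A, α̃)` on which `X` is invertible. -/
noncomputable def genZ (α : ZMod m → ℕ) : Matrix (CycIdx α) (CycIdx α) (RepA₀ α) :=
  genY₀ α + (genX₀ α)⁻¹

theorem isUnit_genZ : IsUnit (genZ α) := isUnit_add_inv isUnit_genX₀ isUnit_oneAdd_gen₀

/-- The brackets among X and Y are carried over to the localization, and `HasBracket.add_inv`
applies with the shift i ↦ i + 1 as the permutation of the vertices. -/
theorem hasBracket_genZ : HasBracket (repBracket₀ α) (genZ α) (genZ α)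
    ((-(1 / 2) : ℂ) • ∑ i, (genE₀ α i ⊗ₖ (genZ α * genE₀ α i * genZ α) -
      (genZ α * genE₀ α i * genZ α) ⊗ₖ genE₀ α i)) := by
  have hdet := (Matrix.isUnit_iff_isUnit_det _).1 (isUnit_genX₀ (α := α))
  let ψ : Matrix (CycIdx α × CycIdx α) (CycIdx α × CycIdx α) (RepA α) →ₐ[ℂ]
      Matrix (CycIdx α × CycIdx α) (CycIdx α × CycIdx α) (RepA₀ α) :=
    (IsScalarTower.toAlgHom ℂ (RepA α) (RepA₀ α)).mapMatrix
  have hψ : ∀ ξ, ξ.map (algebraMap (RepA α) (RepA₀ α)) = ψ ξ := fun _ => rfl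
  have hk : ∀ A B, ψ (A ⊗ₖ B) =
      A.map (algebraMap (RepA α) (RepA₀ α)) ⊗ₖ B.map (algebraMap (RepA α) (RepA₀ α)) :=
    fun A B => map_kronecker (algebraMap (RepA α) (RepA₀ α)) A B
  have hXX := (hasBracket_genX_genX (α := α)).localize (S := RepA₀ α) (genX α).det
  have hYY := (hasBracket_genY_genY (α := α)).localize (S := RepA₀ α) (genX α).det
  have hXY := (hasBracket_genX_genY (α := α)).localize (S := RepA₀ α) (genX α).det
  simp only [hψ, map_smul, map_sum, map_sub, map_add, hk, Matrix.map_mul] at hXX hYY hXY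
  have heX : ∀ i, genE₀ α i * genX₀ α = genX₀ α * genE₀ α (i + 1) := fun i => by
    rw [genE₀, genX₀, ← Matrix.map_mul, genE_mul_genX, Matrix.map_mul]; rfl
  have heY : ∀ i, genE₀ α (i + 1) * genY₀ α = genY₀ α * genE₀ α i := fun i => by
    rw [genE₀, genY₀, ← Matrix.map_mul, genE_mul_genY, Matrix.map_mul]; rfl
  exact HasBracket.add_inv (e := genE₀ α) (Equiv.addRight 1)
    (fun f g => extendBracket_antisymm _ repBracket_antisymm f g)
    (mul_nonsing_inv _ hdet) (nonsing_inv_mul _ hdet) heX heY hXX hYY hXY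

theorem repBracket₀_genZ {f g : RepA₀ α} (hf : HasTraceGradient (genZ α) f)
    (hg : HasTraceGradient (genZ α) g) : repBracket₀ α f g = 0 :=
  hasBracket_genZ.commute hf hg

end OpenSubset

end CyclicQuiver

namespace CyclicQuiver

open RepRing PathAlg Matrix

/-! ### Traces of powers of Y + X⁻¹ -/

section OpenSubsetTraces

variable {m : ℕ} [NeZero m] (α : ZMod m → ℕ) (q : ZMod m → ℂˣ)

theorem isUnit_map_matX :
    IsUnit ((matX α q).map (algebraMap (RepPreproj α q) (RepPreproj₀ α q))) := by
  have h : ((matX α q).map (algebraMap (RepPreproj α q) (RepPreproj₀ α q))).det =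
    algebraMap _ _ (detX α q : RepPreproj α q) := (RingHom.map_det _ _).symm
  rw [Matrix.isUnit_iff_isUnit_det, h]
  exact IsLocalization.Away.algebraMap_isUnit _

theorem isUnit_matZ : IsUnit (matZ α q) := by
  refine isUnit_add_inv (isUnit_map_matX α q) ?_
  have := (isUnit_oneAdd_mat α q).map
    (algebraMap (RepPreproj α q) (RepPreproj₀ α q)).mapMatrix
  rwa [map_add, map_one, map_mul] at this

theorem restrict₀_genX₀ : (restrict₀ α q).mapMatrix (genX₀ α) =
    (matX α q).map (algebraMap (RepPreproj α q) (RepPreproj₀ α q)) := by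
  rw [← restrict_genX]
  ext i j
  exact restrict₀_algebraMap α q _

theorem restrict₀_genY₀ : (restrict₀ α q).mapMatrix (genY₀ α) =
    (matY α q).map (algebraMap (RepPreproj α q) (RepPreproj₀ α q)) := by
  rw [← restrict_genY]
  ext i j
  exact restrict₀_algebraMap α q _

theorem restrict₀_genZ : (restrict₀ α q).mapMatrix (genZ α) = matZ α q := by
  rw [genZ, map_add, mapMatrix_inv _ isUnit_genX₀, restrict₀_genX₀, restrict₀_genY₀, matZ]

/-- The traces of powers of `Y + X⁻¹` are fractions with invariant numerators. -/
theorem exists_trace_genZ_zpow (n : ℤ) :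
    ∃ (k : ℕ) (g : RepA α), restrict α q g ∈ QuiverVariety α q ∧
      (genZ α ^ n).trace * algebraMap (RepA α) (RepA₀ α) ((genX α).det ^ k) =
        algebraMap (RepA α) (RepA₀ α) g := by
  let ι := algebraMap (RepA α) (RepA₀ α)
  obtain ⟨k, rfl | rfl⟩ := n.eq_nat_or_neg
  -- For exponent k ≥ 0, (det X)^k clears the denominators, because det X · X⁻¹ is the adjugate of X
  -- and hence regular.
  · refine ⟨k, (((genX α).det • genY α + (genX α).adjugate) ^ k).trace, ?_, ?_⟩
    · have h : restrict α q (((genX α).det • genY α + (genX α).adjugate) ^ k).trace =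
          (((detX α q : RepPreproj α q) • matY α q + (matX α q).adjugate) ^ k).trace := by
        refine (map_trace_pow (restrict α q).toRingHom _ k).trans ?_
        congr 2
        rw [map_add, RingHom.map_adjugate, mapMatrix_smul, restrict_genX, restrict_genY,
          ← restrict_det_genX]
        rfl
      rw [h]
      exact (((isEquivariant_matY.smul (detX α q).2).add
        isEquivariant_matX.adjugate).pow k).trace_mem
    · have h : ι (((genX α).det • genY α + (genX α).adjugate) ^ k).trace =
          (((genX₀ α).det • genY₀ α + (genX₀ α).adjugate) ^ k).trace := by
        refine (map_trace_pow ι _ k).trans ?_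
        congr 2
        rw [map_add, RingHom.map_adjugate, mapMatrix_smul, det_genX₀]
        rfl
      change _ = ι _
      rw [h, ← det_smul_add_inv isUnit_genX₀, smul_pow, trace_smul, zpow_natCast, map_pow,
        ← det_genX₀, smul_eq_mul, mul_comm]
      rfl
  -- For exponent -k no denominator is needed, as (Y + X⁻¹)⁻¹ = (1 + XY)⁻¹ X is regular.
  · refine ⟨0, (((1 + genX α * genY α)⁻¹ * genX α) ^ k).trace, ?_, ?_⟩
    · have h : restrict α q (((1 + genX α * genY α)⁻¹ * genX α) ^ k).trace =
          (((1 + matX α q * matY α q)⁻¹ * matX α q) ^ k).trace := by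
        refine (map_trace_pow (restrict α q).toRingHom _ k).trans ?_
        rw [map_mul, mapMatrix_inv _ isUnit_oneAdd_gen, restrict_oneAdd, restrict_genX]
      rw [h]
      exact ((((isEquivariant_oneAdd α q).inv (isUnit_oneAdd_mat α q)).mul
        isEquivariant_matX).pow k).trace_mem
    · have h : ι (((1 + genX α * genY α)⁻¹ * genX α) ^ k).trace =
          (((1 + genX₀ α * genY₀ α)⁻¹ * genX₀ α) ^ k).trace := by
        refine (map_trace_pow ι _ k).trans ?_
        rw [map_mul, mapMatrix_inv _ isUnit_oneAdd_gen, map_oneAdd_gen]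
        rfl
      change _ = ι _
      rw [h, pow_zero, map_one, mul_one, Matrix.zpow_neg_natCast, ← inv_pow', genZ,
        inv_add_inv isUnit_genX₀ isUnit_oneAdd_gen₀]

variable {α q}

/-- Every integer power of Z has an invariant lift of its trace, so the brackets can be computed on
the open subset of Rep(A, α̃), where they vanish by `repBracket₀_genZ`; injectivity of the pull-back
brings the vanishing down to M⁰. The argument works for every step r of the exponents. -/
theorem IsExtendedBracket.commuting_trace_matZ
    {br : QuiverVariety α q →ₗ[ℂ] QuiverVariety α q →ₗ[ℂ] QuiverVariety α q}
    {br₀ : QuiverVariety₀ α q →ₗ[ℂ] QuiverVariety₀ α q →ₗ[ℂ] QuiverVariety₀ α q}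
    (h : IsReducedBracket α q br) (h₀ : IsExtendedBracket α q br br₀) (r : ℤ) :
    Commuting (pullback₀ α q) br₀ (fun j : ℤ => (matZ α q ^ (j * r)).trace) := by
  have hlift : ∀ n : ℤ, ∃ F, IsInvariantLift α q F (genZ α ^ n).trace := fun n => by
    obtain ⟨k, g, hg, hgk⟩ := exists_trace_genZ_zpow α q n
    let G : QuiverVariety α q := ⟨_, hg⟩
    exact ⟨IsLocalization.mk' (QuiverVariety₀ α q) G
      (⟨detX α q ^ k, k, rfl⟩ : Submonoid.powers (detX α q)), k, G, g, rfl,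
      IsLocalization.mk'_spec _ _ _, hgk⟩
  choose F hF using hlift
  refine ⟨fun j => F (j * r), fun j => ?_, fun j k => ?_⟩
  · rw [(hF _).pullback₀_eq, map_trace_zpow _ isUnit_genZ, restrict₀_genZ]
  · refine pullback₀_injective α q ?_
    rw [h₀.pullback₀_eq h (hF _) (hF _), repBracket₀_genZ (hasTraceGradient_zpow isUnit_genZ _)
      (hasTraceGradient_zpow isUnit_genZ _), map_zero, map_zero]

end OpenSubsetTraces

end CyclicQuiver

open CyclicQuiver

theorem theorem4p3 (m : ℕ) [NeZero m] (hm : 2 ≤ m) (α : ZMod m → ℕ) (q : ZMod m → ℂˣ) :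
    (∃! br, IsReducedBracket α q br) ∧
    IsUnit (1 + matX α q * matY α q) ∧ IsUnit (matZ α q) ∧
    ∀ br, IsReducedBracket α q br →
      Commuting Subtype.val br (fun j : ℕ => (matX α q ^ (j * m)).trace) ∧
      Commuting Subtype.val br (fun j : ℕ => (matY α q ^ (j * m)).trace) ∧
      Commuting Subtype.val br (fun j : ℤ => ((1 + matX α q * matY α q) ^ j).trace) ∧
      (∃! br₀, IsExtendedBracket α q br br₀) ∧
      ∀ br₀, IsExtendedBracket α q br br₀ →
        Commuting (pullback₀ α q) br₀ (fun j : ℤ => (matZ α q ^ (j * (m : ℤ))).trace) := by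
  obtain ⟨br, hbr⟩ := exists_isReducedBracket α q
  refine ⟨⟨br, hbr, fun _ h => h.unique hbr⟩, isUnit_oneAdd_mat α q, isUnit_matZ α q,
    fun br h => ⟨h.commuting_trace_matX m, h.commuting_trace_matY m, h.commuting_trace_oneAdd,
      ?_, fun br₀ h₀ => h₀.commuting_trace_matZ h m⟩⟩
  obtain ⟨br₀, h₀⟩ := h.exists_extended
  exact ⟨br₀, h₀, fun _ h => h.unique h₀⟩
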